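/- Fix a smooth function $\psi:[0,\infty)\to[0,1]$ with $\psi(t)=t^2$ for $t\le\frac12$, $\psi'(t)>0$ for $0<t<\frac32$, $\psi(t)=1$ for $t\ge\frac32$, $0\le\psi''(t)\le2$ for $t\le\frac{\sqrt2}2$, and $\psi''(t)\le0$ for $t\ge\frac{\sqrt2}2$. Let $T\subset\mathbb R^n$ be a finite linearly embedded tree (vertices are points, edges are straight segments, distinct edges meet only in common endpoints). Put $\Phi_T(x)=0$ if $x$ is a vertex of $T$, and otherwise $$\Phi_T(x)=\frac{\prod_{E}\psi(d(x,E))}{\prod_{v}\psi(\|x-v\|)^{\mathrm{val}(v)-1}},$$ where $E$ runs over the edges and $v$ over the vertices of $T$, $d$ is the Euclidean distance and $\mathrm{val}(v)$ is the valence of $v$. Put $W(T)=\Phi_T^{-1}[0,\frac14]$. Call $T$ taut if (1) at each vertex that is not a leaf some linear combination, with positive coefficients, of the unit vectors pointing along the edges away from the vertex is zero; (2) $T$ has no bivalent vertex; (3) any two edges of an embedded path in $T$, oriented along the path, have nonnegative dot product. A smooth $\Delta^k$-family of linearly embedded trees $T(t)\subset\mathbb R^n$, $t\in\Delta^k$,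 is a fixed finite tree $T_0$ with maps $f_t:T_0\to T(t)$, linear on edges, sending vertices to vertices, such that the inverse image of each vertex is a tree, the inverse image of each open edge is one open edge, no external edge of $T_0$ is collapsed, and $f_t(v)\in\mathbb R^n$ depends smoothly on $t$ for each vertex $v$ of $T_0$. **Proposition.** (a) If $T\subset\mathbb R^n$ is taut, then $W(T)$ is a compact $C^1$ $n$-manifold thickening of $T$: it is a compact $n$-dimensional $C^1$ submanifold of $\mathbb R^n$ with boundary, contains $T$ in its interior, and has $T$ as a strong deformation retract. (b) Let $T(t)$, $t\in\Delta^k$, be a smooth $\Delta^k$-family of linearly embedded trees, all of them taut. Then $W(T(t))$ varies continuously with $t$ in the $C^1$ topology: for each $t_0\in\Delta^k$ there is a bijection over $\Delta^k$ from $W(T(t_0))\times\Delta^k$ to $E(W)=\{(x,t):t\in\Delta^k,\ x\in W(T(t))\}$ such that it and its inverse are continuous, are $C^1$ along the fibers, and have fiberwise derivatives that are jointly continuous in the point and $t$. Moreover $E(T)=\{(x,t):t\in\Delta^k,\ x\in T(t)\}$ is a fiberwise strong deformation retract of $E(W)$. (c) If in (b) moreover for every edge $vw$ of $T_0$ one can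 write $f_t(w)-f_t(v)=\lambda(t)\,\omega(t)$ with smooth $\lambda:\Delta^k\to[0,\infty)$ and smooth $\omega:\Delta^k\to\mathbb R^n\setminus\{0\}$ (automatic for an edge that is never collapsed), then for each $t_0\in\Delta^k$ there is a bijection over $\Delta^k$ from $W(T(t_0))\times\Delta^k$ to $E(W)$ that is $C^1$ jointly in all variables, as is its inverse. -/

import Mathlib

open Set Topology
open scoped ContDiff RealInnerProductSpace

noncomputable section

namespace TreeThickening

/-- Euclidean space `ℝⁿ`. -/
abbrev Euc (n : ℕ) : Type := EuclideanSpace ℝ (Fin n)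

/-- The standard simplex `Δᵏ`, as a subset of `ℝᵏ⁺¹` (barycentric coordinates). -/
abbrev simplex (k : ℕ) : Set (Fin (k + 1) → ℝ) := stdSimplex ℝ (Fin (k + 1))

/-- The smooth cut-off functions `ψ : [0,∞) → [0,1]` used in the construction. Only the values of
`ψ` on `[0,∞)` matter; the derivatives are taken at points of the open half line. -/
structure IsProfile (ψ : ℝ → ℝ) : Prop where
  smooth : ContDiffOn ℝ ∞ ψ (Ici 0)
  mapsTo : MapsTo ψ (Ici 0) (Icc 0 1)
  eq_sq : ∀ t, 0 ≤ t → t ≤ 1 / 2 → ψ t = t ^ 2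
  deriv_pos : ∀ t, 0 < t → t < 3 / 2 → 0 < deriv ψ t
  eq_one : ∀ t, 3 / 2 ≤ t → ψ t = 1
  deriv2_mem : ∀ t, 0 < t → t ≤ √2 / 2 → deriv (deriv ψ) t ∈ Icc (0 : ℝ) 2
  deriv2_nonpos : ∀ t, √2 / 2 ≤ t → deriv (deriv ψ) t ≤ 0

/-- The straight segment spanned by an (unordered) pair of points of a finite set of points. -/
def edgeSegment {n : ℕ} {S : Finset (Euc n)} (e : Sym2 S) : Set (Euc n) :=
  convexHull ℝ ((fun v : S => (v : Euc n)) '' {v | v ∈ e})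

/-- A finite tree linearly embedded in `ℝⁿ`: the vertices are points of `ℝⁿ`, the edges are straight
segments, and two distinct edges meet at most in common endpoints. -/
structure LinearTree (n : ℕ) where
  verts : Finset (Euc n)
  graph : SimpleGraph verts
  isTree : graph.IsTree
  embedded : ∀ e ∈ graph.edgeSet, ∀ e' ∈ graph.edgeSet, e ≠ e' →
    edgeSegment e ∩ edgeSegment e' ⊆ (fun v : verts => (v : Euc n)) '' {v | v ∈ e ∧ v ∈ e'}

namespace LinearTree

variable {n : ℕ}

/-- The tree as a subset of `ℝⁿ`. -/
def carrier (T : LinearTree n) : Set (Euc n) :=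
  (T.verts : Set (Euc n)) ∪ ⋃ e ∈ T.graph.edgeSet, edgeSegment e

open Classical in
/-- Taut trees. The balancing condition is imposed at the vertices that are not leaves (it can never
hold at a leaf). -/
structure IsTaut (T : LinearTree n) : Prop where
  balanced : ∀ v : T.verts, T.graph.degree v ≠ 1 →
    ∃ c : T.verts → ℝ, (∀ w, T.graph.Adj v w → 0 < c w) ∧
      ∑ w ∈ T.graph.neighborFinset v,
        c w • (‖(w : Euc n) - (v : Euc n)‖⁻¹ • ((w : Euc n) - (v : Euc n))) = 0
  not_bivalent : ∀ v : T.verts, T.graph.degree v ≠ 2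
  angle : ∀ (v w : T.verts) (p : T.graph.Walk v w), p.IsPath → ∀ d ∈ p.darts, ∀ d' ∈ p.darts,
    0 ≤ ⟪(d.snd : Euc n) - (d.fst : Euc n), (d'.snd : Euc n) - (d'.fst : Euc n)⟫

open Classical in
/-- The function `Φ_T`. The distance from `x` to the closest point of an edge is `Metric.infDist`;
the exponent is an integer, since it is `-1` for a tree consisting of a single vertex. -/
def Phi (ψ : ℝ → ℝ) (T : LinearTree n) (x : Euc n) : ℝ :=
  if x ∈ T.verts then 0 else
    (∏ e ∈ T.graph.edgeFinset, ψ (Metric.infDist x (edgeSegment e))) /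
      ∏ v : T.verts, ψ ‖x - (v : Euc n)‖ ^ ((T.graph.degree v : ℤ) - 1)

/-- `W(T) = Φ_T⁻¹[0,1/4]`. -/
def W (ψ : ℝ → ℝ) (T : LinearTree n) : Set (Euc n) :=
  T.Phi ψ ⁻¹' Icc 0 (1 / 4)

end LinearTree

/-- `M ⊆ ℝⁿ` is an `n`-dimensional `C¹` submanifold with boundary: near each of its points, `M` is
either all of `ℝⁿ` or is carried to a closed half space by a local `C¹` diffeomorphism of `ℝⁿ`. -/
def IsC1DomainWithBoundary {n : ℕ} (M : Set (Euc n)) : Prop :=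
  ∀ x ∈ M, x ∈ interior M ∨
    ∃ (e : OpenPartialHomeomorph (Euc n) (Euc n)) (l : Euc n →L[ℝ] ℝ),
      x ∈ e.source ∧ ContDiffOn ℝ 1 e e.source ∧ ContDiffOn ℝ 1 e.symm e.target ∧ l ≠ 0 ∧
      e.source ∩ M = e.source ∩ e ⁻¹' {y | 0 ≤ l y}

/-- `A` is a (strong) deformation retract of `M`. -/
def IsDeformationRetract {X : Type*} [TopologicalSpace X] (A M : Set X) : Prop :=
  A ⊆ M ∧ ∃ H : ℝ × X → X, ContinuousOn H (Icc 0 1 ×ˢ M) ∧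
    (∀ s ∈ Icc (0 : ℝ) 1, ∀ x ∈ M, H (s, x) ∈ M) ∧
    (∀ x ∈ M, H (0, x) = x) ∧ (∀ x ∈ M, H (1, x) ∈ A) ∧
    (∀ s ∈ Icc (0 : ℝ) 1, ∀ x ∈ A, H (s, x) = x)

/-- `M` is a compact `C¹` `n`-manifold thickening of `A ⊆ ℝⁿ`: a compact `n`-dimensional `C¹`
submanifold with boundary which is a neighbourhood of `A` and deformation retracts to `A`. -/
structure IsC1Thickening {n : ℕ} (A M : Set (Euc n)) : Prop where
  compact : IsCompact M
  manifold : IsC1DomainWithBoundary M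
  subset_interior : A ⊆ interior M
  retract : IsDeformationRetract A M

/-- The total space of a family of subsets `A t ⊆ X`, `t ∈ D`. -/
def totalSpace {X P : Type*} (D : Set P) (A : P → Set X) : Set (X × P) :=
  {q | q.2 ∈ D ∧ q.1 ∈ A q.2}

/-- The total space of `A` over `D` is a fiberwise (strong) deformation retract of that of `M`. -/
def IsFiberwiseDeformationRetract {X P : Type*} [TopologicalSpace X] [TopologicalSpace P]
    (D : Set P) (A M : P → Set X) : Prop :=
  (∀ t ∈ D, A t ⊆ M t) ∧
  ∃ H : ℝ × X × P → X, ContinuousOn H (Icc 0 1 ×ˢ totalSpace D M) ∧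
    (∀ s ∈ Icc (0 : ℝ) 1, ∀ t ∈ D, ∀ x ∈ M t, H (s, x, t) ∈ M t) ∧
    (∀ t ∈ D, ∀ x ∈ M t, H (0, x, t) = x) ∧ (∀ t ∈ D, ∀ x ∈ M t, H (1, x, t) ∈ A t) ∧
    (∀ s ∈ Icc (0 : ℝ) 1, ∀ t ∈ D, ∀ x ∈ A t, H (s, x, t) = x)

/-- `F` and `G` are mutually inverse bijections over `D` between the product `M₀ × D` and the total
space of the family `M`. -/
structure IsTrivialization {X P : Type*} (D : Set P) (M₀ : Set X) (M : P → Set X)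
    (F G : X × P → X) : Prop where
  mapsTo : ∀ t ∈ D, ∀ x ∈ M₀, F (x, t) ∈ M t
  mapsTo_inv : ∀ t ∈ D, ∀ y ∈ M t, G (y, t) ∈ M₀
  left_inv : ∀ t ∈ D, ∀ x ∈ M₀, G (F (x, t), t) = x
  right_inv : ∀ t ∈ D, ∀ y ∈ M t, F (G (y, t), t) = y

/-- On the total space of `M` over `D`, the map `F` is continuous and is `C¹` along the fibers, with
a fiberwise derivative which is continuous on the total space. -/
def IsFiberwiseC1 {X P : Type*} [NormedAddCommGroup X] [NormedSpace ℝ X] [TopologicalSpace P]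
    (D : Set P) (M : P → Set X) (F : X × P → X) : Prop :=
  ContinuousOn F (totalSpace D M) ∧
  ∃ F' : X × P → X →L[ℝ] X, ContinuousOn F' (totalSpace D M) ∧
    ∀ t ∈ D, ∀ x ∈ M t, HasFDerivWithinAt (fun y => F (y, t)) (F' (x, t)) (M t) x

/-- The family `M t`, `t ∈ D`, varies continuously in the `C¹` topology: over `D` it is isomorphic
to the product family with any of its fibers, through `C¹` diffeomorphisms of the fibers that,
together with their inverses, depend continuously on `t` in the `C¹` topology. -/
def VariesContinuouslyInC1 {X P : Type*} [NormedAddCommGroup X] [NormedSpace ℝ X]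
    [TopologicalSpace P] (D : Set P) (M : P → Set X) : Prop :=
  ∀ t₀ ∈ D, ∃ F G : X × P → X, IsTrivialization D (M t₀) M F G ∧
    IsFiberwiseC1 D (fun _ => M t₀) F ∧ IsFiberwiseC1 D M G

/-- The total space of the family `M t`, `t ∈ D`, is `C¹` diffeomorphic over `D` to the product of
`D` with any of the fibers. -/
def IsC1ProductBundle {X P : Type*} [NormedAddCommGroup X] [NormedSpace ℝ X]
    [NormedAddCommGroup P] [NormedSpace ℝ P] (D : Set P) (M : P → Set X) : Prop :=
  ∀ t₀ ∈ D, ∃ F G : X × P → X, IsTrivialization D (M t₀) M F G ∧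
    ContDiffOn ℝ 1 F (M t₀ ×ˢ D) ∧ ContDiffOn ℝ 1 G (totalSpace D M)

/-- `f`, extended linearly over the edges, is a collapsing map from the abstract tree `G` onto the
linear tree `T`: vertices go to vertices, every edge goes to a vertex or to an edge, the inverse
image of every vertex is a tree, and the inverse image of every open edge is one open edge. -/
structure IsCollapsingMap {n : ℕ} {V : Type*} (G : SimpleGraph V) (T : LinearTree n)
    (f : V → T.verts) : Prop where
  map_edge : ∀ v w, G.Adj v w → f v = f w ∨ T.graph.Adj (f v) (f w)
  fiber_vertex : ∀ p : T.verts, (G.induce {v | f v = p}).IsTree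
  fiber_edge : ∀ e' ∈ T.graph.edgeSet, ∃! e, e ∈ G.edgeSet ∧ Sym2.map f e = e'

/-- A smooth `Δᵏ`-family of linearly embedded trees `T t` in `ℝⁿ`: a fixed finite tree `G` and
collapsing maps `f t` from `G` onto `T t`, collapsing no external edge, such that the image of every
vertex of `G` varies smoothly with `t ∈ Δᵏ`. The values at `t ∉ Δᵏ` are irrelevant. -/
structure SmoothTreeFamily (n k : ℕ) (V : Type*) [Fintype V] where
  G : SimpleGraph V
  isTree : G.IsTree
  T : (Fin (k + 1) → ℝ) → LinearTree n
  f : (t : Fin (k + 1) → ℝ) → V → (T t).verts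
  collapsing : ∀ t ∈ simplex k, IsCollapsingMap G (T t) (f t)
  external : ∀ t ∈ simplex k, ∀ v w, G.Adj v w → (∀ u, G.Adj v u → u = w) → f t v ≠ f t w
  smooth : ∀ v, ContDiffOn ℝ ∞ (fun t => (f t v : Euc n)) (simplex k)

/-- The edge vectors of the family have the form (length) × (direction), where the length is a
nonnegative smooth function on `Δᵏ` and the direction is smooth and nowhere zero. This is automatic
for an edge that is not collapsed for any `t`. -/
def SmoothTreeFamily.HasSmoothEdgeDirections {n k : ℕ} {V : Type*} [Fintype V]
    (S : SmoothTreeFamily n k V) : Prop :=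
  ∀ v w, S.G.Adj v w → ∃ (len : (Fin (k + 1) → ℝ) → ℝ) (dir : (Fin (k + 1) → ℝ) → Euc n),
    ContDiffOn ℝ ∞ len (simplex k) ∧ ContDiffOn ℝ ∞ dir (simplex k) ∧
    ∀ t ∈ simplex k, 0 ≤ len t ∧ dir t ≠ 0 ∧
      (S.f t w : Euc n) - (S.f t v : Euc n) = len t • dir t

end TreeThickening

end

noncomputable section

namespace TreeThickening

open Filter

/-! Let η(s) be the derivative of log ψ(√s). Log-concavity of ψ makes η positive and strictly
decreasing for 0 < s < 9/4; it vanishes from 9/4 on. Root the tree at a vertex b and pair every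
other vertex v with the edge to its parent p. The exponents val(v) - 1 are exactly those for which
log Φ(x) = log ψ(|x - b|) + ∑_{v ≠ b} (log ψ(d(x, pv)) - log ψ(|x - p|)) (`logPhi_eq`), for every
choice of b. All summands are nonpositive, so Φ is at most ψ of the distance to any edge or vertex,
and it tends to 0 at the tree.

The heart is that a critical point of Φ off the tree has Φ = 1 (`logPhi_eq_zero_of_fderiv_eq_zero`).
Suppose ⟨x - a, b - a⟩ > 0 for some oriented edge from a to b; choose one beyond which there is no
other, put e = b - a and root at b. For an edge beyond b the point nearest to x is the parent
vertex, so its summand and its gradient vanish. For the edges on the side of a, the angle condition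
and the monotonicity of η make the component of the gradient along e nonnegative, with equality only
if the term is trivial (`gradTerm_spec`). If no such oriented edge exists, only the root term is
left.

For a family, log Φ of T(t) can be computed on the fixed tree T₀: point inverses are trees, so the
collapsed edges cancel against the surplus vertices (`IsCollapsingMap.sum_eq`). What remains
concerns a family of functions on Euclidean space without fiberwise critical points at the levels in
(0, 1/2] (`NoncriticalFamily`). Nearby fibers are compared by moving x along a smooth field that
increases Φ, by the amount that restores the old value of Φ. After a cut-off this is a perturbation
of the identity with small derivative, hence a diffeomorphism, and no flow of a merely continuous
gradient is needed. Composing such maps along the segment from t₀ to t gives the trivialization.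

For the retraction, the same kind of field pushes W into an arbitrarily low sublevel, from which one
moves straight to the image under a fiberwise retraction ρ onto the trees. The map ρ exists because
a family of collapsing trees is a fiberwise absolute extensor (`fiberwiseExtensor_tree`).

Parts (b) and (c) share one argument, written for the regularity notion `RegAt` relative to `Rel J`:
J false means C¹ along the fibers, J true means C¹ jointly. They differ only in what is known of the
squared distance to a segment that may collapse. -/

theorem half_lt_sqrt_two_div_two : (1 : ℝ) / 2 < √2 / 2 := by
  have : (1 : ℝ) < √2 := by
    rw [Real.lt_sqrt (by norm_num)]; norm_num
  linarith

/-! ### Calculus of the profile function ψ. -/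

namespace IsProfile
variable {ψ : ℝ → ℝ} (hψ : IsProfile ψ)
include hψ

theorem contDiffAt {t : ℝ} (ht : 0 < t) : ContDiffAt ℝ ∞ ψ t :=
  hψ.smooth.contDiffAt (Ici_mem_nhds ht)

theorem contDiffOn_Ioi : ContDiffOn ℝ ∞ ψ (Ioi 0) := hψ.smooth.mono Ioi_subset_Ici_self

theorem contDiffOn_deriv : ContDiffOn ℝ ∞ (deriv ψ) (Ioi 0) :=
  hψ.contDiffOn_Ioi.deriv_of_isOpen isOpen_Ioi (by simp)

theorem hasDerivAt {t : ℝ} (ht : 0 < t) : HasDerivAt ψ (deriv ψ t) t :=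
  ((hψ.contDiffAt ht).differentiableAt (by simp)).hasDerivAt

theorem hasDerivAt_deriv {t : ℝ} (ht : 0 < t) : HasDerivAt (deriv ψ) (deriv (deriv ψ) t) t :=
  ((hψ.contDiffOn_deriv.contDiffAt (Ioi_mem_nhds ht)).differentiableAt (by simp)).hasDerivAt

theorem deriv_of_lt {t : ℝ} (ht : 0 < t) (h : t < 1 / 2) : deriv ψ t = 2 * t := by
  have : ψ =ᶠ[𝓝 t] fun s => s ^ 2 := by
    filter_upwards [Ioo_mem_nhds ht h] with s hs using hψ.eq_sq s hs.1.le hs.2.le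
  rw [this.deriv_eq]
  simp

/-- The formula ψ = t² is known only up to 1/2, so the value of ψ' there is a limit from the left.
-/
theorem deriv_half : deriv ψ (1 / 2) = 1 := by
  have h1 : Tendsto (deriv ψ) (𝓝[<] (1 / 2)) (𝓝 (deriv ψ (1 / 2))) :=
    ((hψ.hasDerivAt_deriv (by norm_num)).continuousAt).mono_left nhdsWithin_le_nhds
  have h2 : Tendsto (fun t : ℝ => 2 * t) (𝓝[<] (1 / 2)) (𝓝 (2 * (1 / 2))) :=
    (Continuous.tendsto (by fun_prop) _).mono_left nhdsWithin_le_nhds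
  have h3 : deriv ψ =ᶠ[𝓝[<] (1 / 2)] fun t => 2 * t := by
    filter_upwards [Ioo_mem_nhdsLT (show (0 : ℝ) < 1 / 2 by norm_num)] with t ht
      using hψ.deriv_of_lt ht.1 ht.2
  have := tendsto_nhds_unique h1 (h2.congr' h3.symm)
  linarith

theorem deriv2_of_lt {t : ℝ} (ht : 0 < t) (h : t < 1 / 2) : deriv (deriv ψ) t = 2 := by
  have : deriv ψ =ᶠ[𝓝 t] fun s => 2 * s := by
    filter_upwards [Ioo_mem_nhds ht h] with s hs using hψ.deriv_of_lt hs.1 hs.2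
  rw [this.deriv_eq]
  simp

/-- Integrating 0 ≤ ψ'' ≤ 2 from 1/2, where ψ' = 1, gives 1 ≤ ψ' ≤ 2t and then ψ ≤ t² up to √2/2.
This lemma and the next two supply the middle case of log-concavity. -/
theorem one_le_deriv {t : ℝ} (ht : t ∈ Icc (1 / 2) (√2 / 2)) : 1 ≤ deriv ψ t := by
  rw [← hψ.deriv_half]
  refine monotoneOn_of_deriv_nonneg (convex_Icc (1 / 2 : ℝ) (√2 / 2)) ?_ ?_ ?_
    (left_mem_Icc.2 half_lt_sqrt_two_div_two.le) ht ht.1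
  · exact hψ.contDiffOn_deriv.continuousOn.mono fun s hs => lt_of_lt_of_le (by norm_num) hs.1
  · intro s hs
    rw [interior_Icc] at hs
    exact (hψ.hasDerivAt_deriv (lt_trans (by norm_num) hs.1)).differentiableAt.differentiableWithinAt
  · intro s hs
    rw [interior_Icc] at hs
    exact (hψ.deriv2_mem s (lt_trans (by norm_num) hs.1) hs.2.le).1

theorem deriv_le {t : ℝ} (ht : t ∈ Icc (1 / 2) (√2 / 2)) : deriv ψ t ≤ 2 * t := by
  have h := antitoneOn_of_deriv_nonpos (f := fun s => deriv ψ s - 2 * s)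
    (convex_Icc (1 / 2 : ℝ) (√2 / 2)) ?_ ?_ ?_ (left_mem_Icc.2 half_lt_sqrt_two_div_two.le) ht ht.1
  · have := hψ.deriv_half
    simp only [this] at h
    linarith
  · exact (hψ.contDiffOn_deriv.continuousOn.mono fun s hs =>
      lt_of_lt_of_le (by norm_num) hs.1).sub (by fun_prop)
  · intro s hs
    rw [interior_Icc] at hs
    exact ((hψ.hasDerivAt_deriv (lt_trans (by norm_num) hs.1)).differentiableAt.sub
      (by fun_prop)).differentiableWithinAt
  · intro s hs
    rw [interior_Icc] at hs
    have hs0 : 0 < s := lt_trans (by norm_num) hs.1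
    have := ((hψ.hasDerivAt_deriv hs0).sub ((hasDerivAt_id s).const_mul 2)).deriv
    simp only [id, Pi.sub_def] at this
    rw [this]
    have := (hψ.deriv2_mem s hs0 hs.2.le).2
    linarith

theorem le_sq {t : ℝ} (ht : t ∈ Icc (1 / 2) (√2 / 2)) : ψ t ≤ t ^ 2 := by
  have h := antitoneOn_of_deriv_nonpos (f := fun s => ψ s - s ^ 2)
    (convex_Icc (1 / 2 : ℝ) (√2 / 2)) ?_ ?_ ?_ (left_mem_Icc.2 half_lt_sqrt_two_div_two.le) ht ht.1
  · have := hψ.eq_sq (1 / 2) (by norm_num) le_rfl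
    simp only [this] at h
    linarith
  · exact (hψ.contDiffOn_Ioi.continuousOn.mono fun s hs =>
      lt_of_lt_of_le (by norm_num) hs.1).sub (by fun_prop)
  · intro s hs
    rw [interior_Icc] at hs
    exact ((hψ.hasDerivAt (lt_trans (by norm_num) hs.1)).differentiableAt.sub
      (by fun_prop)).differentiableWithinAt
  · intro s hs
    rw [interior_Icc] at hs
    have hs0 : 0 < s := lt_trans (by norm_num) hs.1
    have := ((hψ.hasDerivAt hs0).sub ((hasDerivAt_id s).pow 2)).deriv
    simp only [id, Pi.sub_def, Pi.pow_def] at this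
    rw [this]
    have := hψ.deriv_le ⟨hs.1.le, hs.2.le⟩
    norm_num
    linarith

theorem monotoneOn : MonotoneOn ψ (Ioi 0) := by
  refine monotoneOn_of_deriv_nonneg (convex_Ioi 0) hψ.contDiffOn_Ioi.continuousOn ?_ ?_
  · rw [interior_Ioi]
    exact hψ.contDiffOn_Ioi.differentiableOn (by simp)
  · rw [interior_Ioi]
    intro t ht
    rcases lt_trichotomy t (3 / 2) with h | h | h
    · exact (hψ.deriv_pos t ht h).le
    · have h1 : Tendsto (deriv ψ) (𝓝[<] t) (𝓝 (deriv ψ t)) :=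
        ((hψ.hasDerivAt_deriv ht).continuousAt).mono_left nhdsWithin_le_nhds
      refine ge_of_tendsto h1 ?_
      filter_upwards [Ioo_mem_nhdsLT (show (0 : ℝ) < t from ht)] with s hs
        using (hψ.deriv_pos s hs.1 (h ▸ hs.2)).le
    · have : ψ =ᶠ[𝓝 t] fun _ => 1 := by
        filter_upwards [Ioi_mem_nhds h] with s hs using hψ.eq_one s (le_of_lt hs)
      rw [this.deriv_eq]
      simp

theorem pos {t : ℝ} (ht : 0 < t) : 0 < ψ t := by
  have h1 : 0 < min t (1 / 2) := lt_min ht (by norm_num)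
  have h2 := hψ.eq_sq (min t (1 / 2)) h1.le (min_le_right _ _)
  have h3 : ψ (min t (1 / 2)) ≤ ψ t := hψ.monotoneOn h1 ht (min_le_left _ _)
  rw [h2] at h3
  exact lt_of_lt_of_le (by positivity) h3

theorem deriv_eq_zero {t : ℝ} (h : 3 / 2 ≤ t) : deriv ψ t = 0 := by
  have h0 : 0 < t := lt_of_lt_of_le (by norm_num) h
  have h1 : Tendsto (deriv ψ) (𝓝[>] t) (𝓝 (deriv ψ t)) :=
    ((hψ.hasDerivAt_deriv h0).continuousAt).mono_left nhdsWithin_le_nhds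
  refine tendsto_nhds_unique h1 (tendsto_const_nhds.congr' ?_)
  filter_upwards [self_mem_nhdsWithin] with s hs
  have : ψ =ᶠ[𝓝 s] fun _ => 1 := by
    filter_upwards [Ioi_mem_nhds (lt_of_le_of_lt h hs)] with r hr using hψ.eq_one r (le_of_lt hr)
  rw [this.deriv_eq]
  simp

/-- `ψ` is log-concave. -/
theorem deriv2_mul_le {t : ℝ} (ht : 0 < t) : deriv (deriv ψ) t * ψ t ≤ deriv ψ t ^ 2 := by
  rcases lt_or_ge t (1 / 2) with h | h
  · rw [hψ.deriv2_of_lt ht h, hψ.deriv_of_lt ht h, hψ.eq_sq t ht.le h.le]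
    nlinarith [sq_nonneg t]
  rcases le_total t (√2 / 2) with h' | h'
  · have h1 := hψ.one_le_deriv ⟨h, h'⟩
    have h2 := hψ.le_sq ⟨h, h'⟩
    have h3 := hψ.deriv2_mem t ht h'
    -- Here ψ''ψ ≤ 2t² ≤ 1 ≤ ψ'²; the threshold √2/2 is what makes the middle inequality true.
    have h4 : t ^ 2 ≤ 1 / 2 := by
      have : t ^ 2 ≤ (√2 / 2) ^ 2 := by gcongr
      rw [div_pow, Real.sq_sqrt (by norm_num)] at this
      linarith
    have h5 := hψ.pos ht
    nlinarith [h3.1, h3.2]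
  · have h1 := hψ.deriv2_nonpos t h'
    have h5 := hψ.pos ht
    nlinarith [sq_nonneg (deriv ψ t)]

/-- The numerator of the derivative is t(ψ''ψ - ψ'²) - ψψ'. The first part is nonpositive by
log-concavity, and the second is strictly negative before 3/2. -/
theorem strictAntiOn_logDeriv :
    StrictAntiOn (fun t => deriv ψ t / (t * ψ t)) (Ioc 0 (3 / 2)) := by
  have hd : ∀ t, 0 < t → HasDerivAt (fun t => deriv ψ t / (t * ψ t))
      ((deriv (deriv ψ) t * (t * ψ t) - deriv ψ t * (1 * ψ t + t * deriv ψ t)) / (t * ψ t) ^ 2)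
      t := fun t ht =>
    (hψ.hasDerivAt_deriv ht).div ((hasDerivAt_id t).mul (hψ.hasDerivAt ht))
      (mul_pos ht (hψ.pos ht)).ne'
  refine strictAntiOn_of_deriv_neg (convex_Ioc 0 (3 / 2))
    (fun t ht => (hd t ht.1).continuousAt.continuousWithinAt) ?_
  rw [interior_Ioc]
  intro t ht
  rw [(hd t ht.1).deriv]
  have h1 := hψ.deriv2_mul_le ht.1
  have h2 := hψ.pos ht.1
  have h3 := hψ.deriv_pos t ht.1 ht.2
  have h4 := ht.1
  refine div_neg_of_neg_of_pos ?_ (by positivity)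
  have h5 : t * (deriv (deriv ψ) t * ψ t) ≤ t * deriv ψ t ^ 2 := by gcongr
  nlinarith [mul_pos h3 h2]

end IsProfile

/-- The logarithm of a profile function, as a function of the square of its argument. -/
def logSq (ψ : ℝ → ℝ) (s : ℝ) : ℝ := Real.log (ψ (√s))

/-- The derivative of `logSq ψ`. -/
def logSqDeriv (ψ : ℝ → ℝ) (s : ℝ) : ℝ := deriv ψ (√s) / (√s * ψ (√s)) / 2

namespace IsProfile
variable {ψ : ℝ → ℝ} (hψ : IsProfile ψ)
include hψ

theorem hasDerivAt_logSq {s : ℝ} (hs : 0 < s) : HasDerivAt (logSq ψ) (logSqDeriv ψ s) s := by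
  have h0 := Real.sqrt_pos.2 hs
  have h1 := ((hψ.hasDerivAt h0).comp s (Real.hasDerivAt_sqrt hs.ne')).log (hψ.pos h0).ne'
  refine h1.congr_deriv ?_
  rw [logSqDeriv]
  simp only [Function.comp]
  have := (hψ.pos h0).ne'
  field_simp

theorem contDiffAt_logSq {s : ℝ} (hs : 0 < s) : ContDiffAt ℝ ∞ (logSq ψ) s := by
  have h0 := Real.sqrt_pos.2 hs
  exact ((hψ.contDiffAt h0).comp s (Real.contDiffAt_sqrt hs.ne')).log (hψ.pos h0).ne'

theorem continuousAt_logSqDeriv {s : ℝ} (hs : 0 < s) : ContinuousAt (logSqDeriv ψ) s := by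
  have h0 := Real.sqrt_pos.2 hs
  have h1 : ContinuousAt (fun t => deriv ψ t / (t * ψ t) / 2) (√s) :=
    ((hψ.hasDerivAt_deriv h0).continuousAt.div (continuousAt_id.mul (hψ.hasDerivAt h0).continuousAt)
      (mul_pos h0 (hψ.pos h0)).ne').div_const 2
  exact ContinuousAt.comp (f := fun s => √s) h1 Real.continuous_sqrt.continuousAt

theorem logSqDeriv_eq_zero {s : ℝ} (hs : 9 / 4 ≤ s) : logSqDeriv ψ s = 0 := by
  have : 3 / 2 ≤ √s := Real.le_sqrt_of_sq_le (by linarith)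
  rw [logSqDeriv, hψ.deriv_eq_zero this]
  simp

theorem logSqDeriv_pos {s : ℝ} (h0 : 0 < s) (hs : s < 9 / 4) : 0 < logSqDeriv ψ s := by
  have h1 := Real.sqrt_pos.2 h0
  have h2 : √s < 3 / 2 := (Real.sqrt_lt' (by norm_num)).2 (by linarith)
  have h3 := hψ.deriv_pos _ h1 h2
  have h4 := hψ.pos h1
  rw [logSqDeriv]
  positivity

theorem logSqDeriv_nonneg {s : ℝ} (h0 : 0 < s) : 0 ≤ logSqDeriv ψ s := by
  rcases lt_or_ge s (9 / 4) with h | h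
  · exact (hψ.logSqDeriv_pos h0 h).le
  · exact (hψ.logSqDeriv_eq_zero h).ge

/-- Only the smaller argument has to lie below 9/4 = (3/2)²: if the larger one does not, its value
is 0. -/
theorem logSqDeriv_lt {s t : ℝ} (h0 : 0 < s) (hst : s < t) (hs : s < 9 / 4) :
    logSqDeriv ψ t < logSqDeriv ψ s := by
  rcases lt_or_ge t (9 / 4) with h | h
  · have h1 := Real.sqrt_pos.2 h0
    have h2 : √t ≤ 3 / 2 := (Real.sqrt_le_left (by norm_num)).2 (by linarith)
    have h3 : √s < √t := Real.sqrt_lt_sqrt h0.le hst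
    have := hψ.strictAntiOn_logDeriv ⟨h1, h3.le.trans h2⟩ ⟨h1.trans h3, h2⟩ h3
    simp only [logSqDeriv]
    simp only at this
    linarith
  · rw [hψ.logSqDeriv_eq_zero h]
    exact hψ.logSqDeriv_pos h0 hs

theorem logSqDeriv_le {s t : ℝ} (h0 : 0 < s) (hst : s ≤ t) :
    logSqDeriv ψ t ≤ logSqDeriv ψ s := by
  rcases hst.eq_or_lt with rfl | hst
  · rfl
  rcases lt_or_ge s (9 / 4) with h | h
  · exact (hψ.logSqDeriv_lt h0 hst h).le
  · rw [hψ.logSqDeriv_eq_zero h, hψ.logSqDeriv_eq_zero (h.trans hst.le)]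

theorem logSq_eq_zero {s : ℝ} (hs : 9 / 4 ≤ s) : logSq ψ s = 0 := by
  have : 3 / 2 ≤ √s := Real.le_sqrt_of_sq_le (by linarith)
  rw [logSq, hψ.eq_one _ this, Real.log_one]

theorem logSq_mono {s t : ℝ} (h0 : 0 < s) (hst : s ≤ t) : logSq ψ s ≤ logSq ψ t := by
  have h1 := Real.sqrt_pos.2 h0
  have h3 := Real.sqrt_le_sqrt hst
  exact Real.log_le_log (hψ.pos h1) (hψ.monotoneOn h1 (h1.trans_le h3) h3)

theorem exp_logSq {s : ℝ} (hs : 0 < s) : Real.exp (logSq ψ s) = ψ (√s) :=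
  Real.exp_log (hψ.pos (Real.sqrt_pos.2 hs))

theorem exp_logSq_of_le {s : ℝ} (hs : 0 < s) (h : s ≤ 1 / 4) : Real.exp (logSq ψ s) = s := by
  rw [hψ.exp_logSq hs, hψ.eq_sq _ (Real.sqrt_nonneg _), Real.sq_sqrt hs.le]
  exact Real.sqrt_le_iff.2 ⟨by norm_num, by linarith⟩

end IsProfile

/-! ### Nearest points of segments, including degenerate ones. -/

section Projection
variable {E : Type*} [NormedAddCommGroup E] [InnerProductSpace ℝ E]

/-- The parameter of the point of the segment from `v` to `w` closest to `x`. -/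
def segParam (x v w : E) : ℝ := max 0 (min 1 (⟪x - v, w - v⟫ / ‖w - v‖ ^ 2))

/-- The point of the segment from `v` to `w` closest to `x`. -/
def segProj (x v w : E) : E := v + segParam x v w • (w - v)

/-- The square of the distance from `x` to the segment from `v` to `w`. -/
def segDistSq (x v w : E) : ℝ := ‖x - segProj x v w‖ ^ 2

theorem segParam_mem (x v w : E) : segParam x v w ∈ Icc (0 : ℝ) 1 :=
  ⟨le_max_left _ _, max_le zero_le_one (min_le_left _ _)⟩

theorem segProj_mem (x v w : E) : segProj x v w ∈ segment ℝ v w := by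
  rw [segment_eq_image']
  exact ⟨_, segParam_mem x v w, rfl⟩

theorem segParam_of_inner_nonpos {x v w : E} (h : ⟪x - v, w - v⟫ ≤ 0) : segParam x v w = 0 :=
  max_eq_left ((min_le_right _ _).trans (div_nonpos_of_nonpos_of_nonneg h (by positivity)))

theorem segProj_of_inner_nonpos {x v w : E} (h : ⟪x - v, w - v⟫ ≤ 0) : segProj x v w = v := by
  rw [segProj, segParam_of_inner_nonpos h, zero_smul, add_zero]

@[simp] theorem segProj_self (x v : E) : segProj x v v = v := by simp [segProj]

@[simp] theorem segDistSq_self (x v : E) : segDistSq x v v = ‖x - v‖ ^ 2 := by simp [segDistSq]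

theorem segParam_pos {x v w : E} (h : 0 < ⟪x - v, w - v⟫) : 0 < segParam x v w := by
  have h1 : w - v ≠ 0 := fun h0 => by simp [h0] at h
  have h2 := norm_pos_iff.2 h1
  exact lt_max_of_lt_right (lt_min one_pos (by positivity))

/-- The variational inequality of the nearest point: clamping to [0,1] minimizes the quadratic
polynomial that gives the squared distance along the segment. -/
theorem inner_sub_segProj_le {x v w y : E} (hy : y ∈ segment ℝ v w) :
    ⟪x - segProj x v w, y - segProj x v w⟫ ≤ 0 := by
  rw [segment_eq_image'] at hy
  obtain ⟨s, hs, rfl⟩ := hy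
  have e1 : v + s • (w - v) - segProj x v w = (s - segParam x v w) • (w - v) := by
    rw [segProj]; module
  have e2 : x - segProj x v w = (x - v) - segParam x v w • (w - v) := by
    rw [segProj]; module
  simp only [e1, e2]
  rw [inner_smul_right, inner_sub_left, inner_smul_left, real_inner_self_eq_norm_sq]
  simp only [RCLike.conj_to_real]
  rcases eq_or_ne (w - v) 0 with h0 | h0
  · simp [h0]
  have h2 : 0 < ‖w - v‖ ^ 2 := by have := norm_pos_iff.2 h0; positivity
  set c := ⟪x - v, w - v⟫ with hc
  have hc' : c = c / ‖w - v‖ ^ 2 * ‖w - v‖ ^ 2 := by field_simp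
  set r := c / ‖w - v‖ ^ 2 with hr
  have hp : segParam x v w = max 0 (min 1 r) := rfl
  have key : (s - segParam x v w) * (r - segParam x v w) ≤ 0 := by
    rw [hp]
    rcases le_total r 0 with h | h
    · rw [min_eq_right (h.trans zero_le_one), max_eq_left h]
      nlinarith [hs.1]
    rcases le_total 1 r with h' | h'
    · rw [min_eq_left h', max_eq_right zero_le_one]
      nlinarith [hs.2]
    · rw [min_eq_right h', max_eq_right h]
      simp
  have : (s - segParam x v w) * (c - segParam x v w * ‖w - v‖ ^ 2) =
      (s - segParam x v w) * (r - segParam x v w) * ‖w - v‖ ^ 2 := by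
    rw [hc']; ring
  rw [this]
  exact mul_nonpos_of_nonpos_of_nonneg key h2.le

/-- The angle at the nearest point is not acute. The extra square on the left yields uniqueness of
the nearest point. -/
theorem segDistSq_add_le {x v w y : E} (hy : y ∈ segment ℝ v w) :
    segDistSq x v w + ‖y - segProj x v w‖ ^ 2 ≤ ‖x - y‖ ^ 2 := by
  have h := inner_sub_segProj_le (x := x) hy
  have : x - y = (x - segProj x v w) - (y - segProj x v w) := by abel
  rw [this, norm_sub_sq_real (x - segProj x v w), segDistSq]
  linarith

theorem segDistSq_le {x v w y : E} (hy : y ∈ segment ℝ v w) : segDistSq x v w ≤ ‖x - y‖ ^ 2 := by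
  have := segDistSq_add_le (x := x) hy
  have := sq_nonneg ‖y - segProj x v w‖
  linarith

theorem segDistSq_nonneg (x v w : E) : 0 ≤ segDistSq x v w := sq_nonneg _

theorem segProj_eq_of_segDistSq_eq {x v w y : E} (hy : y ∈ segment ℝ v w)
    (h : segDistSq x v w = ‖x - y‖ ^ 2) : segProj x v w = y := by
  have := segDistSq_add_le (x := x) hy
  have h0 : ‖y - segProj x v w‖ ^ 2 = 0 := le_antisymm (by linarith) (sq_nonneg _)
  rw [sq_eq_zero_iff, norm_eq_zero, sub_eq_zero] at h0
  exact h0.symm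

theorem segProj_eq_self_of_mem {x v w : E} (hx : x ∈ segment ℝ v w) : segProj x v w = x := by
  refine segProj_eq_of_segDistSq_eq hx ?_
  have := segDistSq_le (x := x) hx
  rw [sub_self, norm_zero] at this ⊢
  exact le_antisymm (by simpa using this) (by simpa using segDistSq_nonneg x v w)

theorem segDistSq_eq_zero_iff {x v w : E} : segDistSq x v w = 0 ↔ x ∈ segment ℝ v w := by
  constructor
  · intro h
    rw [segDistSq, sq_eq_zero_iff, norm_eq_zero, sub_eq_zero] at h
    rw [h]
    exact segProj_mem _ _ _
  · intro h
    rw [segDistSq, segProj_eq_self_of_mem h, sub_self, norm_zero]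
    simp

theorem infDist_segment (x v w : E) :
    Metric.infDist x (segment ℝ v w) = ‖x - segProj x v w‖ := by
  refine le_antisymm ?_ ?_
  · rw [← dist_eq_norm]
    exact Metric.infDist_le_dist_of_mem (segProj_mem x v w)
  · refine (Metric.le_infDist ⟨v, left_mem_segment ℝ v w⟩).2 fun {y} hy => ?_
    rw [dist_eq_norm]
    exact abs_le_of_sq_le_sq' (segDistSq_le hy) (norm_nonneg _) |>.2

theorem sqrt_segDistSq (x v w : E) : √(segDistSq x v w) = Metric.infDist x (segment ℝ v w) := by
  rw [segDistSq, Real.sqrt_sq (norm_nonneg _), infDist_segment]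

theorem segDistSq_comm (x v w : E) : segDistSq x v w = segDistSq x w v := by
  refine le_antisymm (segDistSq_le ?_) (segDistSq_le ?_)
  · rw [segment_symm]; exact segProj_mem x w v
  · rw [segment_symm]; exact segProj_mem x v w

/-- Testing x + h against the old nearest point bounds the increment from above, and testing x
against the new one bounds it from below. The two bounds differ from the linear term by at most
‖h‖², whether the nearest point is interior or an endpoint and even if v = w. -/
theorem hasFDerivAt_segDistSq (x v w : E) :
    HasFDerivAt (fun y => segDistSq y v w) ((2 : ℝ) • innerSL ℝ (x - segProj x v w)) x := by
  rw [hasFDerivAt_iff_isLittleO_nhds_zero]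
  refine Asymptotics.IsBigO.trans_isLittleO (g := fun h : E => ‖h‖ ^ 2) ?_ ?_
  · refine Asymptotics.IsBigO.of_bound 1 (Eventually.of_forall fun h => ?_)
    simp only [_root_.smul_apply, innerSL_apply_apply, smul_eq_mul, one_mul]
    rw [Real.norm_of_nonneg (sq_nonneg ‖h‖), Real.norm_eq_abs, abs_le]
    have h1 := segDistSq_le (x := x + h) (segProj_mem x v w)
    have e1 : x + h - segProj x v w = (x - segProj x v w) + h := by abel
    rw [e1, norm_add_sq_real] at h1
    have h2 := inner_sub_segProj_le (x := x) (segProj_mem (x + h) v w)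
    have e2 : x + h - segProj (x + h) v w =
      (x - segProj x v w) + (h - (segProj (x + h) v w - segProj x v w)) := by abel
    have h3 : segDistSq (x + h) v w = ‖x + h - segProj (x + h) v w‖ ^ 2 := rfl
    rw [e2, norm_add_sq_real, inner_sub_right] at h3
    have h4 := sq_nonneg ‖h - (segProj (x + h) v w - segProj x v w)‖
    have h5 : segDistSq x v w = ‖x - segProj x v w‖ ^ 2 := rfl
    constructor <;> nlinarith [sq_nonneg ‖h‖]
  · have := Asymptotics.isLittleO_norm_pow_id (E' := E) (n := 2) (by norm_num)
    exact this

theorem continuous_segProj : Continuous fun p : E × E × E => segProj p.1 p.2.1 p.2.2 := by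
  rw [continuous_iff_continuousAt]
  rintro ⟨x, v, w⟩
  rcases eq_or_ne (w - v) 0 with h0 | h0
  -- Where the segment collapses the parameter need not be continuous, but it stays in [0,1] and
  -- multiplies a vector that tends to 0.
  · obtain rfl : w = v := sub_eq_zero.1 h0
    have h1 : Tendsto (fun p : E × E × E => segProj p.1 p.2.1 p.2.2 - p.2.1) (𝓝 (x, w, w))
        (𝓝 0) := by
      refine squeeze_zero_norm (a := fun p : E × E × E => ‖p.2.2 - p.2.1‖) (fun p => ?_) ?_
      · rw [segProj, add_sub_cancel_left, norm_smul]
        have := segParam_mem p.1 p.2.1 p.2.2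
        rw [Real.norm_of_nonneg this.1]
        exact mul_le_of_le_one_left (norm_nonneg _) this.2
      · have : Continuous fun p : E × E × E => ‖p.2.2 - p.2.1‖ := by fun_prop
        simpa using this.tendsto (x, w, w)
    have h2 : Tendsto (fun p : E × E × E => p.2.1) (𝓝 (x, w, w)) (𝓝 w) :=
      Continuous.tendsto (by fun_prop) _
    have := h1.add h2
    simpa [ContinuousAt] using this
  · have h1 : ContinuousAt (fun p : E × E × E => ⟪p.1 - p.2.1, p.2.2 - p.2.1⟫ /
        ‖p.2.2 - p.2.1‖ ^ 2) (x, v, w) := by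
      refine ContinuousAt.div (by fun_prop) (by fun_prop) ?_
      simpa using h0
    unfold segProj segParam
    fun_prop

theorem continuous_segDistSq : Continuous fun p : E × E × E => segDistSq p.1 p.2.1 p.2.2 :=
  ((continuous_fst.sub continuous_segProj).norm).pow 2

/-- The square of the distance to a segment whose edge vector is written as `len • dir`. -/
theorem segDistSq_eq {x v w d : E} {l : ℝ} (hl : 0 ≤ l) (hd : d ≠ 0) (h : w - v = l • d) :
    segDistSq x v w = ‖x - v‖ ^ 2 -
      (max 0 ⟪x - v, d⟫ ^ 2 - max 0 (⟪x - v, d⟫ - l * ‖d‖ ^ 2) ^ 2) / ‖d‖ ^ 2 := by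
  have hd' : 0 < ‖d‖ ^ 2 := by have := norm_pos_iff.2 hd; positivity
  have e : segDistSq x v w = ‖x - v‖ ^ 2 - 2 * (segParam x v w * l) * ⟪x - v, d⟫ +
      (segParam x v w * l) ^ 2 * ‖d‖ ^ 2 := by
    have : x - segProj x v w = (x - v) - (segParam x v w * l) • d := by
      rw [segProj, h, smul_smul]; abel
    rw [segDistSq, this, norm_sub_sq_real, inner_smul_right, norm_smul, mul_pow, Real.norm_eq_abs,
      sq_abs]
    ring
  -- The product of parameter and length is again a clamp, and this form survives l = 0, where the
  -- quotient defining the parameter degenerates.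
  have hp : segParam x v w * l = max 0 (min l (⟪x - v, d⟫ / ‖d‖ ^ 2)) := by
    rcases hl.eq_or_lt with rfl | hl
    · simp
    have hr : ⟪x - v, w - v⟫ / ‖w - v‖ ^ 2 * l = ⟪x - v, d⟫ / ‖d‖ ^ 2 := by
      rw [h, inner_smul_right, norm_smul, mul_pow, Real.norm_eq_abs, sq_abs]
      field_simp
    rw [segParam, max_mul_of_nonneg _ _ hl.le, min_mul_of_nonneg _ _ hl.le, hr, zero_mul, one_mul]
  rw [e, hp]
  set a := ⟪x - v, d⟫
  set m := ‖d‖ ^ 2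
  rcases le_total a 0 with ha | ha
  · rw [max_eq_left ha, max_eq_left (a := (0:ℝ)) (b := a - l * m) (by nlinarith),
      max_eq_left ((min_le_right _ _).trans (div_nonpos_of_nonpos_of_nonneg ha hd'.le))]
    simp
  rcases le_total a (l * m) with h' | h'
  · rw [max_eq_right ha, max_eq_left (a := (0:ℝ)) (b := a - l * m) (by linarith),
      min_eq_right ((div_le_iff₀ hd').2 h'), max_eq_right (by positivity)]
    field_simp
    ring
  · rw [max_eq_right ha, max_eq_right (a := (0:ℝ)) (b := a - l * m) (by linarith),
      min_eq_left ((le_div_iff₀ hd').2 h'), max_eq_right hl]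
    field_simp
    ring

/-- Together with `segDistSq_eq` this makes the squared distance C¹ jointly in the point and the
parameters, also where the edge collapses. -/
theorem contDiff_max_zero_sq : ContDiff ℝ 1 fun s : ℝ => max 0 s ^ 2 := by
  have hd : ∀ s : ℝ, HasDerivAt (fun s : ℝ => max 0 s ^ 2) (2 * max 0 s) s := by
    intro s
    rcases lt_trichotomy s 0 with h | rfl | h
    · have : (fun s : ℝ => max 0 s ^ 2) =ᶠ[𝓝 s] fun _ => 0 := by
        filter_upwards [Iio_mem_nhds h] with r hr
        rw [max_eq_left (le_of_lt hr)]; simp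
      rw [max_eq_left h.le, mul_zero]
      exact (hasDerivAt_const s (0 : ℝ)).congr_of_eventuallyEq this
    · rw [hasDerivAt_iff_isLittleO_nhds_zero]
      simp only [max_self, mul_zero, smul_zero, sub_zero, zero_add, ne_eq, OfNat.ofNat_ne_zero,
        not_false_eq_true, zero_pow]
      refine Asymptotics.IsBigO.trans_isLittleO (g := fun h : ℝ => ‖h‖ ^ 2) ?_
        (Asymptotics.isLittleO_norm_pow_id (by norm_num))
      refine Asymptotics.IsBigO.of_bound 1 (Eventually.of_forall fun h => ?_)
      rw [one_mul, norm_pow, norm_pow, norm_norm]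
      gcongr
      rw [Real.norm_of_nonneg (le_max_left _ _)]
      exact max_le (norm_nonneg _) (Real.le_norm_self h)
    · have : (fun s : ℝ => max 0 s ^ 2) =ᶠ[𝓝 s] fun s => s ^ 2 := by
        filter_upwards [Ioi_mem_nhds h] with r hr
        rw [max_eq_right (le_of_lt hr)]
      rw [max_eq_right h.le]
      simpa using (hasDerivAt_pow 2 s).congr_of_eventuallyEq this
  rw [contDiff_one_iff_deriv]
  refine ⟨fun s => (hd s).differentiableAt, ?_⟩
  rw [show deriv (fun s : ℝ => max 0 s ^ 2) = fun s => 2 * max 0 s from funext fun s => (hd s).deriv]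
  fun_prop

end Projection

/-! ### Rooted trees and summation over their edges. -/

section TreeCombinatorics
variable {V : Type*} {G : SimpleGraph V} (hG : G.IsTree)

/-- The path from `v` to `b` in a tree. -/
def pathTo (v b : V) : G.Walk v b := (hG.existsUnique_path v b).choose

theorem pathTo_isPath (v b : V) : (pathTo hG v b).IsPath :=
  (hG.existsUnique_path v b).choose_spec.1

theorem eq_pathTo {v b : V} {p : G.Walk v b} (hp : p.IsPath) : p = pathTo hG v b :=
  (hG.existsUnique_path v b).unique hp (pathTo_isPath hG v b)

/-- The neighbour of `v` on the path from `v` to `b`. -/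
def par (b v : V) : V := (pathTo hG v b).snd

theorem pathTo_self (b : V) : pathTo hG b b = .nil := (eq_pathTo hG .nil).symm

@[simp] theorem par_self (b : V) : par hG b b = b := by simp [par, pathTo_self]

theorem exists_pathTo_eq_cons {v b : V} (h : v ≠ b) :
    ∃ h' : G.Adj v (par hG b v), pathTo hG v b = .cons h' (pathTo hG (par hG b v) b) := by
  have hp := pathTo_isPath hG v b
  unfold par
  generalize hq : pathTo hG v b = q at hp
  cases q with
  | nil => exact absurd rfl h
  | @cons _ u _ h' r =>
    obtain rfl := eq_pathTo hG hp.of_cons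
    have key : ∀ s, s = u → ∃ h'' : G.Adj v s,
        SimpleGraph.Walk.cons h' (pathTo hG u b) = .cons h'' (pathTo hG s b) := by
      rintro _ rfl
      exact ⟨h', rfl⟩
    exact key _ (SimpleGraph.Walk.snd_cons _ _)

theorem adj_par {v b : V} (h : v ≠ b) : G.Adj v (par hG b v) :=
  (exists_pathTo_eq_cons hG h).1

theorem length_pathTo_par {v b : V} (h : v ≠ b) :
    (pathTo hG v b).length = (pathTo hG (par hG b v) b).length + 1 := by
  obtain ⟨h', e⟩ := exists_pathTo_eq_cons hG h
  rw [e, SimpleGraph.Walk.length_cons]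

theorem support_pathTo {v b : V} (h : v ≠ b) :
    (pathTo hG v b).support = v :: (pathTo hG (par hG b v) b).support := by
  obtain ⟨h', e⟩ := exists_pathTo_eq_cons hG h
  rw [e, SimpleGraph.Walk.support_cons]

/-- Two vertices cannot be parents of each other, because the distance to the root drops by one at
each step. -/
theorem par_edge_injective {v w b : V} (hv : v ≠ b) (hw : w ≠ b)
    (h : s(v, par hG b v) = s(w, par hG b w)) : v = w := by
  rcases Sym2.eq_iff.1 h with h | h
  · exact h.1
  · have h1 := length_pathTo_par hG hv
    have h2 := length_pathTo_par hG hw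
    rw [h.2] at h1
    rw [← h.1] at h2
    omega

theorem eq_par_or_eq_par {v w : V} (b : V) (h : G.Adj v w) : w = par hG b v ∨ v = par hG b w := by
  classical
  by_cases hw : w ∈ (pathTo hG v b).support
  · exact .inl (hG.isAcyclic.eq_snd_of_adj_start (pathTo_isPath hG v b) h hw)
  · right
    have : (SimpleGraph.Walk.cons h.symm (pathTo hG v b)).IsPath :=
      (pathTo_isPath hG v b).cons hw
    rw [par, ← eq_pathTo hG this, SimpleGraph.Walk.snd_cons]

theorem pathTo_eq_concat {v a b : V} (h : G.Adj a b) (ha : a ∈ (pathTo hG v b).support) :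
    pathTo hG v b = (pathTo hG v a).concat h :=
  hG.isAcyclic.path_concat (pathTo_isPath hG v a) (pathTo_isPath hG v b) h ha

theorem par_eq_par {v a b : V} (h : G.Adj a b) (ha : a ∈ (pathTo hG v b).support) (hva : v ≠ a) :
    par hG b v = par hG a v := by
  obtain ⟨h', e⟩ := exists_pathTo_eq_cons hG hva
  rw [par, pathTo_eq_concat hG h ha, e, SimpleGraph.Walk.concat_cons, SimpleGraph.Walk.snd_cons]

/-- Among the darts with a given property there is one beyond which there is no dart with this
property that points away from it. -/
theorem exists_extremal_dart [Finite V] (desc : V → V → Prop)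
    (h : ∃ a b, G.Adj a b ∧ desc a b) :
    ∃ a b, G.Adj a b ∧ desc a b ∧
      ∀ v, v ≠ b → a ∉ (pathTo hG v b).support → ¬ desc (par hG b v) v := by
  classical
  have := Fintype.ofFinite V
  -- Q m says that a dart with the property ends a path having m earlier edges; the dart ending the
  -- longest such path is extremal.
  let Q : ℕ → Prop := fun m => ∃ (u a b : V) (p : G.Walk u a) (hab : G.Adj a b),
    (p.concat hab).IsPath ∧ desc a b ∧ p.length = m
  obtain ⟨a₀, b₀, hab₀, hd₀⟩ := h
  have h0 : Q 0 := ⟨a₀, a₀, b₀, .nil, hab₀, SimpleGraph.Walk.IsPath.nil.concat (by simpa using hab₀.ne') hab₀,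
    hd₀, rfl⟩
  have hm : Q (Nat.findGreatest Q (Fintype.card V)) := Nat.findGreatest_spec (Nat.zero_le _) h0
  obtain ⟨u, a, b, p, hab, hp, hd, hl⟩ := hm
  refine ⟨a, b, hab, hd, fun v hvb ha hdv => ?_⟩
  obtain ⟨h', e⟩ := exists_pathTo_eq_cons hG hvb
  have hlen : ((p.concat hab).append (pathTo hG (par hG b v) b).reverse).length =
      p.length + 1 + (pathTo hG (par hG b v) b).length := by simp
  have hpath : (((p.concat hab).append (pathTo hG (par hG b v) b).reverse).concat
      h'.symm).IsPath := by
    have e2 : ((p.concat hab).append (pathTo hG (par hG b v) b).reverse).concat h'.symm =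
        (p.concat hab).append (pathTo hG v b).reverse := by
      rw [e, SimpleGraph.Walk.reverse_cons, SimpleGraph.Walk.concat_eq_append,
        SimpleGraph.Walk.append_assoc]
    -- In a forest a walk is a path once consecutive edges differ, so only the junction at b has to
    -- be checked; there a repetition would put a on the path from v to b.
    rw [e2, hG.isAcyclic.isPath_iff_isChain, SimpleGraph.Walk.edges_append, List.isChain_append]
    refine ⟨(hG.isAcyclic.isPath_iff_isChain _).1 hp,
      (hG.isAcyclic.isPath_iff_isChain _).1 (pathTo_isPath hG v b).reverse, ?_⟩
    intro x hx y hy hxy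
    rw [SimpleGraph.Walk.edges_concat, List.concat_eq_append, List.getLast?_concat,
      Option.mem_some_iff] at hx
    have hy' := List.mem_of_mem_head? hy
    rw [← hxy, ← hx, SimpleGraph.Walk.edges_reverse, List.mem_reverse] at hy'
    exact ha (SimpleGraph.Walk.fst_mem_support_of_mem_edges _ hy')
  have hQ : Q (p.length + 1 + (pathTo hG (par hG b v) b).length) :=
    ⟨u, _, v, _, h'.symm, hpath, hdv, hlen⟩
  have hle : p.length + 1 + (pathTo hG (par hG b v) b).length ≤ Fintype.card V := by
    have := hpath.length_lt
    rw [SimpleGraph.Walk.length_concat, hlen] at this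
    omega
  have := Nat.le_findGreatest hle hQ
  omega

open Classical in
-- Sending a vertex other than b to the edge towards its parent is injective, hence bijective
-- because a tree has one edge fewer than vertices.
theorem sum_edgeFinset_eq [Fintype V] (b : V) (φ : Sym2 V → ℝ) :
    ∑ e ∈ G.edgeFinset, φ e = ∑ v ∈ Finset.univ.erase b, φ s(v, par hG b v) := by
  have hinj : Set.InjOn (fun v => s(v, par hG b v)) (Finset.univ.erase b : Finset V) := by
    intro v hv w hw h
    simp only [Finset.coe_erase, Finset.coe_univ, Set.mem_sdiff, Set.mem_univ,
      Set.mem_singleton_iff, true_and] at hv hw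
    exact par_edge_injective hG hv hw h
  rw [← Finset.sum_image (g := fun v => s(v, par hG b v)) hinj]
  congr 1
  symm
  refine Finset.eq_of_subset_of_card_le ?_ ?_
  · intro e he
    obtain ⟨v, hv, rfl⟩ := Finset.mem_image.1 he
    rw [SimpleGraph.mem_edgeFinset, SimpleGraph.mem_edgeSet]
    exact adj_par hG (Finset.ne_of_mem_erase hv)
  · rw [Finset.card_image_of_injOn hinj, Finset.card_erase_of_mem (Finset.mem_univ _),
      Finset.card_univ, ← hG.card_edgeFinset]
    simp

/-- The sum of the values of a function at the end points of an edge. -/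
def endSum {V : Type*} (κ : V → ℝ) : Sym2 V → ℝ :=
  Sym2.lift ⟨fun u w => κ u + κ w, fun _ _ => add_comm _ _⟩

@[simp] theorem endSum_mk {V : Type*} (κ : V → ℝ) (u w : V) : endSum κ s(u, w) = κ u + κ w := rfl

open Classical in
theorem sum_degree_mul [Fintype V] (G : SimpleGraph V) (κ : V → ℝ) :
    ∑ v, (G.degree v : ℝ) * κ v = ∑ e ∈ G.edgeFinset, endSum κ e := by
  have h1 : ∀ v, (G.degree v : ℝ) * κ v = ∑ e ∈ G.edgeFinset, if v ∈ e then κ v else 0 := by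
    intro v
    rw [← SimpleGraph.card_incidenceFinset_eq_degree, SimpleGraph.incidenceFinset_eq_filter,
      ← Finset.sum_filter, Finset.sum_const, nsmul_eq_mul]
  simp only [h1]
  rw [Finset.sum_comm]
  refine Finset.sum_congr rfl fun e he => ?_
  induction e with
  | _ u w =>
    rw [SimpleGraph.mem_edgeFinset, SimpleGraph.mem_edgeSet] at he
    have : ∀ v, (if v ∈ s(u, w) then κ v else 0) =
        (if u = v then κ v else 0) + (if w = v then κ v else 0) := by
      intro v
      have := he.ne
      by_cases h1 : v = u <;> by_cases h2 : v = w <;> simp_all [eq_comm]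
    rw [Finset.sum_congr rfl fun v _ => this v, Finset.sum_add_distrib, Finset.sum_ite_eq,
      Finset.sum_ite_eq]
    simp

open Classical in
-- By the handshake sum, ∑ deg(v) κ(v) is the sum of κ(v) + κ(parent of v) over v ≠ b. This turns
-- the denominator of Φ into one factor for each edge, located at the parent, up to one factor at
-- the root.
theorem sum_degree_sub_one_mul [Fintype V] (b : V) (κ : V → ℝ) :
    ∑ v, ((G.degree v : ℝ) - 1) * κ v =
      (∑ v ∈ Finset.univ.erase b, κ (par hG b v)) - κ b := by
  simp only [sub_mul, one_mul, Finset.sum_sub_distrib]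
  rw [sum_degree_mul, sum_edgeFinset_eq hG b, ← Finset.add_sum_erase _ κ (Finset.mem_univ b)]
  simp only [endSum_mk, Finset.sum_add_distrib]
  ring

end TreeCombinatorics

/-! ### The angle condition for a tree mapped to a Euclidean space. -/

section Acute
variable {E : Type*} [NormedAddCommGroup E] [InnerProductSpace ℝ E] {V : Type*}

/-- Any two edges of a path, oriented along the path, have nonnegative inner product. -/
def AcutePaths (G : SimpleGraph V) (P : V → E) : Prop :=
  ∀ (v w : V) (p : G.Walk v w), p.IsPath → ∀ d ∈ p.darts, ∀ d' ∈ p.darts,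
    0 ≤ ⟪P d.snd - P d.fst, P d'.snd - P d'.fst⟫

theorem inner_walk_nonneg {G : SimpleGraph V} {P : V → E} {e : E} {v w : V} (p : G.Walk v w)
    (h : ∀ d ∈ p.darts, 0 ≤ ⟪P d.snd - P d.fst, e⟫) : 0 ≤ ⟪P w - P v, e⟫ := by
  induction p with
  | nil => simp
  | @cons u v w h' p ih =>
    have h1 := ih fun d hd => h d (by simp [hd])
    have h2 := h ⟨(u, v), h'⟩ (by simp)
    have : P w - P u = (P w - P v) + (P v - P u) := by abel
    rw [this, inner_add_left]
    exact add_nonneg h1 h2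

variable {G : SimpleGraph V} (hG : G.IsTree) {P : V → E}

/-- If the path from v to b passes through the neighbour a of b, it ends with the dart from a to b,
so the first step and this dart lie on one path. The next lemma adds up the intermediate steps. -/
theorem AcutePaths.inner_par_nonneg (hP : AcutePaths G P) {v a b : V} (hab : G.Adj a b)
    (ha : a ∈ (pathTo hG v b).support) (hvb : v ≠ b) :
    0 ≤ ⟪P (par hG b v) - P v, P b - P a⟫ := by
  obtain ⟨h', e⟩ := exists_pathTo_eq_cons hG hvb
  refine hP v b _ (pathTo_isPath hG v b) ⟨(v, par hG b v), h'⟩ ?_ ⟨(a, b), hab⟩ ?_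
  · rw [e]; simp
  · rw [pathTo_eq_concat hG hab ha]; simp

theorem AcutePaths.inner_sub_par_nonneg (hP : AcutePaths G P) {v a b : V} (hab : G.Adj a b)
    (ha : a ∈ (pathTo hG v b).support) (hva : v ≠ a) :
    0 ≤ ⟪P a - P (par hG b v), P b - P a⟫ := by
  rw [par_eq_par hG hab ha hva]
  refine inner_walk_nonneg (pathTo hG (par hG a v) a) fun d hd => ?_
  obtain ⟨h', e⟩ := exists_pathTo_eq_cons hG hva
  refine hP v b _ (pathTo_isPath hG v b) d ?_ ⟨(a, b), hab⟩ ?_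
  · rw [pathTo_eq_concat hG hab ha, e]; simp [hd]
  · rw [pathTo_eq_concat hG hab ha]; simp

end Acute

/-! ### The rooted formula for log Φ and its critical points. -/

section LogPhi
variable {E : Type*} [NormedAddCommGroup E] [InnerProductSpace ℝ E]

theorem segProj_comm (x v w : E) : segProj x v w = segProj x w v := by
  have h : segProj x w v ∈ segment ℝ v w := by rw [segment_symm]; exact segProj_mem x w v
  exact segProj_eq_of_segDistSq_eq h (segDistSq_comm x v w)

theorem par_of_adj {V : Type*} {G : SimpleGraph V} (hG : G.IsTree) {a b : V} (h : G.Adj a b) :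
    par hG b a = b := by
  have : (SimpleGraph.Walk.cons h .nil).IsPath := SimpleGraph.Walk.IsPath.of_adj h
  rw [par, ← eq_pathTo hG this, SimpleGraph.Walk.snd_cons]

variable {V : Type*} [Fintype V] {G : SimpleGraph V}

/-- The square of the distance from `x` to the image of an edge. -/
def edgeDistSq {V : Type*} (P : V → E) (x : E) : Sym2 V → ℝ :=
  Sym2.lift ⟨fun v w => segDistSq x (P v) (P w), fun _ _ => segDistSq_comm _ _ _⟩

@[simp] theorem edgeDistSq_mk {V : Type*} (P : V → E) (x : E) (v w : V) :
    edgeDistSq P x s(v, w) = segDistSq x (P v) (P w) := rfl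

/-- The image of the tree `G` under the map that is `P` on vertices and linear on edges. -/
def treeSet {V : Type*} (G : SimpleGraph V) (P : V → E) : Set E :=
  {x | (∃ v, x = P v) ∨ ∃ v w, G.Adj v w ∧ x ∈ segment ℝ (P v) (P w)}

open Classical in
/-- The logarithm of the function `Φ` of the tree `G`, mapped to `E` by `P`. -/
def logPhi (ψ : ℝ → ℝ) (G : SimpleGraph V) (P : V → E) (x : E) : ℝ :=
  ∑ e ∈ G.edgeFinset, logSq ψ (edgeDistSq P x e) -
    ∑ v, ((G.degree v : ℝ) - 1) * logSq ψ (‖x - P v‖ ^ 2)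

omit [Fintype V] in
theorem norm_sq_pos_of_notMem {P : V → E} {x : E} (hx : x ∉ treeSet G P) (v : V) :
    0 < ‖x - P v‖ ^ 2 := by
  have : x - P v ≠ 0 := fun h => hx (.inl ⟨v, sub_eq_zero.1 h⟩)
  have := norm_pos_iff.2 this
  positivity

omit [Fintype V] in
theorem segDistSq_pos_of_notMem {P : V → E} {x : E} (hx : x ∉ treeSet G P) {v w : V}
    (h : G.Adj v w) : 0 < segDistSq x (P v) (P w) :=
  (segDistSq_nonneg _ _ _).lt_of_ne' fun h0 => hx (.inr ⟨v, w, h, segDistSq_eq_zero_iff.1 h0⟩)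

variable (hG : G.IsTree)

open Classical in
-- The freedom to choose the root b is essential: the estimates and the critical point argument each
-- use the root adapted to a given vertex or edge.
theorem logPhi_eq (ψ : ℝ → ℝ) (P : V → E) (x : E) (b : V) :
    logPhi ψ G P x = logSq ψ (‖x - P b‖ ^ 2) +
      ∑ v ∈ Finset.univ.erase b, (logSq ψ (segDistSq x (P (par hG b v)) (P v)) -
        logSq ψ (‖x - P (par hG b v)‖ ^ 2)) := by
  rw [logPhi, sum_edgeFinset_eq hG b,
    sum_degree_sub_one_mul hG b fun v => logSq ψ (‖x - P v‖ ^ 2), Finset.sum_sub_distrib]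
  simp only [edgeDistSq_mk]
  rw [Finset.sum_congr rfl fun v _ => by rw [segDistSq_comm x (P v)]]
  ring

variable {ψ : ℝ → ℝ} (hψ : IsProfile ψ)
include hψ hG

omit [Fintype V] in
theorem logPhi_summand_nonpos {P : V → E} {x : E} (hx : x ∉ treeSet G P) {v b : V} (hv : v ≠ b) :
    logSq ψ (segDistSq x (P (par hG b v)) (P v)) - logSq ψ (‖x - P (par hG b v)‖ ^ 2) ≤ 0 :=
  sub_nonpos.2 (hψ.logSq_mono (segDistSq_pos_of_notMem hx (adj_par hG hv).symm)
    (segDistSq_le (left_mem_segment ℝ _ _)))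

theorem logPhi_le_vertex {P : V → E} {x : E} (hx : x ∉ treeSet G P) (b : V) :
    logPhi ψ G P x ≤ logSq ψ (‖x - P b‖ ^ 2) := by
  classical
  rw [logPhi_eq hG ψ P x b]
  have := Finset.sum_nonpos fun v (hv : v ∈ Finset.univ.erase b) =>
    logPhi_summand_nonpos hG hψ hx (Finset.ne_of_mem_erase hv)
  linarith

/-- With root b, the root term cancels the parent factor of the edge from a, and the remaining
summands are nonpositive because a parent vertex lies on its edge. -/
theorem logPhi_le_edge {P : V → E} {x : E} (hx : x ∉ treeSet G P) {a b : V} (h : G.Adj a b) :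
    logPhi ψ G P x ≤ logSq ψ (segDistSq x (P a) (P b)) := by
  classical
  have ha : a ∈ Finset.univ.erase b := Finset.mem_erase.2 ⟨h.ne, Finset.mem_univ _⟩
  rw [logPhi_eq hG ψ P x b, ← Finset.add_sum_erase _ _ ha, par_of_adj hG h, segDistSq_comm x (P b)]
  have := Finset.sum_nonpos fun v (hv : v ∈ (Finset.univ.erase b).erase a) =>
    logPhi_summand_nonpos hG hψ hx (Finset.ne_of_mem_erase (Finset.mem_of_mem_erase hv))
  linarith

theorem logPhi_eq_zero {P : V → E} {x : E} (h : ∀ y ∈ treeSet G P, 3 / 2 ≤ ‖x - y‖) :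
    logPhi ψ G P x = 0 := by
  classical
  have h1 : ∀ r : ℝ, 3 / 2 ≤ r → logSq ψ (r ^ 2) = 0 := fun r hr =>
    hψ.logSq_eq_zero (by nlinarith)
  have h2 : ∀ v, logSq ψ (‖x - P v‖ ^ 2) = 0 := fun v => h1 _ (h _ (.inl ⟨v, rfl⟩))
  obtain ⟨b⟩ := hG.connected.nonempty
  rw [logPhi_eq hG ψ P x b, h2, zero_add]
  refine Finset.sum_eq_zero fun v hv => ?_
  rw [h2, sub_zero]
  exact h1 _ (h _ (.inr ⟨_, _, (adj_par hG (Finset.ne_of_mem_erase hv)).symm, segProj_mem _ _ _⟩))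

/-- The contribution to half the gradient of `logPhi` of the edge joining `v` to its parent. -/
def gradTerm (ψ : ℝ → ℝ) (x p v : E) : E :=
  logSqDeriv ψ (segDistSq x p v) • (x - segProj x p v) - logSqDeriv ψ (‖x - p‖ ^ 2) • (x - p)

/-- Half the gradient of `logPhi`. -/
def halfGrad {V : Type*} [Fintype V] {G : SimpleGraph V} (hG : G.IsTree) (ψ : ℝ → ℝ) (P : V → E)
    (x : E) (b : V) : E :=
  open Classical in
  logSqDeriv ψ (‖x - P b‖ ^ 2) • (x - P b) +
    ∑ v ∈ Finset.univ.erase b, gradTerm ψ x (P (par hG b v)) (P v)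

omit hG in
theorem hasFDerivAt_logSq_segDistSq {x v w : E} (h : 0 < segDistSq x v w) :
    HasFDerivAt (fun y => logSq ψ (segDistSq y v w))
      (innerSL ℝ ((2 : ℝ) • logSqDeriv ψ (segDistSq x v w) • (x - segProj x v w))) x := by
  refine ((hψ.hasDerivAt_logSq h).comp_hasFDerivAt x (hasFDerivAt_segDistSq x v w)).congr_fderiv ?_
  ext y
  simp
  ring

omit hG in
theorem hasFDerivAt_logSq_norm_sq {x v : E} (h : 0 < ‖x - v‖ ^ 2) :
    HasFDerivAt (fun y => logSq ψ (‖y - v‖ ^ 2))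
      (innerSL ℝ ((2 : ℝ) • logSqDeriv ψ (‖x - v‖ ^ 2) • (x - v))) x := by
  have := hasFDerivAt_logSq_segDistSq hψ (x := x) (v := v) (w := v) (by simpa using h)
  simpa using this

theorem hasFDerivAt_logPhi {P : V → E} {x : E} (hx : x ∉ treeSet G P) (b : V) :
    HasFDerivAt (logPhi ψ G P) (innerSL ℝ ((2 : ℝ) • halfGrad hG ψ P x b)) x := by
  classical
  have h1 : HasFDerivAt (fun y => logSq ψ (‖y - P b‖ ^ 2) +
      ∑ v ∈ Finset.univ.erase b, (logSq ψ (segDistSq y (P (par hG b v)) (P v)) -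
        logSq ψ (‖y - P (par hG b v)‖ ^ 2)))
      (innerSL ℝ ((2 : ℝ) • logSqDeriv ψ (‖x - P b‖ ^ 2) • (x - P b)) +
        ∑ v ∈ Finset.univ.erase b, (innerSL ℝ ((2 : ℝ) •
          logSqDeriv ψ (segDistSq x (P (par hG b v)) (P v)) •
            (x - segProj x (P (par hG b v)) (P v))) -
          innerSL ℝ ((2 : ℝ) • logSqDeriv ψ (‖x - P (par hG b v)‖ ^ 2) •
            (x - P (par hG b v))))) x := by
    refine (hasFDerivAt_logSq_norm_sq hψ (norm_sq_pos_of_notMem hx b)).add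
      (HasFDerivAt.fun_sum fun v hv => ?_)
    exact (hasFDerivAt_logSq_segDistSq hψ (segDistSq_pos_of_notMem hx
      (adj_par hG (Finset.ne_of_mem_erase hv)).symm)).sub
      (hasFDerivAt_logSq_norm_sq hψ (norm_sq_pos_of_notMem hx _))
  rw [show logPhi ψ G P = _ from funext fun y => logPhi_eq hG ψ P y b]
  refine h1.congr_fderiv ?_
  simp only [halfGrad, gradTerm, smul_add, Finset.smul_sum, smul_sub, map_add, map_sum, map_sub]

omit hG in
-- The edge is at least as close to x as its endpoint p, so η weighs it at least as much; and x -
-- segProj exceeds x - p by a nonnegative multiple of p - v, which does not point against e. In case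
-- of equality either the nearest point is p, or both values of η vanish and both logarithms are 0.
theorem gradTerm_spec {x p v e : E} (h0 : 0 < segDistSq x p v) (hB : 0 < ⟪x - p, e⟫)
    (hpv : 0 ≤ ⟪p - v, e⟫) :
    0 ≤ ⟪gradTerm ψ x p v, e⟫ ∧ (⟪gradTerm ψ x p v, e⟫ = 0 →
      gradTerm ψ x p v = 0 ∧ logSq ψ (segDistSq x p v) = logSq ψ (‖x - p‖ ^ 2)) := by
  have hle : segDistSq x p v ≤ ‖x - p‖ ^ 2 := segDistSq_le (left_mem_segment ℝ _ _)
  have hA : ⟪x - p, e⟫ ≤ ⟪x - segProj x p v, e⟫ := by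
    have : x - segProj x p v = (x - p) + segParam x p v • (p - v) := by rw [segProj]; module
    rw [this, inner_add_left, inner_smul_left]
    have := mul_nonneg (segParam_mem x p v).1 hpv
    simpa using this
  have hη := hψ.logSqDeriv_le h0 hle
  have hR := hψ.logSqDeriv_nonneg (h0.trans_le hle)
  have e1 : ⟪gradTerm ψ x p v, e⟫ = logSqDeriv ψ (segDistSq x p v) * ⟪x - segProj x p v, e⟫ -
      logSqDeriv ψ (‖x - p‖ ^ 2) * ⟪x - p, e⟫ := by
    rw [gradTerm, inner_sub_left, inner_smul_left, inner_smul_left]; simp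
  rw [e1]
  refine ⟨by nlinarith, fun h => ?_⟩
  rcases lt_or_ge (‖x - p‖ ^ 2) (9 / 4) with h9 | h9
  · rcases hle.eq_or_lt with heq | hlt
    · have hq := segProj_eq_of_segDistSq_eq (left_mem_segment ℝ _ _) heq
      rw [gradTerm, hq, heq, sub_self]
      exact ⟨rfl, rfl⟩
    · have h1 := hψ.logSqDeriv_lt h0 hlt (hlt.trans h9)
      nlinarith
  · have hR0 := hψ.logSqDeriv_eq_zero h9
    rw [hR0] at h
    have hD : logSqDeriv ψ (segDistSq x p v) = 0 := by
      have : ⟪x - segProj x p v, e⟫ ≠ 0 := (hB.trans_le hA).ne'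
      simpa [this] using h
    have hD9 : 9 / 4 ≤ segDistSq x p v := by
      by_contra hlt
      exact (hψ.logSqDeriv_pos h0 (not_le.1 hlt)).ne' hD
    rw [gradTerm, hD, hR0, hψ.logSq_eq_zero hD9, hψ.logSq_eq_zero h9]
    simp

/-- For a tree satisfying the angle condition, `Φ = 1` at all critical points of `Φ` outside the
tree. -/
theorem logPhi_eq_zero_of_fderiv_eq_zero {P : V → E} (hP : AcutePaths G P) {x : E}
    (hx : x ∉ treeSet G P) (h : fderiv ℝ (logPhi ψ G P) x = 0) : logPhi ψ G P x = 0 := by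
  classical
  -- The gradient does not depend on the root, so its expansion vanishes for every root.
  have hg : ∀ b, halfGrad hG ψ P x b = 0 := by
    intro b
    rw [(hasFDerivAt_logPhi hG hψ hx b).fderiv] at h
    have := congrArg (fun A : E →L[ℝ] ℝ => A (halfGrad hG ψ P x b)) h
    simpa [inner_smul_left] using this
  have hsmul : ∀ (s : ℝ) (y : E), 0 < s → x - y ≠ 0 → logSqDeriv ψ s • (x - y) = 0 →
      logSq ψ s = 0 := by
    intro s y hs hy h0
    have := (smul_eq_zero.1 h0).resolve_right hy
    refine hψ.logSq_eq_zero (not_lt.1 fun hlt => (hψ.logSqDeriv_pos hs hlt).ne' this)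
  by_cases hd : ∃ a b, G.Adj a b ∧ 0 < ⟪x - P a, P b - P a⟫
  · obtain ⟨a, b, hab, hdab, hfwd⟩ := exists_extremal_dart hG
      (fun a b => 0 < ⟪x - P a, P b - P a⟫) hd
    set e := P b - P a with he
    set q := segProj x (P b) (P a) with hq
    have hqa : q = P a + segParam x (P a) (P b) • e := by rw [hq, segProj_comm, segProj]
    have hτ := segParam_pos hdab
    have hee : 0 < ⟪e, e⟫ := by
      rw [real_inner_self_eq_norm_sq]
      have : e ≠ 0 := fun h0 => by rw [h0] at hdab; simp at hdab
      have := norm_pos_iff.2 this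
      positivity
    have h1 : 0 < ⟪q - P a, e⟫ := by
      rw [hqa, add_sub_cancel_left, inner_smul_left]
      exact mul_pos hτ hee
    -- The variational inequality tested at the endpoint a, divided by the positive parameter of q.
    have h2 : 0 ≤ ⟪x - q, e⟫ := by
      have h3 := inner_sub_segProj_le (x := x) (right_mem_segment ℝ (P b) (P a))
      rw [← hq] at h3
      have : P a - q = (-segParam x (P a) (P b)) • e := by rw [hqa]; module
      rw [this, inner_smul_right] at h3
      by_contra hlt
      nlinarith [not_le.1 hlt]
    have hterm : ∀ v ∈ (Finset.univ.erase b).erase a,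
        0 ≤ ⟪gradTerm ψ x (P (par hG b v)) (P v), e⟫ ∧
        (⟪gradTerm ψ x (P (par hG b v)) (P v), e⟫ = 0 →
          gradTerm ψ x (P (par hG b v)) (P v) = 0 ∧
          logSq ψ (segDistSq x (P (par hG b v)) (P v)) = logSq ψ (‖x - P (par hG b v)‖ ^ 2)) := by
      intro v hv
      simp only [Finset.mem_erase, Finset.mem_univ, and_true] at hv
      by_cases hav : a ∈ (pathTo hG v b).support
      -- Edges on the side of a: x - parent is the sum of x - q, q - a and a - parent, all with
      -- nonnegative component along e, the second strictly positive.
      · refine gradTerm_spec hψ (segDistSq_pos_of_notMem hx (adj_par hG hv.2).symm) ?_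
          (hP.inner_par_nonneg hG hab hav hv.2)
        have h4 := hP.inner_sub_par_nonneg hG hab hav hv.1
        have : x - P (par hG b v) = (x - q) + (q - P a) + (P a - P (par hG b v)) := by abel
        rw [this, inner_add_left, inner_add_left]
        linarith
      -- Edges beyond b: by extremality x does not lie ahead of the parent, so the parent is the
      -- nearest point and the term vanishes.
      · have h5 := segProj_of_inner_nonpos (not_lt.1 (hfwd v hv.2 hav))
        have : gradTerm ψ x (P (par hG b v)) (P v) = 0 := by
          rw [gradTerm, segDistSq, h5, sub_self]
        rw [this]
        simp [segDistSq, h5]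
    have ha : a ∈ Finset.univ.erase b := Finset.mem_erase.2 ⟨hab.ne, Finset.mem_univ _⟩
    have hDpos := segDistSq_pos_of_notMem hx hab.symm
    -- The root term at b cancels the parent part of the term of the edge from a to b.
    have hsplit : halfGrad hG ψ P x b = logSqDeriv ψ (segDistSq x (P b) (P a)) • (x - q) +
        ∑ v ∈ (Finset.univ.erase b).erase a, gradTerm ψ x (P (par hG b v)) (P v) := by
      rw [halfGrad, ← Finset.add_sum_erase _ _ ha, par_of_adj hG hab, gradTerm]
      abel
    have hsum : logSqDeriv ψ (segDistSq x (P b) (P a)) * ⟪x - q, e⟫ +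
        ∑ v ∈ (Finset.univ.erase b).erase a, ⟪gradTerm ψ x (P (par hG b v)) (P v), e⟫ = 0 := by
      have := congrArg (fun y => ⟪y, e⟫) (hg b)
      simp only [hsplit, inner_add_left, sum_inner, inner_smul_left, inner_zero_left] at this
      simpa using this
    have hnn := Finset.sum_nonneg fun v hv => (hterm v hv).1
    have hnn' := mul_nonneg (hψ.logSqDeriv_nonneg hDpos) h2
    have hz : ∀ v ∈ (Finset.univ.erase b).erase a,
        ⟪gradTerm ψ x (P (par hG b v)) (P v), e⟫ = 0 :=
      (Finset.sum_eq_zero_iff_of_nonneg fun v hv => (hterm v hv).1).1 (by linarith)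
    have h6 : logSqDeriv ψ (segDistSq x (P b) (P a)) • (x - q) = 0 := by
      have h7 := hg b
      rwa [hsplit, Finset.sum_eq_zero fun v hv => ((hterm v hv).2 (hz v hv)).1, add_zero] at h7
    have h8 : x - q ≠ 0 := by
      intro h0
      rw [segDistSq, ← hq, h0] at hDpos
      simp at hDpos
    have h9 := hsmul _ _ hDpos h8 h6
    rw [logPhi_eq hG ψ P x b, ← Finset.add_sum_erase _ _ ha, par_of_adj hG hab, h9,
      Finset.sum_eq_zero fun v hv => sub_eq_zero.2 ((hterm v hv).2 (hz v hv)).2]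
    ring
  -- Now x lies ahead of no dart: every edge projects x to its parent, and only the root term is
  -- left.
  · push Not at hd
    obtain ⟨b⟩ := hG.connected.nonempty
    have hq : ∀ v ∈ Finset.univ.erase b, segProj x (P (par hG b v)) (P v) = P (par hG b v) :=
      fun v hv => segProj_of_inner_nonpos (hd _ _ (adj_par hG (Finset.ne_of_mem_erase hv)).symm)
    have h1 := hg b
    rw [halfGrad, Finset.sum_eq_zero (fun v hv => by
      rw [gradTerm, segDistSq, hq v hv, sub_self]), add_zero] at h1
    rw [logPhi_eq hG ψ P x b, Finset.sum_eq_zero (fun v hv => by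
      rw [segDistSq, hq v hv, sub_self]), add_zero]
    have hpos := norm_sq_pos_of_notMem hx b
    refine hsmul _ _ hpos (fun h0 => ?_) h1
    rw [h0] at hpos
    simp at hpos

end LogPhi

/-! ### Linearly embedded trees and collapsing maps. -/

theorem edgeSegment_mk {n : ℕ} {S : Finset (Euc n)} (p q : S) :
    edgeSegment s(p, q) = segment ℝ (p : Euc n) q := by
  rw [edgeSegment, ← convexHull_pair]
  congr 1
  ext y
  simp [eq_comm]

/-- Embeddedness only compares edges. If p is not q, the first edge of a walk from p to q contains p
and can be compared with the edge qr. -/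
theorem LinearTree.eq_or_eq_of_mem_segment {n : ℕ} (T : LinearTree n) {p q r : T.verts}
    (h : T.graph.Adj q r) (hp : (p : Euc n) ∈ segment ℝ (q : Euc n) r) : p = q ∨ p = r := by
  by_contra hne
  push Not at hne
  obtain ⟨w⟩ := T.isTree.connected.preconnected p q
  have hadj := w.adj_snd (SimpleGraph.Walk.not_nil_of_ne hne.1)
  have hmem : (p : Euc n) ∈ edgeSegment s(p, w.snd) ∩ edgeSegment s(q, r) := by
    rw [edgeSegment_mk, edgeSegment_mk]
    exact ⟨left_mem_segment ℝ _ _, hp⟩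
  obtain ⟨v, ⟨-, hv2⟩, hv⟩ := T.embedded s(p, w.snd) hadj s(q, r) h (by
    intro he
    have : p ∈ s(q, r) := he ▸ Sym2.mem_mk_left _ _
    rcases Sym2.mem_iff.1 this with h | h
    · exact hne.1 h
    · exact hne.2 h) hmem
  obtain rfl : v = p := Subtype.ext hv
  rcases Sym2.mem_iff.1 hv2 with h | h
  · exact hne.1 h
  · exact hne.2 h

namespace IsCollapsingMap
variable {n : ℕ} {V : Type*} {G : SimpleGraph V} {T : LinearTree n} {f : V → T.verts}
  (hf : IsCollapsingMap G T f)
include hf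

theorem treeSet_eq : treeSet G (fun v => (f v : Euc n)) = T.carrier := by
  ext x
  simp only [treeSet, LinearTree.carrier, mem_union, mem_iUnion, exists_prop, mem_ofPred_eq]
  constructor
  · rintro (⟨v, rfl⟩ | ⟨v, w, h, hx⟩)
    · exact .inl (f v).2
    · rcases hf.map_edge v w h with h' | h'
      · rw [h', segment_same] at hx
        obtain rfl := hx
        exact .inl (f w).2
      · exact .inr ⟨s(f v, f w), h', by rwa [edgeSegment_mk]⟩
  · rintro (hx | ⟨e, he, hx⟩)
    · obtain ⟨v, hv⟩ := (hf.fiber_vertex ⟨x, hx⟩).connected.nonempty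
      refine .inl ⟨v, ?_⟩
      rw [show f v = ⟨x, hx⟩ from hv]
    · obtain ⟨e', ⟨he', rfl⟩, -⟩ := hf.fiber_edge e he
      induction e' with
      | _ v w => exact .inr ⟨v, w, he', by rwa [Sym2.map_mk, edgeSegment_mk] at hx⟩

theorem map_mem_edgeSet {e : Sym2 V} (he : e ∈ G.edgeSet) (h : ¬ (Sym2.map f e).IsDiag) :
    Sym2.map f e ∈ T.graph.edgeSet := by
  induction e with
  | _ v w =>
    rw [Sym2.map_mk, Sym2.mk_isDiag_iff] at h
    exact (hf.map_edge v w he).resolve_left h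

theorem map_injOn {e e' : Sym2 V} (he : e ∈ G.edgeSet) (he' : e' ∈ G.edgeSet)
    (h : ¬ (Sym2.map f e).IsDiag) (heq : Sym2.map f e = Sym2.map f e') : e = e' :=
  (hf.fiber_edge _ (hf.map_mem_edgeSet he h)).unique ⟨he, rfl⟩ ⟨he', heq.symm⟩

open Classical in
-- The image walk omits the collapsed edges. Its edge list serves to show that it is a trail, its
-- darts to transport inner products.
theorem exists_map_walk {v w : V} (p : G.Walk v w) :
    ∃ q : T.graph.Walk (f v) (f w),
      q.edges = (p.edges.filter fun e => ¬ (Sym2.map f e).IsDiag).map (Sym2.map f) ∧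
      ∀ d ∈ p.darts, f d.fst ≠ f d.snd →
        ∃ d' ∈ q.darts, d'.fst = f d.fst ∧ d'.snd = f d.snd := by
  induction p with
  | nil => exact ⟨.nil, by simp, by simp⟩
  | @cons u v w h p ih =>
    obtain ⟨q, hq, hd⟩ := ih
    by_cases huv : f u = f v
    · refine ⟨q.copy huv.symm rfl, ?_, ?_⟩
      · simp [hq, huv]
      · intro d hd' hne
        rw [SimpleGraph.Walk.darts_cons, List.mem_cons] at hd'
        rcases hd' with rfl | hd'
        · exact absurd huv hne
        · simpa using hd d hd' hne
    · have hadj := (hf.map_edge u v h).resolve_left huv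
      refine ⟨.cons hadj q, ?_, ?_⟩
      · simp [hq, huv]
      · intro d hd' hne
        rw [SimpleGraph.Walk.darts_cons, List.mem_cons] at hd'
        rcases hd' with rfl | hd'
        · exact ⟨⟨(f u, f v), hadj⟩, by simp, rfl, rfl⟩
        · obtain ⟨d', h1, h2⟩ := hd d hd' hne
          exact ⟨d', by simp [h1], h2⟩

/-- Edges that are not collapsed map injectively, so the image of a path is a trail, hence a path in
a tree; a collapsed edge contributes the zero vector. -/
theorem acutePaths (hT : T.IsTaut) : AcutePaths G fun v => (f v : Euc n) := by
  classical
  intro v w p hp d hd d' hd'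
  obtain ⟨q, hq, hdq⟩ := hf.exists_map_walk p
  have hqp : q.IsPath := by
    rw [T.isTree.isAcyclic.isPath_iff_isTrail, SimpleGraph.Walk.isTrail_def, hq]
    refine List.Nodup.map_on ?_ (hp.isTrail.edges_nodup.filter _)
    intro e he e' he' heq
    rw [List.mem_filter] at he he'
    exact hf.map_injOn (p.edges_subset_edgeSet he.1) (p.edges_subset_edgeSet he'.1)
      (by simpa using he.2) heq
  by_cases h : f d.fst = f d.snd
  · simp [h]
  by_cases h' : f d'.fst = f d'.snd
  · simp [h']
  obtain ⟨c, hc, h1, h2⟩ := hdq d hd h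
  obtain ⟨c', hc', h1', h2'⟩ := hdq d' hd' h'
  have := hT.angle _ _ q hqp c hc c' hc'
  rwa [h1, h2, h1', h2'] at this

section Separation
variable (hG : G.IsTree) {o : V} {S : Set V} (hS : ∀ u ∈ S, u ≠ o → par hG o u ∈ S)
include hS

omit hf in
theorem support_subset_of_closed {u : V} (hu : u ∈ S) : ∀ w ∈ (pathTo hG u o).support, w ∈ S := by
  induction hl : (pathTo hG u o).length generalizing u with
  | zero =>
    intro w hw
    have : u = o := SimpleGraph.Walk.eq_of_length_eq_zero hl
    subst this
    rw [pathTo_self] at hw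
    simp only [SimpleGraph.Walk.support_nil, List.mem_singleton] at hw
    rwa [hw]
  | succ m ih =>
    have huo : u ≠ o := by
      rintro rfl
      simp [pathTo_self] at hl
    have h1 := length_pathTo_par hG huo
    intro w hw
    rw [support_pathTo hG huo, List.mem_cons] at hw
    rcases hw with rfl | hw
    · exact hu
    · exact ih (hS u hu huo) (by omega) w hw

/-- Join a to v inside the point inverse of f v. The path from a to the root stays in S, so a is not
a descendant of v, and the only way to enter the descendants of v is along the edge from the parent
of v. Hence the parent lies in the same point inverse. -/
theorem map_par_eq {a v : V} (ha : a ∈ S) (hv : v ∉ S) (h : f a = f v) :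
    f (par hG o v) = f v := by
  obtain ⟨p⟩ := (hf.fiber_vertex (f v)).connected.preconnected ⟨a, h⟩ ⟨v, rfl⟩
  have key : ∀ (a b : {w | f w = f v}) (p : (G.induce {w | f w = f v}).Walk a b),
      v ∉ (pathTo hG a.1 o).support → v ∈ (pathTo hG b.1 o).support → f (par hG o v) = f v := by
    intro a b p
    induction p with
    | nil => exact fun h1 h2 => absurd h2 h1
    | @cons a c b hac p ih =>
      intro h1 h2
      by_cases hc : v ∈ (pathTo hG c.1 o).support
      · have hadj : G.Adj a.1 c.1 := hac
        rcases eq_par_or_eq_par hG o hadj with h3 | h3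
        · have hao : a.1 ≠ o := by
            intro h4
            rw [h4, par_self] at h3
            exact hadj.ne (h4.trans h3.symm)
          rw [support_pathTo hG hao, ← h3] at h1
          exact absurd (List.mem_cons_of_mem _ hc) h1
        · have hco : c.1 ≠ o := by
            intro h4
            rw [h4, par_self] at h3
            exact hadj.ne (h3.trans h4.symm)
          rw [support_pathTo hG hco, ← h3, List.mem_cons] at hc
          rcases hc with hc | hc
          · rw [hc, ← h3]
            exact a.2.trans (congrArg f hc)
          · exact absurd hc h1
      · exact ih hc h2
  exact key _ _ p (fun h1 => hv (support_subset_of_closed hG hS ha v h1))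
    (SimpleGraph.Walk.start_mem_support _)

/-- This lets the image tree be built up edge by edge, each new edge meeting the earlier ones only
at its parent end, even when some of the edges are collapsed. -/
theorem eq_of_mem_segment_inter {u v : V} (hu : u ∈ S) (hv : v ∉ S) (hvo : v ≠ o) {y : Euc n}
    (h1 : y ∈ segment ℝ (f u : Euc n) (f (par hG o u)))
    (h2 : y ∈ segment ℝ (f v : Euc n) (f (par hG o v))) : y = f (par hG o v) := by
  by_cases hcv : f v = f (par hG o v)
  · rw [hcv, segment_same] at h2
    exact h2
  have hsep : ∀ a ∈ S, f a ≠ f v := fun a ha h => hcv (hf.map_par_eq hG hS ha hv h).symm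
  have hadj := (hf.map_edge _ _ (adj_par hG hvo)).resolve_left hcv
  have hfin : ∀ a ∈ S, y = f a → f a ∈ s(f v, f (par hG o v)) → y = f (par hG o v) := by
    intro a ha hy hmem
    rw [Sym2.mem_iff] at hmem
    rw [hy, hmem.resolve_left (hsep a ha)]
  by_cases hcu : f u = f (par hG o u)
  · rw [← hcu, segment_same] at h1
    obtain rfl : y = f u := h1
    exact hfin u hu rfl (Sym2.mem_iff.2 (T.eq_or_eq_of_mem_segment hadj h2))
  have huo : u ≠ o := by
    rintro rfl
    simp at hcu
  have hadju := (hf.map_edge _ _ (adj_par hG huo)).resolve_left hcu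
  have hne : s(f u, f (par hG o u)) ≠ s(f v, f (par hG o v)) := by
    intro heq
    have h3 := hf.map_injOn (e := s(u, par hG o u)) (e' := s(v, par hG o v)) (adj_par hG huo)
      (adj_par hG hvo) (by simpa using hcu) heq
    exact hv (par_edge_injective hG huo hvo h3 ▸ hu)
  obtain ⟨z, ⟨hz1, hz2⟩, rfl⟩ := T.embedded _ hadju _ hadj hne
    (show y ∈ _ by rw [edgeSegment_mk, edgeSegment_mk]; exact ⟨h1, h2⟩)
  rcases Sym2.mem_iff.1 hz1 with rfl | rfl
  · exact hfin _ hu rfl hz2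
  · exact hfin _ (hS u hu huo) rfl hz2

end Separation

open Classical in
-- The point inverse is a tree, so it has one edge fewer than vertices.
theorem card_collapsed [Fintype V] (p : T.verts) :
    (G.edgeFinset.filter fun e => Sym2.map f e = s(p, p)).card + 1 =
      (Finset.univ.filter fun v => f v = p).card := by
  have h := (hf.fiber_vertex p).card_edgeFinset
  have h1 : Fintype.card {v | f v = p} = (Finset.univ.filter fun v => f v = p).card := by
    rw [Fintype.card_subtype]
    rfl
  rw [h1] at h
  rw [← h]
  congr 1
  symm
  refine Finset.card_bij (fun e _ => Sym2.map Subtype.val e) ?_ ?_ ?_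
  · intro e he
    induction e with
    | _ v w =>
      rw [SimpleGraph.mem_edgeFinset, SimpleGraph.mem_edgeSet] at he
      rw [Finset.mem_filter, SimpleGraph.mem_edgeFinset]
      refine ⟨he, ?_⟩
      rw [Sym2.map_mk, Sym2.map_mk, show f v.1 = p from v.2, show f w.1 = p from w.2]
  · intro e _ e' _ h
    exact Sym2.map.injective Subtype.val_injective h
  · intro e he
    induction e with
    | _ v w =>
      rw [Finset.mem_filter, SimpleGraph.mem_edgeFinset, SimpleGraph.mem_edgeSet, Sym2.map_mk,
        Sym2.eq_iff] at he
      have hv : f v = p := he.2.elim (·.1) (·.1)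
      have hw : f w = p := he.2.elim (·.2) (·.2)
      refine ⟨s(⟨v, hv⟩, ⟨w, hw⟩), ?_, rfl⟩
      rw [SimpleGraph.mem_edgeFinset]
      exact he.1

open Classical in
-- By the handshake sum each edge contributes ε minus its two end values of κ, which is -κ p for an
-- edge collapsed to p. The vertices over p outnumber the edges collapsed to p by one, so exactly
-- one κ p survives.
theorem sum_eq [Fintype V] (ε : Sym2 T.verts → ℝ) (κ : T.verts → ℝ)
    (hε : ∀ p, ε s(p, p) = κ p) :
    ∑ e ∈ G.edgeFinset, ε (Sym2.map f e) - ∑ v, ((G.degree v : ℝ) - 1) * κ (f v) =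
      ∑ e ∈ T.graph.edgeFinset, ε e - ∑ p, ((T.graph.degree p : ℝ) - 1) * κ p := by
  have hend : ∀ e : Sym2 V, endSum (fun v => κ (f v)) e = endSum κ (Sym2.map f e) := by
    intro e
    induction e with
    | _ v w => rfl
  simp only [sub_mul, one_mul, Finset.sum_sub_distrib, sum_degree_mul]
  simp only [hend]
  have h1 : ∑ e ∈ G.edgeFinset, (ε (Sym2.map f e) - endSum κ (Sym2.map f e)) =
      ∑ e ∈ T.graph.edgeFinset, (ε e - endSum κ e) - ∑ p, (((Finset.univ.filter
        fun v => f v = p).card : ℝ) - 1) * κ p := by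
    rw [← Finset.sum_filter_not_add_sum_filter _ fun e => (Sym2.map f e).IsDiag, sub_eq_add_neg]
    congr 1
    · refine Finset.sum_bij (fun e _ => Sym2.map f e) ?_ ?_ ?_ ?_
      · intro e he
        rw [Finset.mem_filter, SimpleGraph.mem_edgeFinset] at he
        exact SimpleGraph.mem_edgeFinset.2 (hf.map_mem_edgeSet he.1 he.2)
      · intro e he e' he' h
        rw [Finset.mem_filter, SimpleGraph.mem_edgeFinset] at he he'
        exact hf.map_injOn he.1 he'.1 he.2 h
      · intro e he
        rw [SimpleGraph.mem_edgeFinset] at he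
        obtain ⟨e', ⟨h1, h2⟩, -⟩ := hf.fiber_edge e he
        refine ⟨e', ?_, h2⟩
        rw [Finset.mem_filter, SimpleGraph.mem_edgeFinset, h2]
        exact ⟨h1, T.graph.not_isDiag_of_mem_edgeSet he⟩
      · exact fun _ _ => rfl
    · have h2 : ∀ e ∈ G.edgeFinset.filter (fun e => (Sym2.map f e).IsDiag),
          ε (Sym2.map f e) - endSum κ (Sym2.map f e) =
            ∑ p, if Sym2.map f e = s(p, p) then -κ p else 0 := by
        intro e he
        have hd := (Finset.mem_filter.1 he).2
        generalize Sym2.map f e = e' at hd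
        induction e' with
        | _ p q =>
          obtain rfl : p = q := Sym2.mk_isDiag_iff.1 hd
          rw [hε, endSum_mk]
          simp
      rw [Finset.sum_congr rfl h2, Finset.sum_comm, ← Finset.sum_neg_distrib]
      refine Finset.sum_congr rfl fun p _ => ?_
      rw [← Finset.sum_filter, Finset.sum_const, Finset.filter_filter, nsmul_eq_mul]
      have h3 : (G.edgeFinset.filter fun e => (Sym2.map f e).IsDiag ∧ Sym2.map f e = s(p, p)) =
          G.edgeFinset.filter fun e => Sym2.map f e = s(p, p) := by
        refine Finset.filter_congr fun e _ => ⟨fun h => h.2, fun h => ⟨?_, h⟩⟩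
        rw [h]
        exact Sym2.mk_isDiag_iff.2 rfl
      rw [h3, ← hf.card_collapsed p]
      push_cast
      ring
  have h4 : ∑ v, κ (f v) = ∑ p, ((Finset.univ.filter fun v => f v = p).card : ℝ) * κ p := by
    rw [← Finset.sum_fiberwise Finset.univ f]
    refine Finset.sum_congr rfl fun p _ => ?_
    rw [Finset.sum_congr rfl (g := fun _ => κ p) fun v hv => by rw [(Finset.mem_filter.1 hv).2],
      Finset.sum_const, nsmul_eq_mul]
  simp only [Finset.sum_sub_distrib, sub_mul, one_mul] at h1
  linarith

open Classical in
theorem phi_eq [Fintype V] {ψ : ℝ → ℝ} (hψ : IsProfile ψ) (x : Euc n) :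
    T.Phi ψ x = if x ∈ treeSet G (fun v => (f v : Euc n)) then 0 else
      Real.exp (logPhi ψ G (fun v => (f v : Euc n)) x) := by
  rw [hf.treeSet_eq]
  rw [LinearTree.Phi]
  by_cases hx : x ∈ T.verts
  · rw [if_pos hx, if_pos]
    exact .inl hx
  rw [if_neg hx]
  by_cases hx' : x ∈ T.carrier
  · rw [if_pos hx']
    rcases hx' with h | h
    · exact absurd h hx
    · simp only [mem_iUnion, exists_prop] at h
      obtain ⟨e, he, hxe⟩ := h
      rw [Finset.prod_eq_zero (SimpleGraph.mem_edgeFinset.2 he), zero_div]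
      rw [Metric.infDist_zero_of_mem hxe, hψ.eq_sq 0 le_rfl (by norm_num)]
      simp
  rw [if_neg hx']
  have h1 : logPhi ψ G (fun v => (f v : Euc n)) x = logPhi ψ T.graph (fun v : T.verts => (v : Euc n)) x := by
    rw [logPhi, logPhi, ← hf.sum_eq (fun e => logSq ψ (edgeDistSq (fun v : T.verts => (v : Euc n)) x e))
      (fun v => logSq ψ (‖x - (v : Euc n)‖ ^ 2)) (by simp)]
    congr 1
    refine Finset.sum_congr rfl fun e _ => ?_
    induction e with
    | _ v w => rfl
  have hx0 : x ∉ treeSet T.graph fun v : T.verts => (v : Euc n) := by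
    rintro (⟨v, rfl⟩ | ⟨v, w, h, hxe⟩)
    · exact hx v.2
    · refine hx' (.inr ?_)
      simp only [mem_iUnion, exists_prop]
      exact ⟨s(v, w), h, by rwa [edgeSegment_mk]⟩
  rw [h1, logPhi, Real.exp_sub, Real.exp_sum, Real.exp_sum]
  congr 1
  · refine Finset.prod_congr rfl fun e he => ?_
    rw [SimpleGraph.mem_edgeFinset] at he
    induction e with
    | _ v w =>
      rw [edgeDistSq_mk, hψ.exp_logSq (segDistSq_pos_of_notMem hx0 he), sqrt_segDistSq,
        edgeSegment_mk]
  · refine Finset.prod_congr rfl fun v _ => ?_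
    have h2 := norm_sq_pos_of_notMem hx0 v
    have h3 := hψ.pos (Real.sqrt_pos.2 h2)
    rw [Real.sqrt_sq (norm_nonneg _)] at h3
    rw [mul_comm, Real.exp_mul, hψ.exp_logSq h2, Real.sqrt_sq (norm_nonneg _),
      ← Real.rpow_intCast]
    push_cast
    rfl

end IsCollapsingMap

/-! ### Fiberwise retractions onto families of collapsing trees. -/

/-- The family `A` of subsets of `X`, parametrized by `Z`, is a fiberwise absolute extensor. -/
def FiberwiseExtensor {Z X : Type*} [TopologicalSpace Z] [TopologicalSpace X] (A : Z → Set X) :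
    Prop :=
  ∀ B C : Set Z, IsClosed B → IsClosed C → C ⊆ B → ∀ g : Z → X, ContinuousOn g C →
    (∀ z ∈ C, g z ∈ A z) → ∃ g' : Z → X, ContinuousOn g' B ∧ EqOn g' g C ∧ ∀ z ∈ B, g' z ∈ A z

/-- Extend into Euclidean space by Tietze, then apply the nearest point projection, which is
continuous also where the segment degenerates. -/
theorem fiberwiseExtensor_segment {Z : Type*} [TopologicalSpace Z] [NormalSpace Z] {n : ℕ}
    {v w : Z → Euc n} (hv : Continuous v) (hw : Continuous w) :
    FiberwiseExtensor fun z => segment ℝ (v z) (w z) := by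
  intro B C _ hC _ g hg hgA
  obtain ⟨h, hh⟩ := ContinuousMap.exists_restrict_eq hC ⟨C.domRestrict g, hg.domRestrict⟩
  have hh' : EqOn h g C := fun z hz => congrArg (fun k => k ⟨z, hz⟩) hh
  refine ⟨fun z => segProj (h z) (v z) (w z), ?_, fun z hz => ?_, fun z _ => segProj_mem _ _ _⟩
  · exact (continuous_segProj.comp (h.continuous.prodMk (hv.prodMk hw))).continuousOn
  · simp only [hh' hz]
    exact segProj_eq_self_of_mem (hgA z hz)

theorem isClosed_segment_family {Z : Type*} [TopologicalSpace Z] {E : Type*}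
    [NormedAddCommGroup E] [InnerProductSpace ℝ E] {v w : Z → E} (hv : Continuous v)
    (hw : Continuous w) : IsClosed {p : E × Z | p.1 ∈ segment ℝ (v p.2) (w p.2)} := by
  simp only [← segDistSq_eq_zero_iff]
  exact isClosed_eq (continuous_segDistSq.comp (continuous_fst.prodMk
    ((hv.comp continuous_snd).prodMk (hw.comp continuous_snd)))) continuous_const

open Classical in
-- C is divided according to which of the two sets g lands in, and B by which part of C is closer.
-- On the locus of equal distance the extension is put equal to the common point v, and the two
-- halves are extended separately.
theorem FiberwiseExtensor.union {Z X : Type*} [MetricSpace Z] [TopologicalSpace X]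
    {A A' : Z → Set X} (hA : FiberwiseExtensor A) (hA' : FiberwiseExtensor A')
    (hc : IsClosed {p : X × Z | p.1 ∈ A p.2}) (hc' : IsClosed {p : X × Z | p.1 ∈ A' p.2})
    {v : Z → X} (hv : Continuous v) (hvA : ∀ z, A z ∩ A' z = {v z}) :
    FiberwiseExtensor fun z => A z ∪ A' z := by
  intro B C hB hC hCB g hg hgA
  have hmem : ∀ z, v z ∈ A z ∩ A' z := fun z => by rw [hvA]; rfl
  have hcl : ∀ A₀ : Z → Set X, IsClosed {p : X × Z | p.1 ∈ A₀ p.2} →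
      IsClosed (C ∩ {z | g z ∈ A₀ z}) := fun A₀ h =>
    (hg.prodMk continuousOn_id).preimage_isClosed_of_isClosed hC h
  set CA := C ∩ {z | g z ∈ A z} with hCA
  set CA' := C ∩ {z | g z ∈ A' z} with hCA'
  have hCAc : IsClosed CA := hcl A hc
  have hCAc' : IsClosed CA' := hcl A' hc'
  have hCu : ∀ z ∈ C, z ∈ CA ∨ z ∈ CA' := fun z hz =>
    (hgA z hz).imp (fun h => ⟨hz, h⟩) fun h => ⟨hz, h⟩
  -- Extended distances are infinite to the empty set, so an empty piece of C needs no separate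
  -- case. A point of M in C has distance 0 to both pieces, which forces g = v there.
  set M := B ∩ {z | Metric.infEDist z CA = Metric.infEDist z CA'} with hM
  have hMc : IsClosed M := hB.inter
    (isClosed_eq Metric.continuous_infEDist Metric.continuous_infEDist)
  have hzero : ∀ {K : Set Z}, IsClosed K → ∀ z, Metric.infEDist z K = 0 ↔ z ∈ K :=
    fun {K} hK z => (Metric.mem_iff_infEDist_zero_of_closed hK).symm
  have hMC : ∀ z ∈ M, z ∈ C → g z = v z := by
    intro z hz hzC
    have h0 : Metric.infEDist z CA = 0 := by
      rcases hCu z hzC with h | h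
      · exact (hzero hCAc z).2 h
      · rw [hz.2]; exact (hzero hCAc' z).2 h
    have h1 := (hzero hCAc z).1 h0
    have h2 := (hzero hCAc' z).1 (hz.2 ▸ h0)
    have : g z ∈ A z ∩ A' z := ⟨h1.2, h2.2⟩
    rwa [hvA] at this
  have step : ∀ (A₀ : Z → Set X) (K : Set Z), FiberwiseExtensor A₀ → IsClosed K → K ⊆ C →
      (∀ z ∈ K, g z ∈ A₀ z) → (∀ z, v z ∈ A₀ z) → ∀ B₀ : Set Z, IsClosed B₀ → M ⊆ B₀ → K ⊆ B₀ →
      ∃ g' : Z → X, ContinuousOn g' B₀ ∧ (∀ z ∈ M, g' z = v z) ∧ (∀ z ∈ K, g' z = g z) ∧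
        ∀ z ∈ B₀, g' z ∈ A₀ z := by
    intro A₀ K hA₀ hK hKC hgK hvA₀ B₀ hB₀ hMB hKB
    have hK' : EqOn (fun z => if z ∈ M then v z else g z) g K := by
      intro z hz
      by_cases h : z ∈ M
      · simp only [if_pos h, hMC z h (hKC hz)]
      · simp only [if_neg h]
    obtain ⟨g', h1, h2, h3⟩ := hA₀ B₀ (M ∪ K) hB₀ (hMc.union hK) (union_subset hMB hKB)
      (fun z => if z ∈ M then v z else g z) (by
        refine ContinuousOn.union_of_isClosed ?_ ((hg.mono hKC).congr hK') hMc hK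
        exact hv.continuousOn.congr fun z hz => if_pos hz) (by
        intro z hz
        by_cases h : z ∈ M
        · simpa only [if_pos h] using hvA₀ z
        · simpa only [if_neg h] using hgK z (hz.resolve_left h))
    exact ⟨g', h1, fun z hz => (h2 (.inl hz)).trans (if_pos hz),
      fun z hz => (h2 (.inr hz)).trans (hK' hz), h3⟩
  have hle : ∀ {K K' : Set Z}, IsClosed (B ∩ {z | Metric.infEDist z K ≤ Metric.infEDist z K'}) :=
    fun {K K'} => hB.inter (isClosed_le Metric.continuous_infEDist Metric.continuous_infEDist)
  obtain ⟨g₁, h1, h2, h3, h4⟩ := step A CA hA hCAc inter_subset_left (fun z hz => hz.2)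
    (fun z => (hmem z).1) _ (hle (K := CA) (K' := CA')) (fun z hz => ⟨hz.1, le_of_eq hz.2⟩)
    (fun z hz => ⟨hCB hz.1, by
      show Metric.infEDist z CA ≤ _
      rw [(hzero hCAc z).2 hz]; exact zero_le⟩)
  obtain ⟨g₂, k1, k2, k3, k4⟩ := step A' CA' hA' hCAc' inter_subset_left (fun z hz => hz.2)
    (fun z => (hmem z).2) _ (hle (K := CA') (K' := CA)) (fun z hz => ⟨hz.1, ge_of_eq hz.2⟩)
    (fun z hz => ⟨hCB hz.1, by
      show Metric.infEDist z CA' ≤ _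
      rw [(hzero hCAc' z).2 hz]; exact zero_le⟩)
  set G : Z → X := fun z => if Metric.infEDist z CA ≤ Metric.infEDist z CA' then g₁ z else g₂ z
  have hG1 : ∀ z, Metric.infEDist z CA ≤ Metric.infEDist z CA' → G z = g₁ z := fun z h => if_pos h
  have hG2 : ∀ z ∈ B, Metric.infEDist z CA' ≤ Metric.infEDist z CA → G z = g₂ z := by
    intro z hz h
    rcases h.lt_or_eq with h | h
    · exact if_neg (not_le.2 h)
    · rw [hG1 z h.ge, h2 z ⟨hz, h.symm⟩, k2 z ⟨hz, h.symm⟩]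
  refine ⟨G, ?_, ?_, ?_⟩
  · have hBu : B = (B ∩ {z | Metric.infEDist z CA ≤ Metric.infEDist z CA'}) ∪
        (B ∩ {z | Metric.infEDist z CA' ≤ Metric.infEDist z CA}) := by
      rw [← inter_union_distrib_left, eq_comm, inter_eq_left]
      exact fun z _ => (le_total (Metric.infEDist z CA) (Metric.infEDist z CA')).imp id id
    rw [hBu]
    exact ContinuousOn.union_of_isClosed (h1.congr fun z hz => hG1 z hz.2)
      (k1.congr fun z hz => hG2 z hz.1 hz.2) hle hle
  · intro z hz
    rcases hCu z hz with h | h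
    · rw [hG1 z (by rw [(hzero hCAc z).2 h]; exact zero_le), h3 z h]
    · rw [hG2 z (hCB hz) (by rw [(hzero hCAc' z).2 h]; exact zero_le), k3 z h]
  · intro z hz
    rcases le_total (Metric.infEDist z CA) (Metric.infEDist z CA') with h | h
    · rw [hG1 z h]
      exact .inl (h4 z ⟨hz, h⟩)
    · rw [hG2 z hz h]
      exact .inr (k4 z ⟨hz, h⟩)

theorem mem_treeSet_iff {E : Type*} [NormedAddCommGroup E] [InnerProductSpace ℝ E] {V : Type*}
    {G : SimpleGraph V} (hG : G.IsTree) (o : V) (P : V → E) (x : E) :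
    x ∈ treeSet G P ↔ ∃ v, x ∈ segment ℝ (P v) (P (par hG o v)) := by
  constructor
  · rintro (⟨v, rfl⟩ | ⟨v, w, h, hx⟩)
    · exact ⟨v, left_mem_segment ℝ _ _⟩
    · rcases eq_par_or_eq_par hG o h with rfl | rfl
      · exact ⟨_, hx⟩
      · rw [segment_symm] at hx
        exact ⟨_, hx⟩
  · rintro ⟨v, hx⟩
    by_cases hv : v = o
    · subst hv
      rw [par_self, segment_same] at hx
      exact .inl ⟨v, hx⟩
    · exact .inr ⟨_, _, adj_par hG hv, hx⟩

/-- Families of linear trees obtained by collapsing a fixed tree are fiberwise absolute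
extensors. -/
theorem fiberwiseExtensor_tree {Z : Type*} [MetricSpace Z] {n : ℕ} {V : Type*} [Finite V]
    {G : SimpleGraph V} (hG : G.IsTree) {T : Z → LinearTree n} {f : (z : Z) → V → (T z).verts}
    (hf : ∀ z, IsCollapsingMap G (T z) (f z)) (hc : ∀ v, Continuous fun z => (f z v : Euc n)) :
    FiberwiseExtensor fun z => treeSet G fun v => (f z v : Euc n) := by
  classical
  have := Fintype.ofFinite V
  obtain ⟨o⟩ := hG.connected.nonempty
  let K : Finset V → Z → Set (Euc n) := fun S z =>
    {x | ∃ v ∈ S, x ∈ segment ℝ (f z v : Euc n) (f z (par hG o v))}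
  have hKc : ∀ S, IsClosed {p : Euc n × Z | p.1 ∈ K S p.2} := by
    intro S
    have : {p : Euc n × Z | p.1 ∈ K S p.2} = ⋃ v ∈ S, {p : Euc n × Z |
        p.1 ∈ segment ℝ (f p.2 v : Euc n) (f p.2 (par hG o v))} := by
      ext p
      simp [K]
    rw [this]
    exact isClosed_biUnion_finset fun v _ => isClosed_segment_family (hc v) (hc _)
  have main : ∀ (m : ℕ) (S : Finset V), S.card = m → o ∈ S →
      (∀ u ∈ S, u ≠ o → par hG o u ∈ S) → FiberwiseExtensor (K S) := by
    intro m
    induction m with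
    | zero =>
      intro S h0 ho
      rw [Finset.card_eq_zero] at h0
      simp [h0] at ho
    | succ m ih =>
      intro S hcard ho hS
      by_cases hne : (S.erase o).Nonempty
      -- A vertex farthest from the root is not the parent of another one, so removing it leaves a
      -- set closed under taking parents.
      · obtain ⟨v, hv, hmax⟩ := Finset.exists_max_image (S.erase o)
          (fun u => (pathTo hG u o).length) hne
        have hvo := Finset.ne_of_mem_erase hv
        have hvS := Finset.mem_of_mem_erase hv
        have ho' : o ∈ S.erase v := Finset.mem_erase.2 ⟨hvo.symm, ho⟩
        have hS' : ∀ u ∈ S.erase v, u ≠ o → par hG o u ∈ S.erase v := by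
          intro u hu huo
          refine Finset.mem_erase.2 ⟨fun h => ?_, hS u (Finset.mem_of_mem_erase hu) huo⟩
          have h1 := hmax u (Finset.mem_erase.2 ⟨huo, Finset.mem_of_mem_erase hu⟩)
          have h2 := length_pathTo_par hG huo
          rw [h] at h2
          omega
        have hpar : par hG o v ∈ S.erase v :=
          Finset.mem_erase.2 ⟨(adj_par hG hvo).ne', hS v hvS hvo⟩
        have h1 := ih (S.erase v) (by rw [Finset.card_erase_of_mem hvS]; omega) ho' hS'
        have h2 := h1.union (fiberwiseExtensor_segment (hc v) (hc (par hG o v))) (hKc _)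
          (isClosed_segment_family (hc v) (hc _)) (hc (par hG o v)) (by
            intro z
            refine subset_antisymm ?_ ?_
            · rintro y ⟨⟨u, hu, hyu⟩, hyv⟩
              exact (hf z).eq_of_mem_segment_inter hG (S := (S.erase v : Finset V))
                (fun u hu huo => hS' u hu huo) hu (by simp) hvo hyu hyv
            · rintro y rfl
              exact ⟨⟨_, hpar, left_mem_segment ℝ _ _⟩, right_mem_segment ℝ _ _⟩)
        convert h2 using 2 with z
        ext y
        simp only [K, Set.mem_union, Set.mem_ofPred_eq]
        constructor
        · rintro ⟨u, hu, hy⟩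
          by_cases huv : u = v
          · exact .inr (huv ▸ hy)
          · exact .inl ⟨u, Finset.mem_erase.2 ⟨huv, hu⟩, hy⟩
        · rintro (⟨u, hu, hy⟩ | hy)
          · exact ⟨u, Finset.mem_of_mem_erase hu, hy⟩
          · exact ⟨v, hvS, hy⟩
      · have hS1 : S = {o} := by
          rw [Finset.not_nonempty_iff_eq_empty, Finset.erase_eq_empty_iff] at hne
          exact hne.resolve_left fun h => by simp [h] at ho
        have := fiberwiseExtensor_segment (hc o) (hc o)
        convert this using 2 with z
        ext y
        simp [K, hS1]
  have := main _ Finset.univ rfl (Finset.mem_univ _) (fun _ _ _ => Finset.mem_univ _)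
  convert this using 2 with z
  ext y
  rw [mem_treeSet_iff hG o]
  simp [K]

/-- The extensor property over the base consisting of all pairs (x, t), applied to the first
projection defined on the total space of the trees. -/
theorem exists_fiberwise_retraction {Pm : Type*} [MetricSpace Pm] {D : Set Pm} {n : ℕ} {V : Type*}
    [Finite V] {G : SimpleGraph V} (hG : G.IsTree) {T : Pm → LinearTree n}
    {f : (t : Pm) → V → (T t).verts} (hf : ∀ t ∈ D, IsCollapsingMap G (T t) (f t))
    (hc : ∀ v, ContinuousOn (fun t => (f t v : Euc n)) D) :
    ∃ ρ : Euc n × Pm → Euc n, ContinuousOn ρ (univ ×ˢ D) ∧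
      (∀ t ∈ D, ∀ x, ρ (x, t) ∈ treeSet G fun v => (f t v : Euc n)) ∧
      ∀ t ∈ D, ∀ x ∈ treeSet G (fun v => (f t v : Euc n)), ρ (x, t) = x := by
  classical
  have hc' : ∀ v, Continuous fun z : Euc n × D => (f z.2 v : Euc n) := fun v =>
    (continuousOn_iff_continuous_domRestrict.1 (hc v)).comp continuous_snd
  have h := fiberwiseExtensor_tree (Z := Euc n × D) hG (T := fun z => T z.2)
    (f := fun z => f z.2) (fun z => hf z.2 z.2.2) hc'
  have hcl : IsClosed {z : Euc n × D | z.1 ∈ treeSet G fun v => (f z.2 v : Euc n)} := by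
    obtain ⟨o⟩ := hG.connected.nonempty
    have : {z : Euc n × D | z.1 ∈ treeSet G fun v => (f z.2 v : Euc n)} =
        ⋃ v, {z : Euc n × D | z.1 ∈ segment ℝ (f z.2 v : Euc n) (f z.2 (par hG o v))} := by
      ext z
      simp [mem_treeSet_iff hG o]
    rw [this]
    refine isClosed_iUnion_of_finite fun v => ?_
    simp only [← segDistSq_eq_zero_iff]
    exact isClosed_eq (continuous_segDistSq.comp (continuous_fst.prodMk
      ((hc' v).prodMk (hc' _)))) continuous_const
  obtain ⟨g, h1, h2, h3⟩ := h univ _ isClosed_univ hcl (subset_univ _) Prod.fst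
    continuous_fst.continuousOn fun z hz => hz
  refine ⟨fun z => if hz : z.2 ∈ D then g (z.1, ⟨z.2, hz⟩) else z.1, ?_, fun t ht x => ?_,
    fun t ht x hx => ?_⟩
  · rw [continuousOn_iff_continuous_domRestrict]
    have e : (univ ×ˢ D).domRestrict (fun z : Euc n × Pm =>
        if hz : z.2 ∈ D then g (z.1, ⟨z.2, hz⟩) else z.1) =
        fun z : ↥(univ ×ˢ D : Set (Euc n × Pm)) => g (z.1.1, ⟨z.1.2, z.2.2⟩) := by
      ext1 z
      exact dif_pos z.2.2
    rw [e]
    refine (continuousOn_univ.1 h1).comp ?_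
    fun_prop
  · simp only [dif_pos ht]
    exact h3 (x, ⟨t, ht⟩) (mem_univ _)
  · simp only [dif_pos ht]
    exact h2 (x := (x, ⟨t, ht⟩)) hx

/-! ### C¹ regularity jointly or along fibers, and implicit functions over arbitrary sets. -/

section Regularity

variable {X Y Z W : Type*} [NormedAddCommGroup X] [NormedSpace ℝ X] [NormedAddCommGroup Y]
  [NormedSpace ℝ Y] [NormedAddCommGroup Z] [NormedSpace ℝ Z] [NormedAddCommGroup W]
  [NormedSpace ℝ W]

/-- Near `z`, the restriction of `f` to `S` is continuous, and it is differentiable along the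
subsets `{y' ∈ S | R y y'}` with a continuous choice of derivatives. -/
def RegAt (R : Z → Z → Prop) (S : Set Z) (f : Z → Y) (z : Z) : Prop :=
  ∃ f' : Z → Z →L[ℝ] Y, ∀ᶠ y in 𝓝[S] z, ContinuousWithinAt f S y ∧ ContinuousWithinAt f' S y ∧
    HasFDerivWithinAt f (f' y) (S ∩ {y' | R y y'}) y

variable {R : Z → Z → Prop} {S : Set Z} {f : Z → Y} {z : Z}

theorem RegAt.continuousWithinAt (h : RegAt R S f z) (hz : z ∈ S) : ContinuousWithinAt f S z := by
  obtain ⟨f', h⟩ := h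
  exact (h.self_of_nhdsWithin hz).1

theorem RegAt.congr {g : Z → Y} (h : RegAt R S f z) (hg : ∀ᶠ y in 𝓝[S] z, g y = f y) :
    RegAt R S g z := by
  obtain ⟨f', h⟩ := h
  refine ⟨f', ?_⟩
  filter_upwards [h, eventually_eventually_nhdsWithin.2 hg, hg, self_mem_nhdsWithin]
    with y hy hgy hgy' hyS
  exact ⟨hy.1.congr_of_eventuallyEq hgy hgy', hy.2.1,
    hy.2.2.congr_of_eventuallyEq (hgy.filter_mono (nhdsWithin_mono _ inter_subset_left)) hgy'⟩

theorem RegAt.of_contDiffWithinAt (hz : z ∈ S) (h : ContDiffWithinAt ℝ 1 f S z) :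
    RegAt R S f z := by
  have h' : ContDiffWithinAt ℝ (0 + 1) f S z := by simpa using h
  obtain ⟨u, hu, -, -, f', hf', hf''⟩ := (contDiffWithinAt_succ_iff_hasFDerivWithinAt'
    (n := 0) (by simp)).1 h'
  rw [insert_eq_of_mem hz] at hu
  obtain ⟨v, hv, hv'⟩ := (contDiffWithinAt_zero hz).1 hf''
  refine ⟨f', ?_⟩
  filter_upwards [hu, eventually_eventually_nhdsWithin.2 hv, hv, self_mem_nhdsWithin]
    with y hy hyv hyv' hyS
  exact ⟨(hf' y hy).continuousWithinAt, (hv' y ⟨hyS, hyv'⟩).mono_of_mem_nhdsWithin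
    (inter_mem self_mem_nhdsWithin hyv), (hf' y hy).mono inter_subset_left⟩

theorem RegAt.of_contDiffAt (hz : z ∈ S) (h : ContDiffAt ℝ 1 f z) : RegAt R S f z :=
  .of_contDiffWithinAt hz h.contDiffWithinAt

theorem RegAt.contDiffWithinAt (hz : z ∈ S) (h : RegAt R S f z) (hR : ∀ y y', R y y') :
    ContDiffWithinAt ℝ 1 f S z := by
  obtain ⟨f', h⟩ := h
  have : ContDiffWithinAt ℝ (0 + 1) f S z := by
    refine (contDiffWithinAt_succ_iff_hasFDerivWithinAt' (n := 0) (by simp)).2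
      ⟨{y | y ∈ S ∧ HasFDerivWithinAt f (f' y) S y}, ?_, fun y hy => mem_insert_of_mem _ hy.1,
        by simp, f', fun y hy => hy.2, ?_⟩
    · rw [insert_eq_of_mem hz]
      filter_upwards [self_mem_nhdsWithin, h] with y hyS hy
      exact ⟨hyS, by simpa [hR] using hy.2.2⟩
    · exact (contDiffWithinAt_zero hz).2 ⟨_, h, fun y hy => hy.2.2.1.mono inter_subset_left⟩
  simpa using this

theorem RegAt.prodMk {g : Z → X} (hf : RegAt R S f z) (hg : RegAt R S g z) :
    RegAt R S (fun y => (f y, g y)) z := by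
  obtain ⟨f', hf⟩ := hf
  obtain ⟨g', hg⟩ := hg
  refine ⟨fun y => (f' y).prod (g' y), ?_⟩
  filter_upwards [hf, hg] with y hf hg
  refine ⟨hf.1.prodMk hg.1, ?_, hf.2.2.prodMk hg.2.2⟩
  exact (ContinuousLinearMap.prodₗᵢ ℝ (E := Z) (F := Y) (G := X)
    (𝕜 := ℝ)).continuous.continuousAt.comp_continuousWithinAt (hf.2.1.prodMk hg.2.1)

theorem RegAt.comp {g : X → Y} {T : Set X} {Q : X → X → Prop} {f : Z → X}
    (hg : RegAt Q T g (f z)) (hf : RegAt R S f z) (hz : z ∈ S) (hm : MapsTo f S T)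
    (hR : ∀ y y', R y y' → Q (f y) (f y')) : RegAt R S (fun y => g (f y)) z := by
  have hc := hf.continuousWithinAt hz
  obtain ⟨f', hf⟩ := hf
  obtain ⟨g', hg⟩ := hg
  refine ⟨fun y => (g' (f y)).comp (f' y), ?_⟩
  have ht : Tendsto f (𝓝[S] z) (𝓝[T] (f z)) := hc.tendsto_nhdsWithin hm
  filter_upwards [hf, ht.eventually hg] with y hf hg
  exact ⟨hg.1.comp hf.1 hm, (hg.2.1.comp hf.1 hm).clm_comp hf.2.1,
    hg.2.2.comp y hf.2.2 fun w hw => ⟨hm hw.1, hR _ _ hw.2⟩⟩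

theorem RegAt.comp_contDiffAt {g : X → Y} {f : Z → X} (hg : ContDiffAt ℝ 1 g (f z))
    (hf : RegAt R S f z) (hz : z ∈ S) : RegAt R S (fun y => g (f y)) z :=
  RegAt.comp (Q := fun _ _ => True) (.of_contDiffAt (mem_univ _) hg) hf hz (mapsTo_univ _ _)
    fun _ _ _ => trivial

/-- The relation along which functions on a family over `B` are differentiated: all directions, or
only those in the fibers. -/
def Rel (J : Prop) (z z' : X × Z) : Prop := J ∨ z.2 = z'.2

/-- With J false only points of the same fiber are compared, so a derivative in x, extended by zero
in the parameter directions, suffices. -/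
theorem RegAt.of_slice {D : Set Z} {f : X × Z → Y} {z : X × Z} {f' : X × Z → X →L[ℝ] Y}
    (h : ∀ᶠ y in 𝓝[univ ×ˢ D] z, ContinuousWithinAt f (univ ×ˢ D) y ∧
      ContinuousWithinAt f' (univ ×ˢ D) y ∧ HasFDerivAt (fun x => f (x, y.2)) (f' y) y.1) :
    RegAt (Rel False) (univ ×ˢ D) f z := by
  refine ⟨fun y => (f' y).comp (.fst ℝ X Z), h.mono fun y hy => ⟨hy.1,
    hy.2.1.clm_comp continuousWithinAt_const, ?_⟩⟩
  have : HasFDerivAt (fun w : X × Z => f (w.1, y.2)) ((f' y).comp (.fst ℝ X Z)) y :=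
    HasFDerivAt.comp y (f := Prod.fst) hy.2.2 hasFDerivAt_fst
  refine this.hasFDerivWithinAt.congr (fun w hw => ?_) rfl
  rw [(hw.2.resolve_left id : y.2 = w.2)]

theorem RegAt.hasFDerivAt_slice {J : Prop} {D : Set Z} {f : X × Z → Y} {z : X × Z}
    (h : RegAt (Rel J) (univ ×ˢ D) f z) :
    ∃ f' : X × Z → X →L[ℝ] Y, ∀ᶠ y in 𝓝[univ ×ˢ D] z, ContinuousWithinAt f' (univ ×ˢ D) y ∧
      HasFDerivAt (fun x => f (x, y.2)) (f' y) y.1 := by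
  obtain ⟨f', h⟩ := h
  refine ⟨fun y => (f' y).comp (.inl ℝ X Z), ?_⟩
  filter_upwards [h, self_mem_nhdsWithin] with y hy hyS
  refine ⟨hy.2.1.clm_comp continuousWithinAt_const, ?_⟩
  have h1 : HasFDerivAt (fun x : X => (x, y.2)) (.inl ℝ X Z) y.1 := hasFDerivAt_prodMk_left _ _
  have := HasFDerivWithinAt.comp (t := (univ ×ˢ D) ∩ {y' | Rel J y y'}) (s := univ) y.1
    (f := fun x : X => (x, y.2)) (g := f) hy.2.2 h1.hasFDerivWithinAt
    fun x _ => ⟨⟨mem_univ _, hyS.2⟩, .inr rfl⟩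
  exact hasFDerivWithinAt_univ.1 this

theorem RegAt.differentiableAt_slice {J : Prop} {D : Set Z} {f : X × Z → Y} {z : X × Z}
    (h : RegAt (Rel J) (univ ×ˢ D) f z) (hz : z.2 ∈ D) :
    DifferentiableAt ℝ (fun x => f (x, z.2)) z.1 := by
  obtain ⟨f', h⟩ := h.hasFDerivAt_slice
  exact (h.self_of_nhdsWithin ⟨mem_univ _, hz⟩).2.differentiableAt

theorem RegAt.continuousWithinAt_fderiv_slice {J : Prop} {D : Set Z} {f : X × Z → Y} {z : X × Z}
    (h : RegAt (Rel J) (univ ×ˢ D) f z) (hz : z.2 ∈ D) :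
    ContinuousWithinAt (fun y : X × Z => fderiv ℝ (fun x => f (x, y.2)) y.1) (univ ×ˢ D) z := by
  obtain ⟨f', h⟩ := h.hasFDerivAt_slice
  have h0 := h.self_of_nhdsWithin ⟨mem_univ _, hz⟩
  exact h0.1.congr_of_eventuallyEq (h.mono fun y hy => hy.2.fderiv) h0.2.fderiv

theorem exists_shear_equiv (e : W ≃L[ℝ] W) (C : Z →L[ℝ] W) : ∃ L : (W × Z) ≃L[ℝ] (W × Z),
    (L : W × Z →L[ℝ] W × Z) = ((e : W →L[ℝ] W).coprod C).prod (.snd ℝ W Z) ∧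
    ∀ p, L.symm p = (e.symm (p.1 - C p.2), p.2) :=
  ⟨ContinuousLinearEquiv.equivOfInverse (((e : W →L[ℝ] W).coprod C).prod (.snd ℝ W Z))
    (((e.symm : W →L[ℝ] W).comp (.fst ℝ W Z - C.comp (.snd ℝ W Z))).prod (.snd ℝ W Z))
    (fun p => Prod.ext (by simp) (by simp)) (fun p => Prod.ext (by simp) (by simp)),
    rfl, fun p => rfl⟩

/-- The map p ↦ (f p, p.2) has an invertible triangular derivative, and (σ, id) is a continuous
local right inverse of it over {c} × T, so it is differentiable there. Existence and continuity of σ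
are given, so T need not be open. -/
theorem hasFDerivWithinAt_implicit {T : Set Z} {f : W × Z → W} {σ : Z → W} {y : Z} {c : W}
    {e : W ≃L[ℝ] W} {C : Z →L[ℝ] W} (hy : y ∈ T)
    (hf : HasFDerivWithinAt f ((e : W →L[ℝ] W).coprod C) (univ ×ˢ T) (σ y, y))
    (hσ : ContinuousWithinAt σ T y) (hc : ∀ᶠ w in 𝓝[T] y, f (σ w, w) = c) :
    HasFDerivWithinAt σ (-(e.symm : W →L[ℝ] W).comp C) T y := by
  obtain ⟨L, hL, hL'⟩ := exists_shear_equiv e C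
  have h1 : HasFDerivWithinAt (fun p : W × Z => (f p, p.2)) (L : W × Z →L[ℝ] W × Z)
      (univ ×ˢ T) (σ y, y) := by
    rw [hL]
    exact hf.prodMk hasFDerivWithinAt_snd
  have hT : Tendsto (fun p : W × Z => p.2) (𝓝[{c} ×ˢ T] (c, y)) (𝓝[T] y) := by
    rw [nhdsWithin_prod_eq]
    exact tendsto_snd
  have h2 : HasFDerivWithinAt (fun p : W × Z => (σ p.2, p.2)) (L.symm : W × Z →L[ℝ] W × Z)
      ({c} ×ˢ T) (c, y) := by
    refine HasFDerivWithinAt.of_local_left_inverse (f := fun p : W × Z => (f p, p.2))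
      (t := univ ×ˢ T) ?_ h1 ⟨rfl, hy⟩ ?_
    · have : ContinuousWithinAt (fun p : W × Z => (σ p.2, p.2)) ({c} ×ˢ T) (c, y) :=
        (hσ.comp continuousWithinAt_snd fun p hp => hp.2).prodMk continuousWithinAt_snd
      exact this.tendsto_nhdsWithin fun p hp => ⟨mem_univ _, hp.2⟩
    · filter_upwards [hT.eventually hc, self_mem_nhdsWithin] with p hp hpS
      exact Prod.ext (hp.trans hpS.1.symm) rfl
  have h3 : HasFDerivWithinAt (fun w : Z => (c, w)) (.inr ℝ W Z) T y :=
    (hasFDerivAt_prodMk_right _ _).hasFDerivWithinAt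
  have h4 : HasFDerivWithinAt (fun w : Z => (σ w, w))
      ((L.symm : W × Z →L[ℝ] W × Z).comp (.inr ℝ W Z)) T y := h2.comp y h3 fun w hw => ⟨rfl, hw⟩
  have h5 : -(e.symm : W →L[ℝ] W).comp C = (ContinuousLinearMap.fst ℝ W Z).comp
      ((L.symm : W × Z →L[ℝ] W × Z).comp (.inr ℝ W Z)) := by
    ext w
    simp [hL']
  rw [h5]
  exact h4.fst

/-- A continuous solution of an equation is as regular as the equation. -/
theorem RegAt.implicit [CompleteSpace W] {J : Prop} {B : Type*} [NormedAddCommGroup B]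
    [NormedSpace ℝ B] {D : Set B} {f : W × X × B → W} {σ : X × B → W} {z : X × B} {c : W}
    (hz : z ∈ univ ×ˢ D)
    (hf : RegAt (fun y y' => Rel J y.2 y'.2) (univ ×ˢ univ ×ˢ D) f (σ z, z))
    (hσ : ∀ᶠ y in 𝓝[univ ×ˢ D] z, ContinuousWithinAt σ (univ ×ˢ D) y)
    (hc : ∀ᶠ y in 𝓝[univ ×ˢ D] z, f (σ y, y) = c)
    (hi : (fderiv ℝ (fun w => f (w, z)) (σ z)).IsInvertible) :
    RegAt (Rel J) (univ ×ˢ D) σ z := by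
  set S : Set (X × B) := univ ×ˢ D with hS
  obtain ⟨f', hf⟩ := hf
  have hσz := hσ.self_of_nhdsWithin hz
  have hpc : ∀ y, ContinuousWithinAt σ S y →
      Tendsto (fun y => (σ y, y)) (𝓝[S] y) (𝓝[univ ×ˢ S] (σ y, y)) := fun y hy =>
    (hy.prodMk continuousWithinAt_id).tendsto_nhdsWithin fun y hy => ⟨mem_univ _, hy⟩
  have hsl : ∀ w y, y ∈ S → HasFDerivWithinAt f (f' (w, y))
      ((univ ×ˢ S) ∩ {y' | Rel J (w, y).2 y'.2}) (w, y) →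
      HasFDerivAt (fun w => f (w, y)) ((f' (w, y)).comp (.inl ℝ W (X × B))) w := by
    intro w y hy h
    have h1 : HasFDerivAt (fun w : W => (w, y)) (.inl ℝ W (X × B)) w := hasFDerivAt_prodMk_left _ _
    have := HasFDerivWithinAt.comp (s := univ) w (f := fun w : W => (w, y)) (g := f) h
      h1.hasFDerivWithinAt fun x _ => ⟨⟨mem_univ _, hy⟩, .inr rfl⟩
    exact hasFDerivWithinAt_univ.1 this
  set A : X × B → W →L[ℝ] W := fun y => (f' (σ y, y)).comp (.inl ℝ W (X × B)) with hA
  set C : X × B → X × B →L[ℝ] W := fun y => (f' (σ y, y)).comp (.inr ℝ W (X × B)) with hC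
  have hf2 := (hpc z hσz).eventually hf
  have hi0 : (A z).IsInvertible := by
    have := hi
    rwa [(hsl _ _ hz (hf2.self_of_nhdsWithin hz).2.2).fderiv] at this
  have hAc : ∀ y, ContinuousWithinAt σ S y → ContinuousWithinAt f' (univ ×ˢ S) (σ y, y) →
      ContinuousWithinAt A S y ∧ ContinuousWithinAt C S y := fun y h1 h2 => by
    have : ContinuousWithinAt (fun y => f' (σ y, y)) S y := h2.tendsto.comp (hpc y h1)
    exact ⟨this.clm_comp continuousWithinAt_const, this.clm_comp continuousWithinAt_const⟩
  have hinv : ∀ᶠ y in 𝓝[S] z, (A y).IsInvertible := by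
    obtain ⟨e, he⟩ := hi0
    have := (hAc z hσz (hf2.self_of_nhdsWithin hz).2.1).1.eventually_mem
      (he ▸ ContinuousLinearEquiv.nhds e)
    exact this.mono fun y hy => by obtain ⟨e', h'⟩ := hy; exact ⟨e', h'⟩
  refine ⟨fun y => -(A y).inverse.comp (C y), ?_⟩
  filter_upwards [hσ, hf2, hinv, hc, eventually_eventually_nhdsWithin.2 hc, self_mem_nhdsWithin]
    with y hσy hfy hiy hcy hcy' hyS
  obtain ⟨hAy, hCy⟩ := hAc y hσy hfy.2.1
  refine ⟨hσy, ?_, ?_⟩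
  · obtain ⟨e, he⟩ := hiy
    have h1 : ContinuousAt ContinuousLinearMap.inverse (A y) := by
      rw [← he]
      exact (contDiffAt_map_inverse (n := 0) e).continuousAt
    exact ((h1.comp_continuousWithinAt hAy).clm_comp hCy).neg
  · obtain ⟨e, he⟩ := hiy
    have h5 : (A y).inverse = e.symm := by rw [← he]; simp
    rw [h5]
    refine hasFDerivWithinAt_implicit (f := f) (c := c) ⟨hyS, .inr rfl⟩ ?_
      (hσy.mono inter_subset_left) (hcy'.filter_mono (nhdsWithin_mono _ inter_subset_left))
    have h6 : (e : W →L[ℝ] W).coprod (C y) = f' (σ y, y) := by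
      rw [he]
      ext p <;> simp [A, C]
    have h7 : (univ ×ˢ (S ∩ {y' | Rel J y y'}) : Set (W × X × B)) =
        (univ ×ˢ S) ∩ {y' | Rel J y y'.2} := by
      ext p
      simp
    rw [h6, h7]
    exact hfy.2.2

end Regularity

/-! ### Families without fiberwise critical points: comparing nearby fibers. -/

theorem exists_pos_forall_dist_lt {α : Type*} [PseudoMetricSpace α] {K : Set α} (hK : IsCompact K)
    {Q : α → Prop} (h : ∀ q ∈ K, ∀ᶠ q' in 𝓝 q, Q q') :
    ∃ ε > 0, ∀ q ∈ K, ∀ q', dist q' q < ε → Q q' := by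
  obtain ⟨ε, hε, h'⟩ := hK.exists_thickening_subset_open (isOpen_interior (s := {q | Q q}))
    fun q hq => mem_interior_iff_mem_nhds.2 (h q hq)
  exact ⟨ε, hε, fun q hq q' hd => interior_subset (h' (Metric.mem_thickening_iff.2 ⟨q, hq, hd⟩))⟩

section Family

variable {E B : Type*} [NormedAddCommGroup E] [NormedSpace ℝ E] [NormedAddCommGroup B]
  [NormedSpace ℝ B]

/-- The derivative of `Φ` along the fiber. -/
def fiberDeriv (Φ : E × B → ℝ) (z : E × B) : E →L[ℝ] ℝ := fderiv ℝ (fun x => Φ (x, z.2)) z.1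

/-- A family of nonnegative functions on `E` parametrized by `D`, regular where it is positive and
without critical points in the fibers at the levels in `(0, 1/2]`. -/
structure NoncriticalFamily (J : Prop) (D : Set B) (Φ : E × B → ℝ) : Prop where
  continuousOn : ContinuousOn Φ (univ ×ˢ D)
  nonneg : ∀ z, 0 ≤ Φ z
  compact : IsCompact {z | z.2 ∈ D ∧ Φ z ≤ 1 / 2}
  regAt : ∀ z, z.2 ∈ D → 0 < Φ z → RegAt (Rel J) (univ ×ˢ D) Φ z
  fiberDeriv_ne_zero : ∀ z, z.2 ∈ D → 0 < Φ z → Φ z ≤ 1 / 2 → fiberDeriv Φ z ≠ 0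

variable {J : Prop} {D : Set B} {Φ : E × B → ℝ}

namespace NoncriticalFamily

theorem continuousWithinAt (hΦ : NoncriticalFamily J D Φ) {z : E × B} (hz : z.2 ∈ D) :
    ContinuousWithinAt Φ (univ ×ˢ D) z := hΦ.continuousOn z ⟨mem_univ _, hz⟩

theorem isCompact_shell (hΦ : NoncriticalFamily J D Φ) (c : ℝ) {d : ℝ} (hd : d ≤ 1 / 2) :
    IsCompact {z | z.2 ∈ D ∧ c ≤ Φ z ∧ Φ z ≤ d} := by
  have h : ContinuousOn Φ {z | z.2 ∈ D ∧ Φ z ≤ 1 / 2} :=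
    hΦ.continuousOn.mono fun z hz => ⟨mem_univ _, hz.1⟩
  convert hΦ.compact.of_isClosed_subset
    (h.preimage_isClosed_of_isClosed hΦ.compact.isClosed (isClosed_Icc (a := c) (b := d)))
    inter_subset_left using 1
  ext z
  simp only [mem_ofPred_eq, mem_inter_iff, mem_preimage, mem_Icc]
  constructor
  · rintro ⟨h1, h2, h3⟩
    exact ⟨⟨h1, h3.trans hd⟩, h2, h3⟩
  · rintro ⟨⟨h1, -⟩, h2, h3⟩
    exact ⟨h1, h2, h3⟩

theorem hasFDerivAt (hΦ : NoncriticalFamily J D Φ) {z : E × B} (hz : z.2 ∈ D) (h : 0 < Φ z) :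
    HasFDerivAt (fun x => Φ (x, z.2)) (fiberDeriv Φ z) z.1 :=
  ((hΦ.regAt z hz h).differentiableAt_slice hz).hasFDerivAt

theorem continuousWithinAt_fiberDeriv (hΦ : NoncriticalFamily J D Φ) {z : E × B} (hz : z.2 ∈ D)
    (h : 0 < Φ z) : ContinuousWithinAt (fiberDeriv Φ) (univ ×ˢ D) z :=
  (hΦ.regAt z hz h).continuousWithinAt_fderiv_slice hz

open scoped Manifold in
-- The condition on ξ z is convex, and by continuity of the fiber derivative a vector good at z
-- stays good nearby, so a smooth partition of unity glues. Off the closed shell the condition is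
-- empty, hence ξ is smooth on the whole space.
theorem exists_vectorField [FiniteDimensional ℝ E] [FiniteDimensional ℝ B]
    (hΦ : NoncriticalFamily J D Φ) {c : ℝ} (hc : 0 < c) :
    ∃ ξ : E × B → E, ContDiff ℝ ∞ ξ ∧
      ∀ z, z.2 ∈ D → c ≤ Φ z → Φ z ≤ 1 / 2 → 0 < fiberDeriv Φ z (ξ z) := by
  have := exists_contMDiffMap_forall_mem_convex_of_local_const (n := ((⊤ : ℕ∞))) 𝓘(ℝ, E × B) (F := E)
    (M := E × B) (t := fun z => {v | z.2 ∈ D → c ≤ Φ z → Φ z ≤ 1 / 2 → 0 < fiberDeriv Φ z v})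
    (fun z v hv w hw a b ha hb hab h1 h2 h3 => by
      have hv := hv h1 h2 h3
      have hw := hw h1 h2 h3
      rw [map_add, map_smul, map_smul, smul_eq_mul, smul_eq_mul]
      rcases ha.eq_or_lt with rfl | ha
      · rw [zero_add] at hab
        subst hab
        simpa using hw
      · nlinarith [mul_pos ha hv, mul_nonneg hb hw.le])
    (fun z => by
      by_cases hz : z.2 ∈ D ∧ c ≤ Φ z ∧ Φ z ≤ 1 / 2
      · obtain ⟨h1, h2, h3⟩ := hz
        have h0 := hc.trans_le h2
        obtain ⟨v, hv⟩ : ∃ v, 0 < fiberDeriv Φ z v := by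
          by_contra! hcon
          refine hΦ.fiberDeriv_ne_zero z h1 h0 h3 (ContinuousLinearMap.ext fun v => ?_)
          refine le_antisymm (hcon v) ?_
          have := hcon (-v)
          rw [map_neg] at this
          simpa using this
        refine ⟨v, ?_⟩
        have hcw : ContinuousWithinAt (fun y => fiberDeriv Φ y v) (univ ×ˢ D) z :=
          (hΦ.continuousWithinAt_fiberDeriv h1 h0).clm_apply continuousWithinAt_const
        have := eventually_nhdsWithin_iff.1 (hcw.eventually (lt_mem_nhds hv))
        exact this.mono fun y hy hyD _ _ => hy ⟨mem_univ _, hyD⟩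
      · refine ⟨0, ?_⟩
        have hcl := (hΦ.isCompact_shell c le_rfl).isClosed.isOpen_compl.mem_nhds hz
        filter_upwards [hcl] with y hy h1 h2 h3
        exact absurd ⟨h1, h2, h3⟩ hy)
  obtain ⟨g, hg⟩ := this
  exact ⟨g, g.contMDiff.contDiff, hg⟩

theorem hasDerivAt_line (hΦ : NoncriticalFamily J D Φ) {x v : E} {b : B} {s : ℝ} (hb : b ∈ D)
    (h : 0 < Φ (x + s • v, b)) :
    HasDerivAt (fun s : ℝ => Φ (x + s • v, b)) (fiberDeriv Φ (x + s • v, b) v) s := by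
  have h1 : HasDerivAt (fun s : ℝ => x + s • v) v s := by
    simpa using ((hasDerivAt_id s).smul_const v).const_add x
  exact HasFDerivAt.comp_hasDerivAt s (f := fun s : ℝ => x + s • v)
    (hΦ.hasFDerivAt (z := (x + s • v, b)) hb h) h1

/-- At s = 0 and b = z.2 both inequalities hold; compactness of the shell makes the neighbourhoods
uniform. The direction ξ z stays frozen along the line. -/
theorem exists_pos_fiberDeriv_pos [FiniteDimensional ℝ E] [FiniteDimensional ℝ B]
    (hΦ : NoncriticalFamily J D Φ) {ξ : E × B → E} (hξ : Continuous ξ) {c c' d : ℝ} (hc : 0 < c)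
    (hcc : c < c') (hd : d ≤ 1 / 2)
    (hpos : ∀ z, z.2 ∈ D → c ≤ Φ z → Φ z ≤ 1 / 2 → 0 < fiberDeriv Φ z (ξ z)) :
    ∃ δ > 0, ∀ z, z.2 ∈ D → c' ≤ Φ z → Φ z ≤ d → ∀ b ∈ D, dist b z.2 < δ → ∀ s, |s| ≤ δ →
      c < Φ (z.1 + s • ξ z, b) ∧ 0 < fiberDeriv Φ (z.1 + s • ξ z, b) (ξ z) := by
  have hK := (hΦ.isCompact_shell c' hd).image
    (f := fun z : E × B => (z, (0 : ℝ), z.2)) (by fun_prop)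
  obtain ⟨ε, hε, h⟩ := exists_pos_forall_dist_lt hK (Q := fun q => q.2.2 ∈ D →
    c < Φ (q.1.1 + q.2.1 • ξ q.1, q.2.2) ∧
      0 < fiberDeriv Φ (q.1.1 + q.2.1 • ξ q.1, q.2.2) (ξ q.1)) (by
    rintro _ ⟨z, ⟨h1, h2, h3⟩, rfl⟩
    set m : (E × B) × ℝ × B → E × B := fun q => (q.1.1 + q.2.1 • ξ q.1, q.2.2) with hm
    have hmc : Continuous m := by fun_prop
    have hm0 : m (z, 0, z.2) = z := by simp [hm]
    have hmw : ContinuousWithinAt m {q | q.2.2 ∈ D} (z, 0, z.2) := hmc.continuousWithinAt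
    have hmt : MapsTo m {q | q.2.2 ∈ D} (univ ×ˢ D) := fun q hq => ⟨mem_univ _, hq⟩
    have h0 : 0 < Φ z := by linarith
    have c1 : ContinuousWithinAt (fun q => Φ (m q)) {q | q.2.2 ∈ D} (z, 0, z.2) :=
      ContinuousWithinAt.comp (t := univ ×ˢ D) (by rw [hm0]; exact hΦ.continuousWithinAt h1) hmw hmt
    have c3 : ContinuousWithinAt (fun q => fiberDeriv Φ (m q)) {q | q.2.2 ∈ D} (z, 0, z.2) :=
      ContinuousWithinAt.comp (g := fiberDeriv Φ) (t := univ ×ˢ D)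
        (by rw [hm0]; exact hΦ.continuousWithinAt_fiberDeriv h1 h0) hmw hmt
    have c2 : ContinuousWithinAt (fun q => fiberDeriv Φ (m q) (ξ q.1)) {q | q.2.2 ∈ D}
        (z, 0, z.2) := c3.clm_apply
        (hξ.comp continuous_fst).continuousWithinAt
    have e1 := c1.eventually (lt_mem_nhds (a := c) (by simp only [hm0]; linarith))
    have e2 := c2.eventually (lt_mem_nhds (a := 0)
      (by simp only [hm0]; exact hpos z h1 (by linarith) (by linarith)))
    exact eventually_nhdsWithin_iff.1 (e1.and e2))
  refine ⟨ε / 2, half_pos hε, fun z h1 h2 h3 b hb hbd s hs => ?_⟩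
  refine h (z, 0, z.2) ⟨z, ⟨h1, h2, h3⟩, rfl⟩ (z, s, b) ?_ hb
  rw [Prod.dist_eq (x := (z, s, b)), Prod.dist_eq (x := (s, b))]
  simp only [dist_self, dist_zero_right, Real.norm_eq_abs]
  exact max_lt hε (max_lt (by linarith) (by linarith))

/-- The points of the product over which two nearby fibers are compared. -/
def nearPairs (D : Set B) (ε : ℝ) : Set (B × B) := {p | p.1 ∈ D ∧ p.2 ∈ D ∧ dist p.2 p.1 < ε}

/-- On the line through x with direction ξ, the function of the fiber b is strictly increasing, so
it takes the value that x has in the fiber a exactly once; σ is the parameter of that point. The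
levels 1/8 and 3/8 surround 1/4, and the margin down to 1/16 keeps the line where ξ is known to
increase Φ. -/
theorem exists_level_shift [FiniteDimensional ℝ E] [FiniteDimensional ℝ B]
    (hΦ : NoncriticalFamily J D Φ) {ξ : E × B → E} (hξ : ContDiff ℝ ∞ ξ)
    (hpos : ∀ z, z.2 ∈ D → 1 / 16 ≤ Φ z → Φ z ≤ 1 / 2 → 0 < fiberDeriv Φ z (ξ z)) :
    ∃ δ > 0, ∃ ε > 0, ∃ σ : E × B × B → ℝ,
      (∀ q, q.2 ∈ nearPairs D ε → 1 / 8 ≤ Φ (q.1, q.2.1) → Φ (q.1, q.2.1) ≤ 3 / 8 →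
        StrictMonoOn (fun s : ℝ => Φ (q.1 + s • ξ (q.1, q.2.1), q.2.2)) (Icc (-δ) δ) ∧
        σ q ∈ Ioo (-δ) δ ∧ Φ (q.1 + σ q • ξ (q.1, q.2.1), q.2.2) = Φ (q.1, q.2.1)) ∧
      ∀ q, q.2 ∈ nearPairs D ε → 1 / 8 < Φ (q.1, q.2.1) → Φ (q.1, q.2.1) < 3 / 8 →
        RegAt (Rel J) (univ ×ˢ nearPairs D ε) σ q := by
  obtain ⟨δ, hδ, h⟩ := hΦ.exists_pos_fiberDeriv_pos hξ.continuous
    (c' := 1 / 8) (d := 3 / 8) (by norm_num) (by norm_num) (by norm_num) hpos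
  have hmono : ∀ z : E × B, z.2 ∈ D → 1 / 8 ≤ Φ z → Φ z ≤ 3 / 8 → ∀ b ∈ D, dist b z.2 < δ →
      StrictMonoOn (fun s : ℝ => Φ (z.1 + s • ξ z, b)) (Icc (-δ) δ) := by
    intro z h1 h2 h3 b hb hbd
    have hd : ∀ s ∈ Icc (-δ) δ, HasDerivAt (fun s : ℝ => Φ (z.1 + s • ξ z, b))
        (fiberDeriv Φ (z.1 + s • ξ z, b) (ξ z)) s := fun s hs =>
      hΦ.hasDerivAt_line hb (by linarith [(h z h1 h2 h3 b hb hbd s (abs_le.2 hs)).1])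
    refine strictMonoOn_of_deriv_pos (convex_Icc _ _)
      (fun s hs => (hd s hs).continuousAt.continuousWithinAt) fun s hs => ?_
    have hs' := interior_subset hs
    rw [(hd s hs').deriv]
    exact (h z h1 h2 h3 b hb hbd s (abs_le.2 hs')).2
  have hm : Continuous fun p : ℝ × E × B × B => p.2.1 + p.1 • ξ (p.2.1, p.2.2.1) := by
    have := hξ.continuous
    fun_prop
  have hcont : ∀ (s : ℝ) (T : Set (B × B)), (∀ p ∈ T, p.2 ∈ D) →
      ContinuousOn (fun q : E × B × B => Φ (q.1 + s • ξ (q.1, q.2.1), q.2.2)) (univ ×ˢ T) :=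
    fun s T hT => hΦ.continuousOn.comp
      (((hm.comp (Continuous.prodMk_right s)).prodMk (by fun_prop)).continuousOn)
      fun q hq => ⟨mem_univ _, hT _ hq.2⟩
  have hcont0 : ∀ (T : Set (B × B)), (∀ p ∈ T, p.1 ∈ D) →
      ContinuousOn (fun q : E × B × B => Φ (q.1, q.2.1)) (univ ×ˢ T) :=
    fun T hT => hΦ.continuousOn.comp (by fun_prop) fun q hq => ⟨mem_univ _, hT _ hq.2⟩
  have hK := (hΦ.isCompact_shell (1 / 8) (d := 3 / 8) (by norm_num)).image
    (f := fun z : E × B => (z.1, z.2, z.2)) (by fun_prop)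
  obtain ⟨ε₁, hε₁, hs⟩ := exists_pos_forall_dist_lt hK (Q := fun q => q.2 ∈ D ×ˢ D →
    Φ (q.1 + (-δ) • ξ (q.1, q.2.1), q.2.2) < Φ (q.1, q.2.1) ∧
      Φ (q.1, q.2.1) < Φ (q.1 + δ • ξ (q.1, q.2.1), q.2.2)) (by
    rintro _ ⟨z, ⟨h1, h2, h3⟩, rfl⟩
    have hq : (z.1, z.2, z.2) ∈ (univ ×ˢ (D ×ˢ D) : Set (E × B × B)) := ⟨mem_univ _, h1, h1⟩
    have hmz := hmono z h1 h2 h3 z.2 h1 (by simpa using hδ)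
    have c0 := hcont0 (D ×ˢ D) (fun p hp => hp.1) _ hq
    have e1 := (hcont (-δ) (D ×ˢ D) (fun p hp => hp.2) _ hq).eventually_lt c0 (by
      simpa using hmz (left_mem_Icc.2 (by linarith)) ⟨by linarith, hδ.le⟩ (neg_lt_zero.2 hδ))
    have e2 := c0.eventually_lt (hcont δ (D ×ˢ D) (fun p hp => hp.2) _ hq) (by
      simpa using hmz ⟨by linarith, hδ.le⟩ (right_mem_Icc.2 (by linarith)) hδ)
    exact (eventually_nhdsWithin_iff.1 (e1.and e2)).mono fun q hq hqD => hq ⟨mem_univ _, hqD⟩)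
  set ε := min δ ε₁ with hε
  have hA : ∀ q : E × B × B, ∃ s, q.2 ∈ nearPairs D ε → 1 / 8 ≤ Φ (q.1, q.2.1) →
      Φ (q.1, q.2.1) ≤ 3 / 8 →
      s ∈ Ioo (-δ) δ ∧ Φ (q.1 + s • ξ (q.1, q.2.1), q.2.2) = Φ (q.1, q.2.1) := by
    intro q
    by_cases hq : q.2 ∈ nearPairs D ε ∧ 1 / 8 ≤ Φ (q.1, q.2.1) ∧ Φ (q.1, q.2.1) ≤ 3 / 8
    · obtain ⟨⟨ha, hb, hab⟩, h2, h3⟩ := hq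
      have hsq := hs (q.1, q.2.1, q.2.1) ⟨(q.1, q.2.1), ⟨ha, h2, h3⟩, rfl⟩ q (by
        rw [Prod.dist_eq, Prod.dist_eq]
        simp only [dist_self]
        exact max_lt hε₁ (max_lt hε₁ (hab.trans_le (min_le_right _ _)))) ⟨ha, hb⟩
      have hc : ContinuousOn (fun s : ℝ => Φ (q.1 + s • ξ (q.1, q.2.1), q.2.2)) (Icc (-δ) δ) :=
        hΦ.continuousOn.comp (by fun_prop) fun s _ => ⟨mem_univ _, hb⟩
      obtain ⟨s, hs, hs'⟩ := intermediate_value_Ioo (by linarith) hc ⟨hsq.1, hsq.2⟩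
      exact ⟨s, fun _ _ _ => ⟨hs, hs'⟩⟩
    · exact ⟨0, fun h1 h2 h3 => absurd ⟨h1, h2, h3⟩ hq⟩
  choose σ hσ using hA
  have hmono' : ∀ q : E × B × B, q.2 ∈ nearPairs D ε → 1 / 8 ≤ Φ (q.1, q.2.1) →
      Φ (q.1, q.2.1) ≤ 3 / 8 →
      StrictMonoOn (fun s : ℝ => Φ (q.1 + s • ξ (q.1, q.2.1), q.2.2)) (Icc (-δ) δ) :=
    fun q hq h2 h3 => hmono (q.1, q.2.1) hq.1 h2 h3 q.2.2 hq.2.1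
      (hq.2.2.trans_le (min_le_left _ _))
  refine ⟨δ, hδ, ε, lt_min hδ hε₁, σ, fun q hq h2 h3 => ⟨hmono' q hq h2 h3, hσ q hq h2 h3⟩, ?_⟩
  set T : Set (B × B) := nearPairs D ε with hT
  have hT1 : ∀ p ∈ T, p.1 ∈ D := fun p hp => hp.1
  have hT2 : ∀ p ∈ T, p.2 ∈ D := fun p hp => hp.2.1
  have hU : ∀ q : E × B × B, q.2 ∈ T → 1 / 8 < Φ (q.1, q.2.1) → Φ (q.1, q.2.1) < 3 / 8 →
      ∀ᶠ y in 𝓝[univ ×ˢ T] q, y.2 ∈ T ∧ 1 / 8 < Φ (y.1, y.2.1) ∧ Φ (y.1, y.2.1) < 3 / 8 := by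
    intro q hq h2 h3
    have c0 := hcont0 T hT1 q ⟨mem_univ _, hq⟩
    filter_upwards [self_mem_nhdsWithin, c0.eventually (lt_mem_nhds h2),
      c0.eventually (gt_mem_nhds h3)] with y h1 h2 h3
    exact ⟨h1.2, h2, h3⟩
  have hσc : ∀ q : E × B × B, q.2 ∈ T → 1 / 8 < Φ (q.1, q.2.1) → Φ (q.1, q.2.1) < 3 / 8 →
      ContinuousWithinAt σ (univ ×ˢ T) q := by
    intro q hq h2 h3
    have hqS : q ∈ (univ ×ˢ T : Set (E × B × B)) := ⟨mem_univ _, hq⟩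
    obtain ⟨hσq, hσe⟩ := hσ q hq h2.le h3.le
    have hmq := hmono' q hq h2.le h3.le
    -- Strict monotonicity turns inequalities between values of Φ into inequalities between
    -- parameters, so continuity of σ follows from continuity of Φ at a fixed parameter.
    refine tendsto_order.2 ⟨fun a ha => ?_, fun a ha => ?_⟩
    · set a' := max a (-δ)
      have ha1 : a' < σ q := max_lt ha hσq.1
      have ha2 : a' ∈ Icc (-δ) δ := ⟨le_max_right _ _, (ha1.trans hσq.2).le⟩
      have := hmq ha2 ⟨hσq.1.le, hσq.2.le⟩ ha1
      have e := (hcont a' T hT2 q hqS).eventually_lt (hcont0 T hT1 q hqS)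
        (by simp only at this; rwa [hσe] at this)
      filter_upwards [e, hU q hq h2 h3] with y hy hyU
      obtain ⟨h4, h5⟩ := hσ y hyU.1 hyU.2.1.le hyU.2.2.le
      rw [← h5] at hy
      exact (le_max_left _ _).trans_lt
        (((hmono' y hyU.1 hyU.2.1.le hyU.2.2.le).lt_iff_lt ha2 ⟨h4.1.le, h4.2.le⟩).1 hy)
    · set a' := min a δ
      have ha1 : σ q < a' := lt_min ha hσq.2
      have ha2 : a' ∈ Icc (-δ) δ := ⟨(hσq.1.trans ha1).le, min_le_right _ _⟩
      have := hmq ⟨hσq.1.le, hσq.2.le⟩ ha2 ha1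
      have e := (hcont0 T hT1 q hqS).eventually_lt (hcont a' T hT2 q hqS)
        (by simp only at this; rwa [hσe] at this)
      filter_upwards [e, hU q hq h2 h3] with y hy hyU
      obtain ⟨h4, h5⟩ := hσ y hyU.1 hyU.2.1.le hyU.2.2.le
      rw [← h5] at hy
      exact (((hmono' y hyU.1 hyU.2.1.le hyU.2.2.le).lt_iff_lt ⟨h4.1.le, h4.2.le⟩ ha2).1
        hy).trans_le (min_le_left _ _)
  intro q hq h2 h3
  obtain ⟨hσq, hσe⟩ := hσ q hq h2.le h3.le
  have hqS : q ∈ (univ ×ˢ T : Set (E × B × B)) := ⟨mem_univ _, hq⟩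
  have hqS' : (σ q, q) ∈ (univ ×ˢ univ ×ˢ T : Set (ℝ × E × B × B)) := ⟨mem_univ _, hqS⟩
  have hq' := h (q.1, q.2.1) hq.1 h2.le h3.le q.2.2 hq.2.1 (hq.2.2.trans_le (min_le_left _ _))
    (σ q) (abs_le.2 ⟨hσq.1.le, hσq.2.le⟩)
  have r1 : RegAt (fun y y' : ℝ × E × B × B => Rel J y.2 y'.2) (univ ×ˢ univ ×ˢ T)
      (fun p => Φ (p.2.1 + p.1 • ξ (p.2.1, p.2.2.1), p.2.2.2)) (σ q, q) := by
    refine RegAt.comp (g := Φ) (T := univ ×ˢ D) (Q := Rel J)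
      (f := fun p : ℝ × E × B × B => (p.2.1 + p.1 • ξ (p.2.1, p.2.2.1), p.2.2.2))
      (hΦ.regAt _ hq.2.1 (by linarith [hq'.1])) (.of_contDiffAt hqS' ?_) hqS'
      (fun p hp => ⟨mem_univ _, hp.2.2.2.1⟩) fun y y' hy => hy.imp_right fun hy => by rw [hy]
    have := (hξ.of_le (m := 1) (by simp)).comp (f := fun p : ℝ × E × B × B => (p.2.1, p.2.2.1))
      (by fun_prop)
    have h' : ContDiff ℝ 1 fun p : ℝ × E × B × B =>
        (p.2.1 + p.1 • ξ (p.2.1, p.2.2.1), p.2.2.2) :=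
      (contDiff_snd.fst.add (contDiff_fst.smul this)).prodMk contDiff_snd.snd.snd
    exact h'.contDiffAt
  have r2 : RegAt (fun y y' : ℝ × E × B × B => Rel J y.2 y'.2) (univ ×ˢ univ ×ˢ T)
      (fun p => Φ (p.2.1, p.2.2.1)) (σ q, q) :=
    RegAt.comp (g := Φ) (T := univ ×ˢ D) (Q := Rel J)
      (f := fun p : ℝ × E × B × B => (p.2.1, p.2.2.1))
      (hΦ.regAt _ hq.1 (by simp only; linarith)) (.of_contDiffAt hqS' (by fun_prop)) hqS'
      (fun p hp => ⟨mem_univ _, hp.2.2.1⟩) fun y y' hy => hy.imp_right fun hy => by rw [hy]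
  refine RegAt.implicit (f := fun p : ℝ × E × B × B =>
    Φ (p.2.1 + p.1 • ξ (p.2.1, p.2.2.1), p.2.2.2) - Φ (p.2.1, p.2.2.1)) (c := 0) hqS
    (RegAt.comp_contDiffAt (g := fun r : ℝ × ℝ => r.1 - r.2) (by fun_prop) (r1.prodMk r2) hqS')
    ((hU q hq h2 h3).mono fun y hy => hσc y hy.1 hy.2.1 hy.2.2)
    ((hU q hq h2 h3).mono fun y hy => sub_eq_zero.2 (hσ y hy.1 hy.2.1.le hy.2.2.le).2) ?_
  have hd := (hΦ.hasDerivAt_line (x := q.1) (v := ξ (q.1, q.2.1)) (s := σ q) hq.2.1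
    (by linarith [hq'.1])).sub_const (Φ (q.1, q.2.1))
  rw [hd.hasFDerivAt.fderiv]
  refine ⟨ContinuousLinearEquiv.smulLeft (Units.mk0 _ hq'.2.ne'), ?_⟩
  ext
  simp

end NoncriticalFamily

end Family

theorem RegAt.mono {Y Z : Type*} [NormedAddCommGroup Y] [NormedSpace ℝ Y] [NormedAddCommGroup Z]
    [NormedSpace ℝ Z] {R : Z → Z → Prop} {S S' : Set Z} {f : Z → Y} {z : Z} (h : RegAt R S f z)
    (hS : S' ⊆ S) : RegAt R S' f z := by
  obtain ⟨f', h⟩ := h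
  exact ⟨f', (h.filter_mono (nhdsWithin_mono _ hS)).mono fun y hy =>
    ⟨hy.1.mono hS, hy.2.1.mono hS, hy.2.2.mono (inter_subset_inter_left _ hS)⟩⟩

theorem RegAt.smul {Y Z : Type*} [NormedAddCommGroup Y] [NormedSpace ℝ Y] [NormedAddCommGroup Z]
    [NormedSpace ℝ Z] {R : Z → Z → Prop} {S : Set Z} {f : Z → ℝ} {g : Z → Y} {z : Z}
    (hf : RegAt R S f z) (hg : RegAt R S g z) (hz : z ∈ S) :
    RegAt R S (fun y => f y • g y) z :=
  RegAt.comp_contDiffAt (g := fun r : ℝ × Y => r.1 • r.2)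
    (contDiff_fst.smul contDiff_snd).contDiffAt (hf.prodMk hg) hz

/-- Scaling the shift by a cut-off r does not disturb the level 1/4. Near it r = 1, and elsewhere g
(r σ) lies between g 0 and g σ, which differ by less than 1/32 and so stay on the same side of 1/4.
-/
theorem _root_.StrictMonoOn.le_quarter_iff {g : ℝ → ℝ} {δ σ r : ℝ}
    (h1 : StrictMonoOn g (Icc (-δ) δ)) (hσ : σ ∈ Ioo (-δ) δ) (hr0 : 0 ≤ r) (hr1 : r ≤ 1)
    (hab : -(1 / 32) < g 0 - g σ ∧ g 0 - g σ < 1 / 32)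
    (hr : 3 / 16 ≤ g σ → g σ ≤ 5 / 16 → r = 1) : g (r * σ) ≤ 1 / 4 ↔ g σ ≤ 1 / 4 := by
  have hσI : σ ∈ Icc (-δ) δ := ⟨hσ.1.le, hσ.2.le⟩
  have h0I : (0 : ℝ) ∈ Icc (-δ) δ := ⟨by linarith [hσ.1, hσ.2], by linarith [hσ.1, hσ.2]⟩
  have hrσ : min 0 σ ≤ r * σ ∧ r * σ ≤ max 0 σ := by
    rcases le_total 0 σ with h | h
    · exact ⟨(min_le_left _ _).trans (mul_nonneg hr0 h), le_max_of_le_right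
        (mul_le_of_le_one_left h hr1)⟩
    · exact ⟨min_le_of_right_le (by nlinarith), le_max_of_le_left
        (mul_nonpos_of_nonneg_of_nonpos hr0 h)⟩
  have hrI : r * σ ∈ Icc (-δ) δ :=
    ⟨(le_min h0I.1 hσI.1).trans hrσ.1, hrσ.2.trans (max_le h0I.2 hσI.2)⟩
  have hle : g (r * σ) ≤ max (g 0) (g σ) := by
    rcases le_max_iff.1 hrσ.2 with h | h
    · exact le_max_of_le_left (h1.monotoneOn hrI h0I h)
    · exact le_max_of_le_right (h1.monotoneOn hrI hσI h)
  have hge : min (g 0) (g σ) ≤ g (r * σ) := by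
    rcases min_le_iff.1 hrσ.1 with h | h
    · exact min_le_of_left_le (h1.monotoneOn h0I hrI h)
    · exact min_le_of_right_le (h1.monotoneOn hσI hrI h)
  rcases lt_or_ge (g σ) (3 / 16) with h | h
  · exact iff_of_true (hle.trans (max_le (by linarith) (by linarith))) (by linarith)
  · rcases lt_or_ge (5 / 16) (g σ) with h' | h'
    · refine iff_of_false (fun h4 => ?_) (by linarith)
      have := hge.trans h4
      rcases min_le_iff.1 this with h5 | h5 <;> linarith
    · rw [hr h h', one_mul]

/-! ### Perturbations of the identity. -/

section Perturbation

variable {E : Type*} [NormedAddCommGroup E]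

theorem bijective_id_add_of_lipschitzWith [CompleteSpace E] {h : E → E}
    (hh : LipschitzWith (1 / 2) h) : Function.Bijective fun x => x + h x := by
  constructor
  · intro x y hxy
    have h1 := hh.dist_le_mul x y
    have h2 : dist (h x) (h y) = dist x y := by
      rw [dist_eq_norm, dist_eq_norm, ← norm_neg]
      congr 1
      simp only at hxy
      rw [neg_sub, sub_eq_sub_iff_add_eq_add, add_comm, ← hxy, add_comm]
    rw [h2] at h1
    push_cast at h1
    exact dist_le_zero.1 (by linarith [dist_nonneg (x := x) (y := y)])
  · intro y
    have hc : ContractingWith (1 / 2) fun x => y - h x := by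
      refine ⟨by norm_num, LipschitzWith.of_dist_le_mul fun a b => ?_⟩
      rw [dist_sub_left]
      exact hh.dist_le_mul a b
    have e : y - h hc.fixedPoint = hc.fixedPoint := hc.fixedPoint_isFixedPt
    exact ⟨hc.fixedPoint, (sub_eq_iff_eq_add.1 e).symm⟩

theorem norm_sub_le_of_lipschitzWith {h : E → E} (hh : LipschitzWith (1 / 2) h) (x y : E) :
    ‖x - y‖ ≤ 2 * ‖(x + h x) - (y + h y)‖ := by
  have h1 := hh.dist_le_mul x y
  rw [dist_eq_norm, dist_eq_norm] at h1
  push_cast at h1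
  have h2 : x - y = ((x + h x) - (y + h y)) - (h x - h y) := by abel
  have h3 := norm_sub_le ((x + h x) - (y + h y)) (h x - h y)
  rw [← h2] at h3
  linarith

variable [NormedSpace ℝ E] [CompleteSpace E]

theorem isInvertible_id_add {A : E →L[ℝ] E} (hA : ‖A‖ < 1) :
    (ContinuousLinearMap.id ℝ E + A).IsInvertible := by
  refine ⟨ContinuousLinearEquiv.unitsEquiv ℝ E (Units.oneSub (-A) (by rwa [norm_neg])), ?_⟩
  ext x
  simp

end Perturbation

/-! ### Local and global trivializations of the sublevel sets. -/

section Family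

variable {E B : Type*} [NormedAddCommGroup E] [NormedSpace ℝ E] [NormedAddCommGroup B]
  [NormedSpace ℝ B] {J : Prop} {D : Set B}

/-- The inverses of the members of a family of perturbations of the identity form a family of the
same regularity. -/
theorem RegAt.invFun_id_add [CompleteSpace E] {H : E × B → E}
    (hH : ∀ z, z.2 ∈ D → RegAt (Rel J) (univ ×ˢ D) H z)
    (hl : ∀ z : E × B, z.2 ∈ D → ‖fderiv ℝ (fun x => H (x, z.2)) z.1‖ ≤ 1 / 2) :
    (∀ b ∈ D, Function.Bijective fun x => x + H (x, b)) ∧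
    ∀ z, z.2 ∈ D → RegAt (Rel J) (univ ×ˢ D)
      (fun z => Function.invFun (fun x => x + H (x, z.2)) z.1) z := by
  have hd : ∀ b ∈ D, Differentiable ℝ fun x => H (x, b) := fun b hb x =>
    (hH (x, b) hb).differentiableAt_slice hb
  have hL : ∀ b ∈ D, LipschitzWith (1 / 2) fun x => H (x, b) := fun b hb =>
    lipschitzWith_of_nnnorm_fderiv_le (hd b hb) fun x => by
      rw [← NNReal.coe_le_coe]
      simpa using hl (x, b) hb
  have hb : ∀ b ∈ D, Function.Bijective fun x => x + H (x, b) := fun b hb =>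
    bijective_id_add_of_lipschitzWith (hL b hb)
  refine ⟨hb, fun z hz => ?_⟩
  set G : E × B → E := fun z => Function.invFun (fun x => x + H (x, z.2)) z.1 with hG
  have hGe : ∀ z : E × B, z.2 ∈ D → G z + H (G z, z.2) = z.1 := fun z hz =>
    Function.rightInverse_invFun (hb z.2 hz).2 z.1
  -- The maps x ↦ x + H shrink distances at most by the factor 1/2, so G y - G z is bounded by twice
  -- the error that G z makes in the equation over y; this error is continuous in y because G z is
  -- kept fixed.
  have hGc : ContinuousOn G (univ ×ˢ D) := by
    intro z hz
    rw [ContinuousWithinAt, tendsto_iff_norm_sub_tendsto_zero]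
    have h1 : ContinuousWithinAt (fun y : E × B => 2 * ‖y.1 - (G z + H (G z, y.2))‖)
        (univ ×ˢ D) z := by
      have : ContinuousWithinAt (fun y : E × B => H (G z, y.2)) (univ ×ˢ D) z :=
        ContinuousWithinAt.comp (g := H) (f := fun y : E × B => (G z, y.2)) (t := univ ×ˢ D)
          ((hH (G z, z.2) hz.2).continuousWithinAt ⟨mem_univ _, hz.2⟩)
          (by fun_prop) fun y hy => ⟨mem_univ _, hy.2⟩
      exact continuousWithinAt_const.mul
        (continuousWithinAt_fst.sub (continuousWithinAt_const.add this)).norm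
    have h2 := h1.tendsto
    rw [hGe z hz.2, sub_self, norm_zero, mul_zero] at h2
    refine squeeze_zero' (Eventually.of_forall fun _ => norm_nonneg _) ?_ h2
    filter_upwards [self_mem_nhdsWithin] with y hy
    have := norm_sub_le_of_lipschitzWith (hL y.2 hy.2) (G y) (G z)
    rwa [hGe y hy.2] at this
  have hzS : z ∈ (univ ×ˢ D : Set (E × B)) := ⟨mem_univ _, hz⟩
  have hzS' : (G z, z) ∈ (univ ×ˢ univ ×ˢ D : Set (E × E × B)) := ⟨mem_univ _, hzS⟩
  have r1 : RegAt (fun y y' : E × E × B => Rel J y.2 y'.2) (univ ×ˢ univ ×ˢ D)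
      (fun p => H (p.1, p.2.2)) (G z, z) :=
    RegAt.comp (g := H) (T := univ ×ˢ D) (Q := Rel J) (f := fun p : E × E × B => (p.1, p.2.2))
      (hH (G z, z.2) hz) (.of_contDiffAt hzS' (by fun_prop)) hzS'
      (fun p hp => ⟨mem_univ _, hp.2.2⟩) fun y y' hy => hy
  have r2 : RegAt (fun y y' : E × E × B => Rel J y.2 y'.2) (univ ×ˢ univ ×ˢ D)
      (fun p => p.1 - p.2.1) (G z, z) := .of_contDiffAt hzS' (by fun_prop)
  refine RegAt.implicit (f := fun p : E × E × B => (p.1 - p.2.1) + H (p.1, p.2.2)) (c := 0) hzS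
    (RegAt.comp_contDiffAt (g := fun r : E × E => r.1 + r.2) (by fun_prop) (r2.prodMk r1) hzS')
    ?_ ?_ ?_
  · filter_upwards [self_mem_nhdsWithin] with y hy using hGc y hy
  · filter_upwards [self_mem_nhdsWithin] with y hy
    rw [sub_add_eq_add_sub, hGe y hy.2, sub_self]
  · have h1 : HasFDerivAt (fun w => (w - z.1) + H (w, z.2))
        (ContinuousLinearMap.id ℝ E + fderiv ℝ (fun x => H (x, z.2)) (G z)) (G z) :=
      ((hasFDerivAt_id _).sub_const _).add (hd z.2 hz (G z)).hasFDerivAt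
    rw [h1.fderiv]
    exact isInvertible_id_add ((hl (G z, z.2) hz).trans_lt (by norm_num))

variable {Φ : E × B → ℝ}

/-- The perturbation is H = β(Φ) σ ξ with a bump β around the level 1/4. It vanishes when the two
parameters agree, so its derivative in x is small for close parameters, uniformly on the compact
shell; off the shell it is locally zero. -/
theorem NoncriticalFamily.exists_level_perturbation [FiniteDimensional ℝ E]
    [FiniteDimensional ℝ B] (hΦ : NoncriticalFamily J D Φ) :
    ∃ ε > 0, ∃ H : E × B × B → E, ∀ z : E × B × B, z.2 ∈ nearPairs D ε →
      RegAt (Rel J) (univ ×ˢ nearPairs D ε) H z ∧ ‖fderiv ℝ (fun x => H (x, z.2)) z.1‖ ≤ 1 / 2 ∧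
      (Φ (z.1 + H z, z.2.2) ≤ 1 / 4 ↔ Φ (z.1, z.2.1) ≤ 1 / 4) := by
  obtain ⟨ξ, hξ, hpos⟩ := hΦ.exists_vectorField (c := 1 / 16) (by norm_num)
  obtain ⟨δ, hδ, ε, hε, σ, hσ, hσr⟩ := hΦ.exists_level_shift hξ hpos
  set T := nearPairs D ε with hT
  set Ψ : E × B × B → ℝ := fun q => Φ (q.1, q.2.1) with hΨ
  -- β is 1 on [3/16, 5/16] and 0 outside [5/32, 11/32], strictly inside the range (1/8, 3/8) where
  -- σ is regular.
  let β : ContDiffBump (1 / 4 : ℝ) := ⟨1 / 16, 3 / 32, by norm_num, by norm_num⟩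
  have hβ0 : ∀ s : ℝ, s ≤ 5 / 32 ∨ 11 / 32 ≤ s → β s = 0 := fun s hs => β.zero_of_le_dist (by
    show (3 / 32 : ℝ) ≤ _
    rw [Real.dist_eq]
    rcases hs with hs | hs
    · exact le_abs.2 (.inr (by linarith))
    · exact le_abs.2 (.inl (by linarith)))
  have hβ1 : ∀ s : ℝ, 3 / 16 ≤ s → s ≤ 5 / 16 → β s = 1 := fun s h1 h2 =>
    β.one_of_mem_closedBall (by
      show dist s _ ≤ (1 / 16 : ℝ)
      rw [Real.dist_eq]
      exact abs_le.2 ⟨by linarith, by linarith⟩)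
  set H : E × B × B → E := fun q => (β (Ψ q) * σ q) • ξ (q.1, q.2.1) with hH
  have hH0 : ∀ q, Ψ q ≤ 5 / 32 ∨ 11 / 32 ≤ Ψ q → H q = 0 := fun q hq => by
    simp only [hH, hβ0 _ hq, zero_mul, zero_smul]
  have hΨc : ContinuousOn Ψ (univ ×ˢ T) :=
    hΦ.continuousOn.comp (by fun_prop) fun q hq => ⟨mem_univ _, hq.2.1⟩
  have hfar : ∀ q : E × B × B, q.2 ∈ T → ¬ (1 / 8 < Ψ q ∧ Ψ q < 3 / 8) →
      ∀ᶠ y in 𝓝[univ ×ˢ T] q, H y = 0 := by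
    intro q hq hn
    have hc := hΨc q ⟨mem_univ _, hq⟩
    rcases le_or_gt (Ψ q) (1 / 8) with h | h
    · filter_upwards [hc.eventually (gt_mem_nhds (h.trans_lt (by norm_num : (1 / 8 : ℝ) < 5 / 32)))] with y hy
      exact hH0 y (.inl hy.le)
    · have h' : 3 / 8 ≤ Ψ q := not_lt.1 fun h' => hn ⟨h, h'⟩
      filter_upwards [hc.eventually (lt_mem_nhds ((by norm_num : (11 / 32 : ℝ) < 3 / 8).trans_le h'))] with y hy
      exact hH0 y (.inr hy.le)
  have hHr : ∀ q : E × B × B, q.2 ∈ T → RegAt (Rel J) (univ ×ˢ T) H q := by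
    intro q hq
    have hqS : q ∈ (univ ×ˢ T : Set (E × B × B)) := ⟨mem_univ _, hq⟩
    by_cases hn : 1 / 8 < Ψ q ∧ Ψ q < 3 / 8
    · have r1 : RegAt (Rel J) (univ ×ˢ T) Ψ q :=
        RegAt.comp (g := Φ) (T := univ ×ˢ D) (Q := Rel J)
          (f := fun p : E × B × B => (p.1, p.2.1))
          (hΦ.regAt _ hq.1 (by linarith [hn.1])) (.of_contDiffAt hqS (by fun_prop)) hqS
          (fun p hp => ⟨mem_univ _, hp.2.1⟩) fun y y' hy => hy.imp_right fun hy => by rw [hy]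
      have r2 := hσr q hq hn.1 hn.2
      have r3 : RegAt (Rel J) (univ ×ˢ T) (fun q : E × B × B => ξ (q.1, q.2.1)) q :=
        .of_contDiffAt hqS ((hξ.of_le (m := 1) (by simp)).comp
          (f := fun p : E × B × B => (p.1, p.2.1)) (by fun_prop)).contDiffAt
      exact ((RegAt.comp_contDiffAt β.contDiffAt r1 hqS).smul r2 hqS).smul r3 hqS
    · exact (RegAt.of_contDiffAt hqS (contDiffAt_const (c := (0 : E)))).congr (hfar q hq hn)
  have hdiag : ∀ x, ∀ a ∈ D, H (x, a, a) = 0 := by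
    intro x a ha
    by_cases hn : 1 / 8 ≤ Φ (x, a) ∧ Φ (x, a) ≤ 3 / 8
    · obtain ⟨h1, h2, h3⟩ := hσ (x, a, a) ⟨ha, ha, by simpa using hε⟩ hn.1 hn.2
      have : σ (x, a, a) = 0 :=
        h1.injOn ⟨h2.1.le, h2.2.le⟩ ⟨by linarith, hδ.le⟩ (by simpa using h3)
      simp only [hH, this, mul_zero, zero_smul]
    · refine hH0 _ ?_
      rcases le_or_gt (1 / 8) (Φ (x, a)) with h | h
      · exact .inr (by have := not_le.1 fun h' => hn ⟨h, h'⟩; simp only [hΨ]; linarith)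
      · exact .inl (by simp only [hΨ]; linarith)
  set HD : E × B × B → E →L[ℝ] E := fun q => fderiv ℝ (fun x => H (x, q.2)) q.1 with hHD
  have hK := (hΦ.isCompact_shell (1 / 8) (d := 3 / 8) (by norm_num)).image
    (f := fun z : E × B => (z.1, z.2, z.2)) (by fun_prop)
  obtain ⟨ε₁, hε₁, hs₁⟩ := exists_pos_forall_dist_lt hK (Q := fun q => q.2 ∈ T →
    ‖HD q‖ < 1 / 2) (by
    rintro _ ⟨z, ⟨h1, h2, h3⟩, rfl⟩
    have hzT : (z.2, z.2) ∈ T := ⟨h1, h1, by simpa using hε⟩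
    have hc : ContinuousWithinAt HD (univ ×ˢ T) (z.1, z.2, z.2) :=
      (hHr (z.1, z.2, z.2) hzT).continuousWithinAt_fderiv_slice hzT
    have h0 : HD (z.1, z.2, z.2) = 0 := by
      simp only [hHD, hdiag _ _ h1]
      exact fderiv_const_apply _
    have := hc.norm.eventually
      (gt_mem_nhds (show ‖HD (z.1, z.2, z.2)‖ < 1 / 2 by rw [h0, norm_zero]; norm_num))
    exact (eventually_nhdsWithin_iff.1 this).mono fun q hq hqT => hq ⟨mem_univ _, hqT⟩)
  have hK₂ := hΦ.compact.image (f := fun z : E × B => (z.1, z.2, z.2)) (by fun_prop)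
  obtain ⟨ε₂, hε₂, hs₂⟩ := exists_pos_forall_dist_lt hK₂ (Q := fun q => q.2 ∈ D ×ˢ D →
    |Φ (q.1, q.2.2) - Φ (q.1, q.2.1)| < 1 / 32) (by
    rintro _ ⟨z, ⟨h1, h2⟩, rfl⟩
    have c1 : ContinuousOn (fun q : E × B × B => Φ (q.1, q.2.2)) (univ ×ˢ (D ×ˢ D)) :=
      hΦ.continuousOn.comp (by fun_prop) fun q hq => ⟨mem_univ _, hq.2.2⟩
    have c2 : ContinuousOn (fun q : E × B × B => Φ (q.1, q.2.1)) (univ ×ˢ (D ×ˢ D)) :=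
      hΦ.continuousOn.comp (by fun_prop) fun q hq => ⟨mem_univ _, hq.2.1⟩
    have := ((c1.sub c2).abs (z.1, z.2, z.2) ⟨mem_univ _, h1, h1⟩).eventually
      (gt_mem_nhds (show |Φ (z.1, z.2) - Φ (z.1, z.2)| < 1 / 32 by
        rw [sub_self, abs_zero]; norm_num))
    exact (eventually_nhdsWithin_iff.1 this).mono fun q hq hqT => hq ⟨mem_univ _, hqT⟩)
  set ε' := min ε (min ε₁ ε₂) with hε'
  have hTT : nearPairs D ε' ⊆ T := fun p hp =>
    ⟨hp.1, hp.2.1, hp.2.2.trans_le (min_le_left _ _)⟩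
  have hHD : ∀ q : E × B × B, q.2 ∈ nearPairs D ε' → ‖HD q‖ ≤ 1 / 2 := by
    intro q hq
    by_cases hn : 1 / 8 < Ψ q ∧ Ψ q < 3 / 8
    · refine (hs₁ (q.1, q.2.1, q.2.1) ⟨(q.1, q.2.1), ⟨hq.1, hn.1.le, hn.2.le⟩, rfl⟩ q ?_
        (hTT hq)).le
      rw [Prod.dist_eq, Prod.dist_eq]
      simp only [dist_self]
      exact max_lt hε₁ (max_lt hε₁
        (hq.2.2.trans_le ((min_le_right _ _).trans (min_le_left _ _))))
    · have h1 : Tendsto (fun x : E => (x, q.2)) (𝓝 q.1) (𝓝[univ ×ˢ T] q) := by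
        have : ContinuousWithinAt (fun x : E => (x, q.2)) univ q.1 := by fun_prop
        simpa using this.tendsto_nhdsWithin (t := univ ×ˢ T) fun x _ => ⟨mem_univ _, hTT hq⟩
      have h2 : (fun x => H (x, q.2)) =ᶠ[𝓝 q.1] fun _ => 0 := h1.eventually (hfar q (hTT hq) hn)
      have h3 : HD q = 0 := by
        simp only [HD]
        rw [h2.fderiv_eq]
        exact fderiv_const_apply _
      rw [h3]
      norm_num
  refine ⟨ε', lt_min hε (lt_min hε₁ hε₂), H, fun z hz =>
    ⟨(hHr z (hTT hz)).mono (prod_mono_right hTT), hHD z hz, ?_⟩⟩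
  -- Values in the two fibers are known to be close only near the compact sublevel Φ ≤ 1/2, so x
  -- must lie in it for at least one of the two parameters.
  have hd : ∀ c ∈ D, dist (z.1, z.2) (z.1, c, c) < ε₂ → Φ (z.1, c) ≤ 1 / 2 →
      |Φ (z.1, z.2.2) - Φ (z.1, z.2.1)| < 1 / 32 := fun c hc h1 h2 =>
    hs₂ (z.1, c, c) ⟨(z.1, c), ⟨hc, h2⟩, rfl⟩ z h1 ⟨hz.1, hz.2.1⟩
  have hdε : dist z.2.2 z.2.1 < ε₂ :=
    hz.2.2.trans_le ((min_le_right _ _).trans (min_le_right _ _))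
  have hda : Φ (z.1, z.2.1) ≤ 1 / 2 → |Φ (z.1, z.2.2) - Φ (z.1, z.2.1)| < 1 / 32 := by
    refine hd z.2.1 hz.1 ?_
    rw [Prod.dist_eq, Prod.dist_eq]
    simp only [dist_self]
    exact max_lt hε₂ (max_lt hε₂ hdε)
  have hdb : Φ (z.1, z.2.2) ≤ 1 / 2 → |Φ (z.1, z.2.2) - Φ (z.1, z.2.1)| < 1 / 32 := by
    refine hd z.2.2 hz.2.1 ?_
    rw [Prod.dist_eq, Prod.dist_eq]
    simp only [dist_self]
    exact max_lt hε₂ (max_lt (by rwa [dist_comm]) hε₂)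
  by_cases hn : 1 / 8 < Φ (z.1, z.2.1) ∧ Φ (z.1, z.2.1) < 3 / 8
  · obtain ⟨h1, h2, h3⟩ := hσ z (hTT hz) hn.1.le hn.2.le
    have hab := abs_lt.1 (hda (by linarith [hn.2]))
    have := h1.le_quarter_iff h2 (r := β (Ψ z)) β.nonneg β.le_one
      (by simpa [h3] using hab) (fun h4 h5 => hβ1 _ (h4.trans_eq h3) (h3.symm.trans_le h5))
    rwa [h3] at this
  · have hcase : Φ (z.1, z.2.1) ≤ 1 / 8 ∨ 3 / 8 ≤ Φ (z.1, z.2.1) := by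
      by_contra! hcon
      exact hn hcon
    rw [hH0 z (hcase.imp (fun h => by simp only [hΨ]; linarith)
      fun h => by simp only [hΨ]; linarith), add_zero]
    rcases hcase with h | h
    · have := abs_lt.1 (hda (by linarith))
      exact iff_of_true (by linarith) (by linarith)
    · refine iff_of_false (fun h4 => ?_) (by linarith)
      have := abs_lt.1 (hdb (by linarith))
      linarith

theorem NoncriticalFamily.exists_local_trivialization [FiniteDimensional ℝ E]
    [FiniteDimensional ℝ B] (hΦ : NoncriticalFamily J D Φ) :
    ∃ ε > 0, ∃ F G : E × B × B → E, ∀ z : E × B × B, z.2 ∈ nearPairs D ε →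
      G (F z, z.2) = z.1 ∧ F (G z, z.2) = z.1 ∧
      (Φ (F z, z.2.2) ≤ 1 / 4 ↔ Φ (z.1, z.2.1) ≤ 1 / 4) ∧
      RegAt (Rel J) (univ ×ˢ nearPairs D ε) F z ∧ RegAt (Rel J) (univ ×ˢ nearPairs D ε) G z := by
  obtain ⟨ε, hε, H, h⟩ := hΦ.exists_level_perturbation
  obtain ⟨hbij, hGr⟩ := RegAt.invFun_id_add (fun z hz => (h z hz).1) fun z hz => (h z hz).2.1
  exact ⟨ε, hε, fun q => q.1 + H q, fun z => Function.invFun (fun x => x + H (x, z.2)) z.1,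
    fun z hz => ⟨Function.leftInverse_invFun (hbij z.2 hz).1 z.1,
      Function.rightInverse_invFun (hbij z.2 hz).2 z.1, (h z hz).2.2,
      RegAt.comp_contDiffAt (g := fun r : E × E => r.1 + r.2) (by fun_prop)
        ((RegAt.of_contDiffAt (S := univ ×ˢ nearPairs D ε) ⟨mem_univ _, hz⟩ contDiffAt_fst).prodMk
          (h z hz).1)
        ⟨mem_univ _, hz⟩, hGr z hz⟩⟩

/-- Local comparisons are composed along the points t₀ + (j/N)(t - t₀). These depend affinely on t,
so every composite has the same regularity. -/
theorem NoncriticalFamily.exists_trivialization [FiniteDimensional ℝ E]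
    [FiniteDimensional ℝ B] (hΦ : NoncriticalFamily J D Φ) (hD : IsCompact D) (hDc : Convex ℝ D)
    {t₀ : B} (ht₀ : t₀ ∈ D) :
    ∃ F G : E × B → E, ∀ z : E × B, z.2 ∈ D →
      G (F z, z.2) = z.1 ∧ F (G z, z.2) = z.1 ∧
      (Φ (F z, z.2) ≤ 1 / 4 ↔ Φ (z.1, t₀) ≤ 1 / 4) ∧
      RegAt (Rel J) (univ ×ˢ D) F z ∧ RegAt (Rel J) (univ ×ˢ D) G z := by
  obtain ⟨ε, hε, F₁, G₁, h₁⟩ := hΦ.exists_local_trivialization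
  obtain ⟨C, hC⟩ := hD.isBounded.exists_norm_le
  -- The parameter set has diameter at most 2C, so each of the N steps is shorter than ε.
  obtain ⟨N, hN⟩ := exists_nat_gt (2 * C / ε)
  have hC0 : 0 ≤ C := (norm_nonneg _).trans (hC t₀ ht₀)
  have hN0 : (0 : ℝ) < N := lt_of_le_of_lt (by positivity) hN
  set p : ℕ → B → B := fun j t => t₀ + ((j : ℝ) / N) • (t - t₀) with hp
  have hpD : ∀ j ≤ N, ∀ t ∈ D, p j t ∈ D := fun j hj t ht =>
    hDc.add_smul_sub_mem ht₀ ht ⟨by positivity, by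
      rw [div_le_one hN0]; exact_mod_cast hj⟩
  have hpp : ∀ j, j + 1 ≤ N → ∀ t ∈ D, (p j t, p (j + 1) t) ∈ nearPairs D ε := by
    intro j hj t ht
    refine ⟨hpD _ (by omega) t ht, hpD _ hj t ht, ?_⟩
    rw [dist_eq_norm]
    have : p (j + 1) t - p j t = (1 / (N : ℝ)) • (t - t₀) := by
      simp only [hp]
      rw [add_sub_add_left_eq_sub, ← sub_smul]
      congr 1
      push_cast
      ring
    rw [this, norm_smul, Real.norm_of_nonneg (by positivity), one_div, inv_mul_lt_iff₀ hN0]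
    have h2 : ‖t - t₀‖ ≤ 2 * C := (norm_sub_le _ _).trans (by linarith [hC t ht, hC t₀ ht₀])
    rw [div_lt_iff₀ hε] at hN
    linarith
  suffices h : ∀ j ≤ N, ∃ F G : E × B → E, ∀ z : E × B, z.2 ∈ D →
      G (F z, z.2) = z.1 ∧ F (G z, z.2) = z.1 ∧
      (Φ (F z, p j z.2) ≤ 1 / 4 ↔ Φ (z.1, t₀) ≤ 1 / 4) ∧
      RegAt (Rel J) (univ ×ˢ D) F z ∧ RegAt (Rel J) (univ ×ˢ D) G z by
    obtain ⟨F, G, h⟩ := h N le_rfl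
    refine ⟨F, G, fun z hz => ?_⟩
    have : p N z.2 = z.2 := by simp [hp, div_self hN0.ne']
    simpa only [this] using h z hz
  intro j
  induction j with
  | zero =>
    refine fun _ => ⟨Prod.fst, Prod.fst, fun z hz => ⟨rfl, rfl, ?_, ?_, ?_⟩⟩
    · simp [hp]
    · exact .of_contDiffAt ⟨mem_univ _, hz⟩ contDiffAt_fst
    · exact .of_contDiffAt ⟨mem_univ _, hz⟩ contDiffAt_fst
  | succ j ih =>
    intro hj
    obtain ⟨F, G, h⟩ := ih (by omega)
    have hm : ∀ f : E × B → E, MapsTo (fun z : E × B => (f z, p j z.2, p (j + 1) z.2))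
        (univ ×ˢ D) (univ ×ˢ nearPairs D ε) := fun f z hz => ⟨mem_univ _, hpp j hj z.2 hz.2⟩
    have hr : ∀ (f : E × B → E) (z : E × B), z.2 ∈ D → RegAt (Rel J) (univ ×ˢ D) f z →
        RegAt (Rel J) (univ ×ˢ D) (fun z : E × B => (f z, p j z.2, p (j + 1) z.2)) z :=
      fun f z hz hf => hf.prodMk (.of_contDiffAt ⟨mem_univ _, hz⟩
        (by simp only [hp]; fun_prop))
    have hR : ∀ (f : E × B → E) (y y' : E × B), Rel J y y' →
        Rel J (f y, p j y.2, p (j + 1) y.2) (f y', p j y'.2, p (j + 1) y'.2) :=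
      fun f y y' hy => hy.imp_right fun hy => by simp only [hy]
    refine ⟨fun z => F₁ (F z, p j z.2, p (j + 1) z.2),
      fun z => G (G₁ (z.1, p j z.2, p (j + 1) z.2), z.2), fun z hz => ⟨?_, ?_, ?_, ?_, ?_⟩⟩
    · have := (h₁ (F z, p j z.2, p (j + 1) z.2) (hpp j hj z.2 hz)).1
      simp only [this]
      exact (h z hz).1
    · have := (h (G₁ (z.1, p j z.2, p (j + 1) z.2), z.2) hz).2.1
      simp only [this]
      exact (h₁ (z.1, p j z.2, p (j + 1) z.2) (hpp j hj z.2 hz)).2.1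
    · exact (h₁ (F z, p j z.2, p (j + 1) z.2) (hpp j hj z.2 hz)).2.2.1.trans (h z hz).2.2.1
    · exact RegAt.comp (h₁ (F z, p j z.2, p (j + 1) z.2) (hpp j hj z.2 hz)).2.2.2.1
        (hr F z hz (h z hz).2.2.2.1) ⟨mem_univ _, hz⟩ (hm F) (hR F)
    · have e1 : RegAt (Rel J) (univ ×ˢ D) (fun z => G₁ (z.1, p j z.2, p (j + 1) z.2)) z :=
        RegAt.comp (h₁ (z.1, p j z.2, p (j + 1) z.2) (hpp j hj z.2 hz)).2.2.2.2
          (hr Prod.fst z hz (.of_contDiffAt ⟨mem_univ _, hz⟩ contDiffAt_fst)) ⟨mem_univ _, hz⟩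
          (hm Prod.fst) (hR Prod.fst)
      exact RegAt.comp (h (G₁ (z.1, p j z.2, p (j + 1) z.2), z.2) hz).2.2.2.2
        (e1.prodMk (.of_contDiffAt ⟨mem_univ _, hz⟩ contDiffAt_snd)) ⟨mem_univ _, hz⟩
        (fun z hz => ⟨mem_univ _, hz.2⟩) fun y y' hy => hy

end Family

/-! ### Deformation retraction of the sublevel onto the zero set. -/

section Retraction

variable {E B : Type*} [NormedAddCommGroup E] [NormedSpace ℝ E] [NormedAddCommGroup B]
  [NormedSpace ℝ B] {J : Prop} {D : Set B} {Φ : E × B → ℝ}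

/-- The pairs (s, z) for which the straight path to ρ z reaches the level 1/4 form a compact set.
None of them has Φ z = 0, since the path is then constant, so Φ z is bounded below by a positive
number on this set. -/
theorem NoncriticalFamily.exists_segment_level (hΦ : NoncriticalFamily J D Φ) {ρ : E × B → E}
    (hρ : ContinuousOn ρ (univ ×ˢ D)) (hρ' : ∀ z, z.2 ∈ D → Φ z = 0 → ρ z = z.1) :
    ∃ ε > 0, 2 * ε ≤ 1 / 4 ∧ ∀ z, z.2 ∈ D → Φ z ≤ 2 * ε → ∀ s ∈ Icc (0 : ℝ) 1,
      Φ (z.1 + s • (ρ z - z.1), z.2) ≤ 1 / 4 := by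
  set K : Set (E × B) := {z | z.2 ∈ D ∧ 0 ≤ Φ z ∧ Φ z ≤ 1 / 4} with hK
  have hKc : IsCompact K := hΦ.isCompact_shell 0 (by norm_num)
  have hKs : K ⊆ univ ×ˢ D := fun z hz => ⟨mem_univ _, hz.1⟩
  have hc : ContinuousOn (fun p : ℝ × E × B => Φ (p.2.1 + p.1 • (ρ p.2 - p.2.1), p.2.2))
      (Icc 0 1 ×ˢ K) := by
    refine hΦ.continuousOn.comp (ContinuousOn.prodMk ?_ (by fun_prop)) fun p hp =>
      ⟨mem_univ _, hp.2.1⟩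
    have : ContinuousOn (fun p : ℝ × E × B => ρ p.2) (Icc 0 1 ×ˢ K) :=
      hρ.comp continuousOn_snd fun p hp => hKs hp.2
    exact continuousOn_snd.fst.add (continuousOn_fst.smul (this.sub continuousOn_snd.fst))
  have hC : IsCompact ((Icc 0 1 ×ˢ K) ∩
      (fun p : ℝ × E × B => Φ (p.2.1 + p.1 • (ρ p.2 - p.2.1), p.2.2)) ⁻¹' Ici (1 / 4)) :=
    (isCompact_Icc.prod hKc).of_isClosed_subset (hc.preimage_isClosed_of_isClosed
      (isClosed_Icc.prod hKc.isClosed) isClosed_Ici) inter_subset_left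
  obtain ⟨m, hm, hm'⟩ : ∃ m > 0, ∀ p ∈ (Icc 0 1 ×ˢ K) ∩
      (fun p : ℝ × E × B => Φ (p.2.1 + p.1 • (ρ p.2 - p.2.1), p.2.2)) ⁻¹' Ici (1 / 4),
      m ≤ Φ p.2 := by
    rcases eq_empty_or_nonempty ((Icc 0 1 ×ˢ K) ∩
      (fun p : ℝ × E × B => Φ (p.2.1 + p.1 • (ρ p.2 - p.2.1), p.2.2)) ⁻¹' Ici (1 / 4)) with h | h
    · exact ⟨1, one_pos, by rw [h]; exact fun p hp => hp.elim⟩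
    · obtain ⟨p, hp, hmin⟩ := hC.exists_isMinOn h
        ((hΦ.continuousOn.comp continuousOn_snd fun p hp => hKs hp.1.2) :
          ContinuousOn (fun p : ℝ × E × B => Φ p.2) _)
      refine ⟨Φ p.2, (hΦ.nonneg _).lt_of_ne fun h0 => ?_, fun q hq => hmin hq⟩
      have := hp.2
      simp only [mem_preimage, hρ' _ hp.1.2.1 h0.symm, sub_self, smul_zero, add_zero, mem_Ici,
        ← h0] at this
      linarith
  refine ⟨min (1 / 8) (m / 4), by positivity, ?_, fun z hz hzm s hs => ?_⟩
  · linarith [min_le_left (1 / 8 : ℝ) (m / 4)]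
  · by_contra! hcon
    have hz1 : Φ z ≤ 1 / 4 := by linarith [min_le_left (1 / 8 : ℝ) (m / 4)]
    have := hm' (s, z) ⟨⟨hs, hz, hΦ.nonneg z, hz1⟩, hcon.le⟩
    linarith [min_le_right (1 / 8 : ℝ) (m / 4)]

/-- Pushing down along a vector field gives a deformation of a sublevel into a smaller one. -/
theorem NoncriticalFamily.exists_deformation [FiniteDimensional ℝ E] [FiniteDimensional ℝ B]
    (hΦ : NoncriticalFamily J D Φ) {ε : ℝ} (hε : 0 < ε) :
    ∃ Y : ℝ × E × B → E, ContinuousOn Y (Icc 0 1 ×ˢ {z | z.2 ∈ D ∧ Φ z ≤ 1 / 4}) ∧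
      (∀ s ∈ Icc (0 : ℝ) 1, ∀ z, z.2 ∈ D → Φ z ≤ 1 / 4 → Φ (Y (s, z), z.2) ≤ 1 / 4) ∧
      (∀ z, z.2 ∈ D → Φ z ≤ 1 / 4 → Φ (Y (1, z), z.2) ≤ 2 * ε) ∧
      (∀ z, Y (0, z) = z.1) ∧ ∀ s z, Φ z = 0 → Y (s, z) = z.1 := by
  obtain ⟨ξ, hξ, hpos⟩ := hΦ.exists_vectorField (half_pos hε)
  obtain ⟨δ, hδ, h⟩ := hΦ.exists_pos_fiberDeriv_pos hξ.continuous (c' := ε) (d := 1 / 4)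
    (half_pos hε) (half_lt_self hε) (by norm_num) hpos
  have hanti : ∀ z, z.2 ∈ D → ε ≤ Φ z → Φ z ≤ 1 / 4 →
      StrictAntiOn (fun s : ℝ => Φ (z.1 - s • ξ z, z.2)) (Icc 0 δ) := by
    intro z h1 h2 h3
    have hm : StrictMonoOn (fun s : ℝ => Φ (z.1 + s • ξ z, z.2)) (Icc (-δ) δ) := by
      have hd : ∀ s ∈ Icc (-δ) δ, HasDerivAt (fun s : ℝ => Φ (z.1 + s • ξ z, z.2))
          (fiberDeriv Φ (z.1 + s • ξ z, z.2) (ξ z)) s := fun s hs =>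
        hΦ.hasDerivAt_line h1
          (by linarith [(h z h1 h2 h3 z.2 h1 (by simpa) s (abs_le.2 hs)).1])
      refine strictMonoOn_of_deriv_pos (convex_Icc _ _)
        (fun s hs => (hd s hs).continuousAt.continuousWithinAt) fun s hs => ?_
      have hs' := interior_subset hs
      rw [(hd s hs').deriv]
      exact (h z h1 h2 h3 z.2 h1 (by simpa) s (abs_le.2 hs')).2
    intro s hs r hr hsr
    have := hm (a := -r) (b := -s) ⟨by linarith [hr.2], by linarith [hr.1]⟩
      ⟨by linarith [hs.2], by linarith [hs.1]⟩ (neg_lt_neg hsr)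
    simpa only [neg_smul, ← sub_eq_add_neg] using this
  set K : Set (E × B) := {z | z.2 ∈ D ∧ Φ z ≤ 1 / 4} with hK
  have hKs : K ⊆ univ ×ˢ D := fun z hz => ⟨mem_univ _, hz.1⟩
  -- Rises from 0 at level ε to 1 at level 2ε, so low points stay fixed and all motion takes place
  -- where ξ increases Φ.
  set χ : ℝ → ℝ := fun r => max 0 (min 1 ((r - ε) / ε)) with hχ
  have hχ0 : ∀ r, r ≤ ε → χ r = 0 := fun r hr =>
    max_eq_left ((min_le_right _ _).trans (div_nonpos_of_nonpos_of_nonneg (by linarith) hε.le))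
  have hχ1 : ∀ r, 2 * ε ≤ r → χ r = 1 := fun r hr => by
    have : 1 ≤ (r - ε) / ε := by rw [le_div_iff₀ hε]; linarith
    simp [hχ, min_eq_left this]
  have hχI : ∀ r, χ r ∈ Icc (0 : ℝ) 1 := fun r =>
    ⟨le_max_left _ _, max_le zero_le_one (min_le_left _ _)⟩
  set S : ℝ × E × B → E := fun p => p.2.1 - (p.1 * χ (Φ p.2) * δ) • ξ p.2 with hS
  have hSle : ∀ s ∈ Icc (0 : ℝ) 1, ∀ z ∈ K, Φ (S (s, z), z.2) ≤ Φ z := by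
    intro s hs z hz
    rcases le_or_gt (Φ z) ε with h1 | h1
    · simp [hS, hχ0 _ h1]
    · have h2 : s * χ (Φ z) * δ ∈ Icc 0 δ :=
        ⟨mul_nonneg (mul_nonneg hs.1 (hχI _).1) hδ.le,
          mul_le_of_le_one_left hδ.le (mul_le_one₀ hs.2 (hχI _).1 (hχI _).2)⟩
      have := (hanti z hz.1 h1.le hz.2).antitoneOn ⟨le_rfl, hδ.le⟩ h2 h2.1
      simpa using this
  have hSK : ∀ s ∈ Icc (0 : ℝ) 1, ∀ z ∈ K, (S (s, z), z.2) ∈ K := fun s hs z hz =>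
    ⟨hz.1, (hSle s hs z hz).trans hz.2⟩
  have hSc : ContinuousOn S (Icc 0 1 ×ˢ K) := by
    have h1 : ContinuousOn (fun p : ℝ × E × B => Φ p.2) (Icc 0 1 ×ˢ K) :=
      hΦ.continuousOn.comp continuousOn_snd fun p hp => hKs hp.2
    have h2 : Continuous χ := by fun_prop
    have h3 := h2.comp_continuousOn h1
    exact continuousOn_snd.fst.sub (((continuousOn_fst.mul h3).mul continuousOn_const).smul
      (hξ.continuous.comp continuous_snd).continuousOn)
  -- By compactness one full step lowers Φ by a fixed amount above the level 2ε; more than 1/(4η)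
  -- steps then suffice.
  obtain ⟨η, hη, hη'⟩ : ∃ η > 0, ∀ z ∈ K, 2 * ε ≤ Φ z → Φ (S (1, z), z.2) ≤ Φ z - η := by
    rcases eq_empty_or_nonempty {z : E × B | z.2 ∈ D ∧ 2 * ε ≤ Φ z ∧ Φ z ≤ 1 / 4} with he | he
    · exact ⟨1, one_pos, fun z hz hz' =>
        absurd (show z ∈ {z : E × B | z.2 ∈ D ∧ 2 * ε ≤ Φ z ∧ Φ z ≤ 1 / 4} from
          ⟨hz.1, hz', hz.2⟩) (by rw [he]; exact notMem_empty _)⟩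
    · have hc : ContinuousOn (fun z : E × B => Φ z - Φ (z.1 - δ • ξ z, z.2))
          {z : E × B | z.2 ∈ D ∧ 2 * ε ≤ Φ z ∧ Φ z ≤ 1 / 4} := by
        have hξc := hξ.continuous
        exact (hΦ.continuousOn.mono fun z hz => ⟨mem_univ _, hz.1⟩).sub
          (hΦ.continuousOn.comp (by fun_prop) fun z hz => ⟨mem_univ _, hz.1⟩)
      obtain ⟨w, hw, hmin⟩ := (hΦ.isCompact_shell (2 * ε) (d := 1 / 4)
        (by norm_num)).exists_isMinOn he hc
      refine ⟨Φ w - Φ (w.1 - δ • ξ w, w.2), sub_pos.2 ?_, fun z hz hz' => ?_⟩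
      · have := hanti w hw.1 (by linarith [hw.2.1]) hw.2.2 ⟨le_rfl, hδ.le⟩ ⟨hδ.le, le_rfl⟩ hδ
        simpa using this
      · have := hmin (a := z) ⟨hz.1, hz', hz.2⟩
        simp only [mem_ofPred_eq] at this
        have h5 : S (1, z) = z.1 - δ • ξ z := by simp [hS, hχ1 _ hz']
        rw [h5]
        linarith
  suffices hind : ∀ N : ℕ, ∃ Y : ℝ × E × B → E, ContinuousOn Y (Icc 0 1 ×ˢ K) ∧
      (∀ s ∈ Icc (0 : ℝ) 1, ∀ z ∈ K, (Y (s, z), z.2) ∈ K) ∧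
      (∀ z ∈ K, Φ (Y (1, z), z.2) ≤ max (2 * ε) (1 / 4 - N * η)) ∧
      (∀ z, Y (0, z) = z.1) ∧ ∀ s z, Φ z = 0 → Y (s, z) = z.1 by
    obtain ⟨N, hN⟩ := exists_nat_gt (1 / 4 / η)
    obtain ⟨Y, h1, h2, h3, h4⟩ := hind N
    refine ⟨Y, h1, fun s hs z hz hz' => (h2 s hs z ⟨hz, hz'⟩).2, fun z hz hz' => ?_, h4⟩
    rw [div_lt_iff₀ hη] at hN
    exact (h3 z ⟨hz, hz'⟩).trans (max_le le_rfl (by linarith))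
  intro N
  induction N with
  | zero =>
    exact ⟨fun p => p.2.1, continuousOn_snd.fst, fun s hs z hz => hz,
      fun z hz => le_max_of_le_right (by simpa using hz.2), fun _ => rfl, fun _ _ _ => rfl⟩
  | succ N ih =>
    obtain ⟨Y, h1, h2, h3, h4, h5⟩ := ih
    refine ⟨fun p => S (p.1, Y p, p.2.2), ?_, fun s hs z hz => hSK s hs _ (h2 s hs z hz),
      fun z hz => ?_, fun z => ?_, fun s z hz => ?_⟩
    · exact hSc.comp (continuousOn_fst.prodMk (h1.prodMk continuousOn_snd.snd))
        fun p hp => ⟨hp.1, h2 p.1 hp.1 p.2 hp.2⟩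
    · have hY := h2 1 (right_mem_Icc.2 zero_le_one) z hz
      rcases le_total (Φ (Y (1, z), z.2)) (2 * ε) with h6 | h6
      · exact le_max_of_le_left ((hSle 1 (right_mem_Icc.2 zero_le_one) _ hY).trans h6)
      · have h7 := hη' _ hY h6
        have h8 := h3 z hz
        push_cast
        rcases le_max_iff.1 h8 with h8 | h8
        · exact le_max_of_le_left (h7.trans (by linarith))
        · exact le_max_of_le_right (h7.trans (by linarith))
    · simp [hS, h4]
    · have h6 : (z.1, z.2) = z := rfl
      simp [hS, h5 s z hz, h6, hz, hχ0 0 hε.le]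

theorem NoncriticalFamily.isFiberwiseDeformationRetract [FiniteDimensional ℝ E]
    [FiniteDimensional ℝ B] (hΦ : NoncriticalFamily J D Φ) {ρ : E × B → E}
    (hρ : ContinuousOn ρ (univ ×ˢ D)) (hρ0 : ∀ z, z.2 ∈ D → Φ (ρ z, z.2) = 0)
    (hρ' : ∀ z, z.2 ∈ D → Φ z = 0 → ρ z = z.1) :
    IsFiberwiseDeformationRetract D (fun t => {x | Φ (x, t) = 0})
      (fun t => {x | Φ (x, t) ≤ 1 / 4}) := by
  obtain ⟨ε, hε, hε', hseg⟩ := hΦ.exists_segment_level hρ hρ'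
  obtain ⟨Y, h1, h2, h3, h4, h5⟩ := hΦ.exists_deformation hε
  -- The two clamped times min(2s, 1) and max(2s - 1, 0) concatenate the push and the straight path
  -- in one continuous formula.
  set f : ℝ × E × B → ℝ × E × B := fun p => (min (2 * p.1) 1, p.2) with hf
  have hfm : MapsTo f (Icc 0 1 ×ˢ {z | z.2 ∈ D ∧ Φ z ≤ 1 / 4})
      (Icc 0 1 ×ˢ {z | z.2 ∈ D ∧ Φ z ≤ 1 / 4}) := fun p hp =>
    ⟨⟨le_min (by linarith [hp.1.1]) zero_le_one, min_le_right _ _⟩, hp.2⟩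
  refine ⟨fun t ht x hx => by rw [mem_ofPred_eq] at hx ⊢; rw [hx]; norm_num,
    fun p => Y (f p) + max (2 * p.1 - 1) 0 • (ρ (Y (f p), p.2.2) - Y (f p)), ?_, ?_, ?_, ?_, ?_⟩
  · have c1 : ContinuousOn (fun p => Y (f p)) (Icc 0 1 ×ˢ {z | z.2 ∈ D ∧ Φ z ≤ 1 / 4}) :=
      h1.comp (by fun_prop) hfm
    have c2 : ContinuousOn (fun p => ρ (Y (f p), p.2.2))
        (Icc 0 1 ×ˢ {z | z.2 ∈ D ∧ Φ z ≤ 1 / 4}) :=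
      hρ.comp (c1.prodMk continuousOn_snd.snd) fun p hp => ⟨mem_univ _, hp.2.1⟩
    have c3 : Continuous fun p : ℝ × E × B => max (2 * p.1 - 1) 0 := by fun_prop
    exact c1.add (c3.continuousOn.smul (c2.sub c1))
  · intro s hs t ht x hx
    rcases le_total (2 * s) 1 with h | h
    · simp only [hf, max_eq_right (sub_nonpos.2 h), zero_smul, add_zero]
      exact h2 _ ⟨le_min (by linarith [hs.1]) zero_le_one, min_le_right _ _⟩ (x, t) ht hx
    · simp only [hf, min_eq_right h, mem_ofPred_eq]
      exact hseg (Y (1, x, t), t) ht (h3 (x, t) ht hx) _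
        ⟨le_max_right _ _, max_le (by linarith [hs.2]) zero_le_one⟩
  · intro t ht x hx
    have : f (0, x, t) = (0, x, t) := by simp [hf]
    simp only [this, h4]
    simp
  · intro t ht x hx
    have : max (2 * (1 : ℝ) - 1) 0 = 1 := by norm_num
    simp only [this, one_smul, add_sub_cancel]
    exact hρ0 (_, t) ht
  · intro s hs t ht x hx
    have : Y (f (s, x, t)) = x := h5 _ (x, t) hx
    simp only [this, hρ' (x, t) ht hx, sub_self, smul_zero, add_zero]

end Retraction

/-! ### Regular sublevel sets are C¹ domains with boundary. -/

theorem exists_openPartialHomeomorph_of_fderiv {E : Type*} [NormedAddCommGroup E]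
    [NormedSpace ℝ E] [CompleteSpace E] {f : E → E} {x : E} (hf : ContDiffAt ℝ 1 f x)
    {e' : E ≃L[ℝ] E} (hf' : HasFDerivAt f (e' : E →L[ℝ] E) x) :
    ∃ e : OpenPartialHomeomorph E E, x ∈ e.source ∧ ContDiffOn ℝ 1 e e.source ∧
      ContDiffOn ℝ 1 e.symm e.target ∧ ∀ y, e y = f y := by
  set e := hf.toOpenPartialHomeomorph f hf' one_ne_zero with he
  have hef : ∀ y, e y = f y := fun y => rfl
  have hx : x ∈ e.source := hf.mem_toOpenPartialHomeomorph_source hf' one_ne_zero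
  have h1 : ∀ᶠ y in 𝓝 x, ContDiffAt ℝ 1 e y := hf.eventually (by simp)
  have h2 : ContDiffAt ℝ 1 e.symm (e x) := hf.to_localInverse hf' one_ne_zero
  obtain ⟨U, hU, hUo, hxU⟩ := eventually_nhds_iff.1 h1
  obtain ⟨V, hV, hVo, hxV⟩ := eventually_nhds_iff.1 (h2.eventually (by simp))
  have hs : IsOpen (U ∩ (e.source ∩ e ⁻¹' V)) := hUo.inter (e.isOpen_inter_preimage hVo)
  refine ⟨e.restrOpen _ hs, ?_, ?_, ?_, hef⟩
  · rw [e.restrOpen_source]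
    exact ⟨hx, hxU, hx, hxV⟩
  · rw [e.restrOpen_source]
    exact fun y hy => (hU y hy.2.1).contDiffWithinAt
  · intro y hy
    have hy' : y ∈ e.target ∧ e.symm y ∈ U ∩ (e.source ∩ e ⁻¹' V) := by
      simpa [OpenPartialHomeomorph.restrOpen] using hy
    have hyV : y ∈ V := by
      have := hy'.2.2.2
      rwa [mem_preimage, e.right_inv hy'.1] at this
    exact (hV y hyV).contDiffWithinAt

theorem isC1DomainWithBoundary_sublevel {n : ℕ} {φ : Euc n → ℝ} (hφ : Continuous φ) {c : ℝ}
    (h : ∀ x, φ x = c → ContDiffAt ℝ 1 φ x ∧ fderiv ℝ φ x ≠ 0) :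
    IsC1DomainWithBoundary {x | φ x ≤ c} := by
  intro x hx
  rcases (show φ x ≤ c from hx).lt_or_eq with hx | hx
  · exact .inl (interior_maximal (fun y hy => (show φ y < c from hy).le)
      (isOpen_lt hφ continuous_const) hx)
  obtain ⟨h1, h2⟩ := h x hx
  set l : Euc n →L[ℝ] ℝ := -fderiv ℝ φ x with hl
  have hl0 : l ≠ 0 := neg_ne_zero.2 h2
  obtain ⟨w, hw⟩ : ∃ w, l w = 1 := by
    obtain ⟨v, hv⟩ : ∃ v, l v ≠ 0 := by
      by_contra! hcon
      exact hl0 (ContinuousLinearMap.ext hcon)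
    exact ⟨(l v)⁻¹ • v, by simp [hv]⟩
  -- Chosen so that l (f y) = c - φ y exactly while the derivative of f at x is the identity.
  set f : Euc n → Euc n := fun y => (y - x) + (c - φ y - l (y - x)) • w with hf
  have hfc : ContDiffAt ℝ 1 f x := by
    have hlc : ContDiffAt ℝ 1 (fun y => l (y - x)) x := by fun_prop
    exact (contDiffAt_id.sub contDiffAt_const).add
      (((contDiffAt_const.sub h1).sub hlc).smul contDiffAt_const)
  have hfd : HasFDerivAt f ((ContinuousLinearEquiv.refl ℝ (Euc n) : Euc n ≃L[ℝ] Euc n) :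
      Euc n →L[ℝ] Euc n) x := by
    have d1 : HasFDerivAt (fun y : Euc n => y - x) (.id ℝ (Euc n)) x := (hasFDerivAt_id x).sub_const x
    have d2 : HasFDerivAt (fun y => l (y - x)) (l.comp (.id ℝ (Euc n))) x :=
      l.hasFDerivAt.comp x d1
    have d3 := (h1.differentiableAt one_ne_zero).hasFDerivAt
    have d4 := d1.add (((d3.const_sub c).sub d2).smul_const w)
    refine d4.congr_fderiv (ContinuousLinearMap.ext fun v => ?_)
    simp [hl]
  obtain ⟨e, he1, he2, he3, he4⟩ := exists_openPartialHomeomorph_of_fderiv hfc hfd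
  refine .inr ⟨e, l, he1, he2, he3, hl0, ?_⟩
  ext y
  have : l (f y) = c - φ y := by
    simp only [hf, map_add, map_smul, hw, smul_eq_mul, mul_one]
    ring
  simp only [mem_inter_iff, mem_ofPred_eq, mem_preimage, he4, this, sub_nonneg]

/-! ### The functions Φ of a family of trees form a noncritical family. -/

section PhiFamily

variable {E : Type*} [NormedAddCommGroup E] [InnerProductSpace ℝ E] {V : Type*} {ψ : ℝ → ℝ}

section

variable [Fintype V] {G : SimpleGraph V} {B : Type*} {P : B → V → E}

open Classical in
/-- The functions `Φ` of a family of trees with vertices `P t v`. -/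
def phiFamily (ψ : ℝ → ℝ) (G : SimpleGraph V) (P : B → V → E) (z : E × B) : ℝ :=
  if z.1 ∈ treeSet G (P z.2) then 0 else Real.exp (logPhi ψ G (P z.2) z.1)

theorem phiFamily_nonneg (z : E × B) : 0 ≤ phiFamily ψ G P z := by
  rw [phiFamily]
  split_ifs
  · exact le_rfl
  · exact (Real.exp_pos _).le

theorem phiFamily_eq_zero_iff (z : E × B) :
    phiFamily ψ G P z = 0 ↔ z.1 ∈ treeSet G (P z.2) := by
  rw [phiFamily]
  split_ifs with h
  · exact iff_of_true rfl h
  · exact iff_of_false (Real.exp_ne_zero _) h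

theorem phiFamily_of_notMem {z : E × B} (h : z.1 ∉ treeSet G (P z.2)) :
    phiFamily ψ G P z = Real.exp (logPhi ψ G (P z.2) z.1) := if_neg h

end

theorem continuousOn_segDistSq_family {B : Type*} [TopologicalSpace B] {D : Set B} {P : B → V → E}
    (hc : ∀ v, ContinuousOn (fun t => P t v) D) (v w : V) :
    ContinuousOn (fun z : E × B => segDistSq z.1 (P z.2 v) (P z.2 w)) (univ ×ˢ D) := by
  have h : ∀ v, ContinuousOn (fun z : E × B => P z.2 v) (univ ×ˢ D) := fun v =>
    (hc v).comp continuousOn_snd fun z hz => hz.2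
  exact continuous_segDistSq.comp_continuousOn (continuousOn_fst.prodMk ((h v).prodMk (h w)))

theorem eventually_notMem_treeSet {B : Type*} [TopologicalSpace B] {D : Set B} {P : B → V → E}
    [Finite V] {G : SimpleGraph V} (hG : G.IsTree) (hc : ∀ v, ContinuousOn (fun t => P t v) D)
    {z : E × B} (hz : z.2 ∈ D) (h : z.1 ∉ treeSet G (P z.2)) :
    ∀ᶠ y in 𝓝[univ ×ˢ D] z, y.1 ∉ treeSet G (P y.2) := by
  obtain ⟨o⟩ := hG.connected.nonempty
  simp only [mem_treeSet_iff hG o, not_exists, ← segDistSq_eq_zero_iff] at h ⊢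
  exact eventually_all.2 fun v => (continuousOn_segDistSq_family hc v _ z ⟨mem_univ _, hz⟩).eventually
    (isOpen_ne.mem_nhds (h v))

variable {B : Type*} [NormedAddCommGroup B] {D : Set B} {P : B → V → E} [Fintype V]
  {G : SimpleGraph V}

/-- Near a point of the tree Φ is squeezed between 0 and the squared distance to a fixed edge or
vertex, which depends continuously on the point and on t. -/
theorem continuousWithinAt_phiFamily_of_mem (hG : G.IsTree) (hψ : IsProfile ψ)
    (hc : ∀ v, ContinuousOn (fun t => P t v) D) {z : E × B} (hz : z.2 ∈ D)
    (h : z.1 ∈ treeSet G (P z.2)) :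
    ContinuousWithinAt (phiFamily ψ G P) (univ ×ˢ D) z := by
  obtain ⟨v, w, h0, hle⟩ : ∃ v w, segDistSq z.1 (P z.2 v) (P z.2 w) = 0 ∧
      ∀ y : E × B, y.1 ∉ treeSet G (P y.2) →
        logPhi ψ G (P y.2) y.1 ≤ logSq ψ (segDistSq y.1 (P y.2 v) (P y.2 w)) ∧
        0 < segDistSq y.1 (P y.2 v) (P y.2 w) := by
    rcases h with ⟨v, hv⟩ | ⟨v, w, hvw, hs⟩
    · refine ⟨v, v, by rw [hv]; simp, fun y hy => ?_⟩
      rw [segDistSq_self]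
      exact ⟨logPhi_le_vertex hG hψ hy v, norm_sq_pos_of_notMem hy v⟩
    · exact ⟨v, w, segDistSq_eq_zero_iff.2 hs, fun y hy => ⟨logPhi_le_edge hG hψ hy hvw,
        segDistSq_pos_of_notMem hy hvw⟩⟩
  have hcs := continuousOn_segDistSq_family hc v w z ⟨mem_univ _, hz⟩
  have ht := hcs.tendsto
  rw [h0] at ht
  rw [ContinuousWithinAt, (phiFamily_eq_zero_iff z).2 h]
  refine squeeze_zero' (Eventually.of_forall phiFamily_nonneg) ?_ ht
  filter_upwards [ht.eventually (gt_mem_nhds (show (0 : ℝ) < 1 / 4 by norm_num))] with y hy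
  by_cases hyt : y.1 ∈ treeSet G (P y.2)
  · rw [(phiFamily_eq_zero_iff y).2 hyt]
    exact segDistSq_nonneg _ _ _
  · rw [phiFamily_of_notMem hyt]
    obtain ⟨h1, h2⟩ := hle y hyt
    exact (Real.exp_le_exp.2 h1).trans_eq (hψ.exp_logSq_of_le h2 hy.le)

variable [NormedSpace ℝ B]

/-- The trees are uniformly bounded and Φ = 1 at distance at least 3/2 from them, which gives
compactness; the only critical value off the tree is 1, which exceeds 1/2. -/
theorem noncriticalFamily_phiFamily [FiniteDimensional ℝ E] {J : Prop} (hG : G.IsTree)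
    (hψ : IsProfile ψ) (hD : IsCompact D) (hc : ∀ v, ContinuousOn (fun t => P t v) D)
    (hP : ∀ t ∈ D, AcutePaths G (P t))
    (hr : ∀ z : E × B, z.2 ∈ D → z.1 ∉ treeSet G (P z.2) →
      RegAt (Rel J) (univ ×ˢ D) (fun z : E × B => logPhi ψ G (P z.2) z.1) z) :
    NoncriticalFamily J D (phiFamily ψ G P) := by
  have hr' : ∀ z : E × B, z.2 ∈ D → z.1 ∉ treeSet G (P z.2) →
      RegAt (Rel J) (univ ×ˢ D) (phiFamily ψ G P) z := fun z hz h =>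
    (RegAt.comp_contDiffAt Real.contDiff_exp.contDiffAt (hr z hz h) ⟨mem_univ _, hz⟩).congr
      ((eventually_notMem_treeSet hG hc hz h).mono fun y hy => phiFamily_of_notMem hy)
  have hcont : ContinuousOn (phiFamily ψ G P) (univ ×ˢ D) := by
    intro z hz
    by_cases h : z.1 ∈ treeSet G (P z.2)
    · exact continuousWithinAt_phiFamily_of_mem hG hψ hc hz.2 h
    · exact (hr' z hz.2 h).continuousWithinAt hz
  have hnot : ∀ z : E × B, 0 < phiFamily ψ G P z → z.1 ∉ treeSet G (P z.2) := fun z hz h =>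
    hz.ne' ((phiFamily_eq_zero_iff z).2 h)
  refine ⟨hcont, phiFamily_nonneg, ?_, fun z hz h => hr' z hz (hnot z h),
    fun z hz h1 h2 h3 => ?_⟩
  · have hb : ∀ v, ∃ C, ∀ t ∈ D, ‖P t v‖ ≤ C := fun v => hD.exists_bound_of_continuousOn (hc v)
    choose C hC using hb
    obtain ⟨R, hR⟩ := (finite_range C).bddAbove
    have hR' : ∀ t ∈ D, treeSet G (P t) ⊆ Metric.closedBall 0 R := by
      have hv : ∀ t ∈ D, ∀ v, P t v ∈ Metric.closedBall (0 : E) R := fun t ht v =>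
        mem_closedBall_zero_iff.2 ((hC v t ht).trans (hR (mem_range_self v)))
      rintro t ht x (⟨v, rfl⟩ | ⟨v, w, -, hx⟩)
      · exact hv t ht v
      · exact (convex_closedBall (0 : E) R).segment_subset (hv t ht v) (hv t ht w) hx
    refine ((isCompact_closedBall (0 : E) (R + 3 / 2)).prod hD).of_isClosed_subset
      (t := {z : E × B | z.2 ∈ D ∧ phiFamily ψ G P z ≤ 1 / 2}) ?_ ?_
    · convert hcont.preimage_isClosed_of_isClosed (isClosed_univ.prod hD.isClosed)
        (isClosed_Iic (a := (1 : ℝ) / 2)) using 1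
      ext z
      simp
    · rintro z ⟨hz, hz'⟩
      refine ⟨?_, hz⟩
      rw [mem_closedBall_zero_iff]
      by_contra! hcon
      have hfar : ∀ y ∈ treeSet G (P z.2), 3 / 2 ≤ ‖z.1 - y‖ := fun y hy => by
        have h1 := mem_closedBall_zero_iff.1 (hR' z.2 hz hy)
        have h2 := norm_sub_norm_le z.1 y
        linarith
      have hn : z.1 ∉ treeSet G (P z.2) := fun h => by
        have := hfar z.1 h
        rw [sub_self, norm_zero] at this
        linarith
      rw [phiFamily_of_notMem hn, logPhi_eq_zero hG hψ hfar, Real.exp_zero] at hz'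
      linarith
  · have hn := hnot z h1
    obtain ⟨o⟩ := hG.connected.nonempty
    have hd := (hasFDerivAt_logPhi hG hψ hn o).differentiableAt
    have ht : Tendsto (fun x : E => (x, z.2)) (𝓝 z.1) (𝓝[univ ×ˢ D] z) := by
      have : ContinuousWithinAt (fun x : E => (x, z.2)) univ z.1 := by fun_prop
      simpa using this.tendsto_nhdsWithin (t := univ ×ˢ D) fun x _ => ⟨mem_univ _, hz⟩
    have he : (fun x => phiFamily ψ G P (x, z.2)) =ᶠ[𝓝 z.1]
        fun x => Real.exp (logPhi ψ G (P z.2) x) :=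
      (ht.eventually (eventually_notMem_treeSet hG hc hz hn)).mono fun x hx =>
        phiFamily_of_notMem hx
    rw [fiberDeriv, he.fderiv_eq, (hd.hasFDerivAt.exp).fderiv, smul_eq_zero] at h3
    have := logPhi_eq_zero_of_fderiv_eq_zero hG hψ (hP z.2 hz) hn
      (h3.resolve_left (Real.exp_ne_zero _))
    rw [phiFamily_of_notMem hn, this, Real.exp_zero] at h2
    linarith

/-- The explicit gradient is continuous in x and t because the nearest point is, even where an edge
collapses. -/
theorem regAt_logPhi_fiberwise (hG : G.IsTree) (hψ : IsProfile ψ)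
    (hc : ∀ v, ContinuousOn (fun t => P t v) D) {z : E × B} (hz : z.2 ∈ D)
    (hn : z.1 ∉ treeSet G (P z.2)) :
    RegAt (Rel False) (univ ×ˢ D) (fun z : E × B => logPhi ψ G (P z.2) z.1) z := by
  classical
  obtain ⟨o⟩ := hG.connected.nonempty
  refine RegAt.of_slice (f' := fun z => innerSL ℝ ((2 : ℝ) • halfGrad hG ψ (P z.2) z.1 o)) ?_
  filter_upwards [eventually_notMem_treeSet hG hc hz hn, self_mem_nhdsWithin] with y hy hyS
  have hPc : ∀ v, ContinuousWithinAt (fun z : E × B => P z.2 v) (univ ×ˢ D) y := fun v =>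
    (hc v y.2 hyS.2).comp continuousWithinAt_snd fun z hz => hz.2
  have hs : ∀ v w, ContinuousWithinAt (fun z : E × B => segDistSq z.1 (P z.2 v) (P z.2 w))
      (univ ×ˢ D) y := fun v w => continuousOn_segDistSq_family hc v w y hyS
  have hq : ∀ v w, ContinuousWithinAt (fun z : E × B => segProj z.1 (P z.2 v) (P z.2 w))
      (univ ×ˢ D) y := fun v w => continuous_segProj.continuousAt.comp_continuousWithinAt
        (continuousWithinAt_fst.prodMk ((hPc v).prodMk (hPc w)))
  have hnv : ∀ v, ContinuousWithinAt (fun z : E × B => ‖z.1 - P z.2 v‖ ^ 2) (univ ×ˢ D) y :=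
    fun v => (continuousWithinAt_fst.sub (hPc v)).norm.pow 2
  have hpos : ∀ v ≠ o, 0 < segDistSq y.1 (P y.2 (par hG o v)) (P y.2 v) := fun v hv =>
    segDistSq_pos_of_notMem hy (adj_par hG hv).symm
  have hl : ∀ g : E × B → ℝ, ContinuousWithinAt g (univ ×ˢ D) y → 0 < g y →
      ContinuousWithinAt (fun z => logSq ψ (g z)) (univ ×ˢ D) y := fun g hg h =>
    (hψ.contDiffAt_logSq h).continuousAt.comp_continuousWithinAt hg
  have hl' : ∀ g : E × B → ℝ, ContinuousWithinAt g (univ ×ˢ D) y → 0 < g y →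
      ContinuousWithinAt (fun z => logSqDeriv ψ (g z)) (univ ×ˢ D) y := fun g hg h =>
    (hψ.continuousAt_logSqDeriv h).comp_continuousWithinAt hg
  refine ⟨?_, ?_, hasFDerivAt_logPhi hG hψ hy o⟩
  · simp only [logPhi_eq hG ψ _ _ o]
    refine (hl _ (hnv o) (norm_sq_pos_of_notMem hy o)).add (tendsto_finsetSum _ fun v hv => ?_)
    exact (hl _ (hs _ v) (hpos v (Finset.ne_of_mem_erase hv))).sub
      (hl _ (hnv _) (norm_sq_pos_of_notMem hy _))
  · refine (innerSL ℝ (E := E)).continuous.continuousAt.comp_continuousWithinAt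
      (continuousWithinAt_const.smul ?_)
    unfold halfGrad gradTerm
    refine ((hl' _ (hnv o) (norm_sq_pos_of_notMem hy o)).smul
      (continuousWithinAt_fst.sub (hPc o))).add (tendsto_finsetSum _ fun v hv => ?_)
    exact ((hl' _ (hs _ v) (hpos v (Finset.ne_of_mem_erase hv))).smul
      (continuousWithinAt_fst.sub (hq _ v))).sub
      ((hl' _ (hnv _) (norm_sq_pos_of_notMem hy _)).smul (continuousWithinAt_fst.sub (hPc _)))

/-- In terms of length and direction, the squared distance to an edge is built from C¹ functions and
max(0, ·)², so it is jointly C¹ without assuming that the length is positive. -/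
theorem regAt_logPhi_joint {J : Prop} (hG : G.IsTree) (hψ : IsProfile ψ)
    (hc : ∀ v, ContDiffOn ℝ 1 (fun t => P t v) D)
    (hdir : ∀ v w, G.Adj v w → ∃ (len : B → ℝ) (dir : B → E), ContDiffOn ℝ 1 len D ∧
      ContDiffOn ℝ 1 dir D ∧ ∀ t ∈ D, 0 ≤ len t ∧ dir t ≠ 0 ∧ P t w - P t v = len t • dir t)
    {z : E × B} (hz : z.2 ∈ D) (hn : z.1 ∉ treeSet G (P z.2)) :
    RegAt (Rel J) (univ ×ˢ D) (fun z : E × B => logPhi ψ G (P z.2) z.1) z := by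
  classical
  obtain ⟨o⟩ := hG.connected.nonempty
  have hzS : z ∈ (univ ×ˢ D : Set (E × B)) := ⟨mem_univ _, hz⟩
  have hm : MapsTo Prod.snd (univ ×ˢ D : Set (E × B)) D := fun z hz => hz.2
  have hPc : ∀ v, ContDiffWithinAt ℝ 1 (fun z : E × B => P z.2 v) (univ ×ˢ D) z := fun v =>
    (hc v z.2 hz).comp z contDiffWithinAt_snd hm
  have hnv : ∀ v, ContDiffWithinAt ℝ 1 (fun z : E × B => ‖z.1 - P z.2 v‖ ^ 2) (univ ×ˢ D) z :=
    fun v => (contDiffWithinAt_fst.sub (hPc v)).norm_sq ℝ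
  have hs : ∀ v w, G.Adj v w → ContDiffWithinAt ℝ 1
      (fun z : E × B => segDistSq z.1 (P z.2 v) (P z.2 w)) (univ ×ˢ D) z := by
    intro v w hvw
    obtain ⟨len, dir, hl, hd, h⟩ := hdir v w hvw
    have hl' : ContDiffWithinAt ℝ 1 (fun z : E × B => len z.2) (univ ×ˢ D) z :=
      (hl z.2 hz).comp z contDiffWithinAt_snd hm
    have hd' : ContDiffWithinAt ℝ 1 (fun z : E × B => dir z.2) (univ ×ˢ D) z :=
      (hd z.2 hz).comp z contDiffWithinAt_snd hm
    have hi := (contDiffWithinAt_fst.sub (hPc v)).inner ℝ hd'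
    have hdn := hd'.norm_sq ℝ
    have h1 := contDiff_max_zero_sq.contDiffAt.comp_contDiffWithinAt z hi
    have h2 := contDiff_max_zero_sq.contDiffAt.comp_contDiffWithinAt z (hi.sub (hl'.mul hdn))
    have h3 := (hnv v).sub ((h1.sub h2).div hdn (by simpa using (h z.2 hz).2.1))
    exact h3.congr_of_mem (fun y hy => segDistSq_eq (h y.2 hy.2).1 (h y.2 hy.2).2.1
      (h y.2 hy.2).2.2) hzS
  refine .of_contDiffWithinAt hzS ?_
  have hL : ∀ s : ℝ, 0 < s → ContDiffAt ℝ 1 (logSq ψ) s := fun s hs =>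
    (hψ.contDiffAt_logSq hs).of_le (by simp)
  simp only [logPhi_eq hG ψ _ _ o]
  refine ((hL _ (norm_sq_pos_of_notMem hn o)).comp_contDiffWithinAt z (hnv o)).add
    (ContDiffWithinAt.sum fun v hv => ?_)
  have hadj := (adj_par hG (Finset.ne_of_mem_erase hv)).symm
  exact ((hL _ (segDistSq_pos_of_notMem hn hadj)).comp_contDiffWithinAt z (hs _ v hadj)).sub
    ((hL _ (norm_sq_pos_of_notMem hn _)).comp_contDiffWithinAt z (hnv _))

end PhiFamily

/-! ### From noncritical families to bundles. -/

section Bundles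

variable {E B : Type*} [NormedAddCommGroup E] [NormedSpace ℝ E] [NormedAddCommGroup B]
  [NormedSpace ℝ B] {D : Set B} {Φ : E × B → ℝ} {A M : B → Set E}

theorem totalSpace_congr {X Q : Type*} {D : Set Q} {M M' : Q → Set X} (h : ∀ t ∈ D, M t = M' t) :
    totalSpace D M = totalSpace D M' := by
  ext q
  exact and_congr_right fun hq => by rw [h _ hq]

theorem IsFiberwiseDeformationRetract.congr {X Q : Type*} [TopologicalSpace X]
    [TopologicalSpace Q] {D : Set Q} {A M A' M' : Q → Set X}
    (h : IsFiberwiseDeformationRetract D A M) (hA : ∀ t ∈ D, A' t = A t)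
    (hM : ∀ t ∈ D, M' t = M t) : IsFiberwiseDeformationRetract D A' M' := by
  obtain ⟨h0, H, h1, h2, h3, h4, h5⟩ := h
  refine ⟨fun t ht => by rw [hA t ht, hM t ht]; exact h0 t ht, H, ?_, fun s hs t ht x hx => ?_,
    fun t ht x hx => ?_, fun t ht x hx => ?_, fun s hs t ht x hx => ?_⟩
  · rwa [totalSpace_congr hM]
  · rw [hM t ht] at hx ⊢
    exact h2 s hs t ht x hx
  · exact h3 t ht x (hM t ht ▸ hx)
  · rw [hA t ht]
    exact h4 t ht x (hM t ht ▸ hx)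
  · exact h5 s hs t ht x (hA t ht ▸ hx)

theorem isFiberwiseC1_of_regAt {J : Prop} {F : E × B → E}
    (h : ∀ z : E × B, z.2 ∈ D → RegAt (Rel J) (univ ×ˢ D) F z) (M : B → Set E) :
    IsFiberwiseC1 D M F := by
  have hs : totalSpace D M ⊆ univ ×ˢ D := fun z hz => ⟨mem_univ _, hz.1⟩
  exact ⟨fun z hz => ((h z hz.1).continuousWithinAt ⟨mem_univ _, hz.1⟩).mono hs,
    fun z => fderiv ℝ (fun x => F (x, z.2)) z.1,
    fun z hz => ((h z hz.1).continuousWithinAt_fderiv_slice hz.1).mono hs,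
    fun t ht x _ => ((h (x, t) ht).differentiableAt_slice ht).hasFDerivAt.hasFDerivWithinAt⟩

theorem NoncriticalFamily.exists_isTrivialization [FiniteDimensional ℝ E] [FiniteDimensional ℝ B]
    {J : Prop} (hΦ : NoncriticalFamily J D Φ) (hD : IsCompact D) (hDc : Convex ℝ D)
    (hM : ∀ t ∈ D, M t = {x | Φ (x, t) ≤ 1 / 4}) {t₀ : B} (ht₀ : t₀ ∈ D) :
    ∃ F G : E × B → E, IsTrivialization D (M t₀) M F G ∧
      (∀ z : E × B, z.2 ∈ D → RegAt (Rel J) (univ ×ˢ D) F z) ∧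
      ∀ z : E × B, z.2 ∈ D → RegAt (Rel J) (univ ×ˢ D) G z := by
  obtain ⟨F, G, h⟩ := hΦ.exists_trivialization hD hDc ht₀
  refine ⟨F, G, ⟨fun t ht x hx => ?_, fun t ht y hy => ?_, fun t ht x _ => (h (x, t) ht).1,
    fun t ht y _ => (h (y, t) ht).2.1⟩, fun z hz => (h z hz).2.2.2.1,
    fun z hz => (h z hz).2.2.2.2⟩
  · rw [hM t ht]
    rw [hM t₀ ht₀] at hx
    exact (h (x, t) ht).2.2.1.2 hx
  · rw [hM t ht] at hy
    rw [hM t₀ ht₀]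
    have h1 := (h (G (y, t), t) ht).2.2.1
    rw [(h (y, t) ht).2.1] at h1
    exact h1.1 hy

theorem NoncriticalFamily.variesContinuouslyInC1 [FiniteDimensional ℝ E] [FiniteDimensional ℝ B]
    {J : Prop} (hΦ : NoncriticalFamily J D Φ) (hD : IsCompact D) (hDc : Convex ℝ D)
    (hM : ∀ t ∈ D, M t = {x | Φ (x, t) ≤ 1 / 4}) : VariesContinuouslyInC1 D M := fun t₀ ht₀ => by
  obtain ⟨F, G, h, hF, hG⟩ := hΦ.exists_isTrivialization hD hDc hM ht₀
  exact ⟨F, G, h, isFiberwiseC1_of_regAt hF _, isFiberwiseC1_of_regAt hG _⟩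

theorem NoncriticalFamily.isC1ProductBundle [FiniteDimensional ℝ E] [FiniteDimensional ℝ B]
    (hΦ : NoncriticalFamily True D Φ) (hD : IsCompact D) (hDc : Convex ℝ D)
    (hM : ∀ t ∈ D, M t = {x | Φ (x, t) ≤ 1 / 4}) : IsC1ProductBundle D M := fun t₀ ht₀ => by
  obtain ⟨F, G, h, hF, hG⟩ := hΦ.exists_isTrivialization hD hDc hM ht₀
  have key : ∀ F : E × B → E, (∀ z : E × B, z.2 ∈ D → RegAt (Rel True) (univ ×ˢ D) F z) →
      ContDiffOn ℝ 1 F (univ ×ˢ D) := fun F hF z hz =>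
    (hF z hz.2).contDiffWithinAt hz fun _ _ => .inl trivial
  exact ⟨F, G, h, (key F hF).mono fun z hz => ⟨mem_univ _, hz.2⟩,
    (key G hG).mono fun z hz => ⟨mem_univ _, hz.1⟩⟩

end Bundles

/-! ### Single trees and families of trees. -/

section Trees

variable {n : ℕ} {ψ : ℝ → ℝ}

theorem IsCollapsingMap.W_eq {V : Type*} [Fintype V] {G : SimpleGraph V} {T : LinearTree n}
    {f : V → T.verts} (hf : IsCollapsingMap G T f) (hψ : IsProfile ψ) {B : Type*} {t : B}
    {P : B → V → Euc n} (hP : P t = fun v => (f v : Euc n)) :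
    T.W ψ = {x | phiFamily ψ G P (x, t) ≤ 1 / 4} := by
  ext x
  have : T.Phi ψ x = phiFamily ψ G P (x, t) := by
    rw [hf.phi_eq hψ, phiFamily, hP]
  rw [LinearTree.W, mem_preimage, this]
  exact and_iff_right (phiFamily_nonneg _)

theorem IsCollapsingMap.carrier_eq {V : Type*} [Fintype V] {G : SimpleGraph V} {T : LinearTree n}
    {f : V → T.verts} (hf : IsCollapsingMap G T f) {B : Type*} {t : B}
    {P : B → V → Euc n} (hP : P t = fun v => (f v : Euc n)) :
    T.carrier = {x | phiFamily ψ G P (x, t) = 0} := by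
  ext x
  rw [mem_ofPred_eq, phiFamily_eq_zero_iff, hP, hf.treeSet_eq]

theorem NoncriticalFamily.isFiberwiseDeformationRetract_tree {B : Type*} [NormedAddCommGroup B]
    [NormedSpace ℝ B] [FiniteDimensional ℝ B] {J : Prop} {D : Set B} {V : Type*} [Fintype V]
    {G : SimpleGraph V} (hG : G.IsTree) (hψ : IsProfile ψ) {T : B → LinearTree n}
    {f : (t : B) → V → (T t).verts} (hf : ∀ t ∈ D, IsCollapsingMap G (T t) (f t))
    (hc : ∀ v, ContinuousOn (fun t => (f t v : Euc n)) D)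
    (hΦ : NoncriticalFamily J D (phiFamily ψ G fun t v => (f t v : Euc n))) :
    IsFiberwiseDeformationRetract D (fun t => (T t).carrier) fun t => (T t).W ψ := by
  obtain ⟨ρ, h1, h2, h3⟩ := exists_fiberwise_retraction hG hf hc
  exact (hΦ.isFiberwiseDeformationRetract h1
    (fun z hz => (phiFamily_eq_zero_iff _).2 (h2 z.2 hz z.1))
    fun z hz h => h3 z.2 hz z.1 ((phiFamily_eq_zero_iff _).1 h)).congr
    (fun t ht => (hf t ht).carrier_eq rfl) fun t ht => (hf t ht).W_eq hψ rfl

theorem isCollapsingMap_id (T : LinearTree n) : IsCollapsingMap T.graph T id where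
  map_edge v w h := .inr h
  fiber_vertex p := by
    have : Subsingleton {v | id v = p} := ⟨fun a b => Subtype.ext (a.2.trans b.2.symm)⟩
    have : Nonempty {v | id v = p} := ⟨⟨p, rfl⟩⟩
    exact .of_subsingleton
  fiber_edge e' he' := ⟨e', ⟨he', by simp⟩, fun e he => by simpa using he.2⟩

/-- A single tree is treated as a constant family over the one-point set {0} in ℝ, with every edge
of length 1 times its edge vector; joint and fiberwise regularity are then both available. -/
theorem LinearTree.IsTaut.noncriticalFamily (hψ : IsProfile ψ) {T : LinearTree n}
    (hT : T.IsTaut) :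
    NoncriticalFamily True {(0 : ℝ)} (phiFamily ψ T.graph fun _ v => (v : Euc n)) := by
  have hP : AcutePaths T.graph fun v => (v : Euc n) := (isCollapsingMap_id T).acutePaths hT
  have hdir : ∀ v w : T.verts, T.graph.Adj v w → ∃ (len : ℝ → ℝ) (dir : ℝ → Euc n),
      ContDiffOn ℝ 1 len {0} ∧ ContDiffOn ℝ 1 dir {0} ∧
      ∀ t ∈ ({0} : Set ℝ), 0 ≤ len t ∧ dir t ≠ 0 ∧ (w : Euc n) - v = len t • dir t :=
    fun v w hvw => ⟨fun _ => 1, fun _ => (w : Euc n) - v, contDiffOn_const, contDiffOn_const,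
      fun t _ => ⟨zero_le_one, sub_ne_zero.2 fun h => hvw.ne (Subtype.ext h.symm),
        (one_smul ℝ ((w : Euc n) - v)).symm⟩⟩
  exact noncriticalFamily_phiFamily (P := fun (_ : ℝ) (v : T.verts) => (v : Euc n)) T.isTree hψ
    isCompact_singleton (fun v => continuousOn_const) (fun t _ => hP) fun z hz hn =>
    regAt_logPhi_joint (P := fun (_ : ℝ) (v : T.verts) => (v : Euc n)) T.isTree hψ
      (fun v => contDiffOn_const) hdir hz hn

theorem NoncriticalFamily.continuous_fiber {Φ : Euc n × ℝ → ℝ}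
    (hΦ : NoncriticalFamily True {0} Φ) : Continuous fun x => Φ (x, 0) :=
  hΦ.continuousOn.comp_continuous (f := fun x : Euc n => (x, (0 : ℝ))) (by fun_prop)
    fun x => mk_mem_prod (mem_univ _) rfl

theorem NoncriticalFamily.isC1DomainWithBoundary {Φ : Euc n × ℝ → ℝ}
    (hΦ : NoncriticalFamily True {0} Φ) : IsC1DomainWithBoundary {x | Φ (x, 0) ≤ 1 / 4} := by
  refine isC1DomainWithBoundary_sublevel hΦ.continuous_fiber fun x hx => ⟨?_, ?_⟩
  · have h0 : (x, (0 : ℝ)) ∈ (univ ×ˢ {0} : Set (Euc n × ℝ)) := mk_mem_prod (mem_univ _) rfl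
    have h1 : ContDiffWithinAt ℝ 1 Φ (univ ×ˢ {0}) (x, 0) :=
      (hΦ.regAt (x, 0) rfl (by rw [hx]; norm_num)).contDiffWithinAt h0 fun _ _ => .inl trivial
    have h2 : ContDiffWithinAt ℝ 1 (fun x : Euc n => (x, (0 : ℝ))) univ x :=
      (contDiff_prodMk_left _).contDiffWithinAt
    have h3 : MapsTo (fun x : Euc n => (x, (0 : ℝ))) univ (univ ×ˢ {0}) := fun y _ =>
      mk_mem_prod (mem_univ _) rfl
    exact contDiffWithinAt_univ.1 (h1.comp x h2 h3)
  · exact hΦ.fiberDeriv_ne_zero (x, 0) rfl (by rw [hx]; norm_num) (by rw [hx]; norm_num)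

theorem NoncriticalFamily.isC1Thickening {Φ : Euc n × ℝ → ℝ}
    (hΦ : NoncriticalFamily True {0} Φ)
    (hret : IsFiberwiseDeformationRetract {(0 : ℝ)} (fun t => {x | Φ (x, t) = 0})
      fun t => {x | Φ (x, t) ≤ 1 / 4}) :
    IsC1Thickening {x | Φ (x, 0) = 0} {x | Φ (x, 0) ≤ 1 / 4} := by
  refine ⟨?_, hΦ.isC1DomainWithBoundary, fun x hx => ?_, ?_⟩
  · have h := (hΦ.isCompact_shell 0 (d := 1 / 4) (by norm_num)).image continuous_fst
    have e : {x | Φ (x, 0) ≤ 1 / 4} =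
        Prod.fst '' {z : Euc n × ℝ | z.2 ∈ ({0} : Set ℝ) ∧ 0 ≤ Φ z ∧ Φ z ≤ 1 / 4} := by
      ext x : 1
      constructor
      · exact fun hx => ⟨(x, 0), ⟨rfl, hΦ.nonneg _, hx⟩, rfl⟩
      · rintro ⟨⟨y, t⟩, ⟨rfl, -, h⟩, rfl⟩
        exact h
    rwa [e]
  · have ho : IsOpen {x | Φ (x, 0) < 1 / 4} := isOpen_lt hΦ.continuous_fiber continuous_const
    refine interior_maximal (t := {x | Φ (x, 0) < 1 / 4})
      (fun y (hy : Φ (y, 0) < 1 / 4) => hy.le) ho ?_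
    rw [mem_ofPred_eq] at hx ⊢
    rw [hx]
    norm_num
  · obtain ⟨h0, H, h1, h2, h3, h4, h5⟩ := hret
    refine ⟨h0 0 rfl, fun p => H (p.1, p.2, 0), ?_, fun s hs => h2 s hs 0 rfl, h3 0 rfl, h4 0 rfl,
      fun s hs => h5 s hs 0 rfl⟩
    exact h1.comp (by fun_prop) fun p hp => ⟨hp.1, rfl, hp.2⟩

theorem LinearTree.IsTaut.isC1Thickening (hψ : IsProfile ψ) {T : LinearTree n} (hT : T.IsTaut) :
    IsC1Thickening T.carrier (T.W ψ) := by
  have hf := isCollapsingMap_id T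
  have hΦ := hT.noncriticalFamily hψ
  have hW := hf.W_eq (t := (0 : ℝ)) (P := fun _ v => (v : Euc n)) hψ rfl
  have hA := hf.carrier_eq (ψ := ψ) (t := (0 : ℝ)) (P := fun _ v => (v : Euc n)) rfl
  rw [hW, hA]
  refine hΦ.isC1Thickening ((NoncriticalFamily.isFiberwiseDeformationRetract_tree
    (T := fun _ => T) (f := fun _ => id) T.isTree hψ (fun _ _ => hf)
    (fun v => continuousOn_const) hΦ).congr ?_ ?_)
  · rintro t rfl
    exact hA.symm
  · rintro t rfl
    exact hW.symm

end Trees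

end TreeThickening

end

open TreeThickening in
theorem mainTheorem7 (n : ℕ) (ψ : ℝ → ℝ) (hψ : IsProfile ψ) :
    (∀ T : LinearTree n, T.IsTaut → IsC1Thickening T.carrier (T.W ψ)) ∧
    (∀ (k : ℕ) (V : Type*) [Fintype V] (S : SmoothTreeFamily n k V),
      (∀ t ∈ simplex k, (S.T t).IsTaut) →
        VariesContinuouslyInC1 (simplex k) (fun t => (S.T t).W ψ) ∧
        IsFiberwiseDeformationRetract (simplex k) (fun t => (S.T t).carrier)
          (fun t => (S.T t).W ψ) ∧
        (S.HasSmoothEdgeDirections →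
          IsC1ProductBundle (simplex k) (fun t => (S.T t).W ψ))) := by
  refine ⟨fun T hT => hT.isC1Thickening hψ, fun k V _ S hS => ?_⟩
  have hD : IsCompact (simplex k) := isCompact_stdSimplex ℝ _
  have hDc : Convex ℝ (simplex k) := convex_stdSimplex ℝ _
  have hc := fun v => (S.smooth v).continuousOn
  have hP := fun t ht => (S.collapsing t ht).acutePaths (hS t ht)
  have hM := fun t ht => (S.collapsing t ht).W_eq (t := t)
    (P := fun t v => (S.f t v : Euc n)) hψ rfl
  have hΦ := noncriticalFamily_phiFamily S.isTree hψ hD hc hP fun z hz hn =>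
    regAt_logPhi_fiberwise S.isTree hψ hc hz hn
  refine ⟨hΦ.variesContinuouslyInC1 hD hDc hM, NoncriticalFamily.isFiberwiseDeformationRetract_tree
    S.isTree hψ S.collapsing hc hΦ, fun hdir => ?_⟩
  -- The same functions Φ, now noncritical with joint regularity; only the regularity of log Φ is
  -- proved anew.
  have hΦ' : NoncriticalFamily True (simplex k)
      (phiFamily ψ S.G fun t v => (S.f t v : Euc n)) :=
    noncriticalFamily_phiFamily S.isTree hψ hD hc hP fun z hz hn =>
      regAt_logPhi_joint S.isTree hψ (fun v => (S.smooth v).of_le (by simp)) (fun v w hvw => by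
        obtain ⟨len, dir, h1, h2, h3⟩ := hdir v w hvw
        exact ⟨len, dir, h1.of_le (by simp), h2.of_le (by simp), h3⟩) hz hn
  exact hΦ'.isC1ProductBundle hD hDc hM
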